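/- Let $\mathscr F=\mathbb R^3\times SO(3)$ be the bundle of oriented Euclidean orthonormal frames $({\mathbf x};e_1,e_2,e_3)$ on $\mathbb R^3$, with canonical 1-forms $\eta^i$, $\eta^i_j$ defined by $d{\mathbf x}=e_i\,\eta^i$, $de_i=e_j\,\eta^j_i$. Let $U$ be either $\mathscr F$ itself or, more generally, a non-empty connected open subset of $\mathscr F$, and let $\mathcal I$ be the ideal of smooth differential forms on $U$ (under the wedge product) generated by $$\eta^3,\qquad d\eta^3,\qquad \Psi=\eta^3_1\wedge\eta^3_2+\eta^1\wedge\eta^2$$ (it is closed under $d$, and is the Monge–Ampère system for pseudospherical surfaces, i.e. surfaces with Gauss curvature $K=-1$, pulled back to the frame bundle). Let $\mathfrak S_{\mathcal I}$ be the space of infinitesimal symmetries, i.e. of smooth vector fields $\mathsf v$ on $U$ with $\mathcal L_{\mathsf v}\varphi\in\mathcal I$ for all $\varphi\in\mathcal I$. Let $\mathfrak C_{\mathcal I}$ be the space of Cauchy characteristic vector fields, i.e. of those with $\mathsf v\lrcorner\varphi\in\mathcal I$ for all $\varphi\in\mathcal I$. Let $\mathfrak e$ be the space of infinitesimal Euclidean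 motions, i.e. of the vector fields on $U$ along which ${\mathbf x}$ has velocity $M{\mathbf x}+b$ and each $e_i$ has velocity $Me_i$, where $M$ is a constant skew-symmetric $3\times 3$ matrix and $b\in\mathbb R^3$ is constant. Then: 1. $\mathfrak S_{\mathcal I}=\mathfrak C_{\mathcal I}+\mathfrak e$; 2. $\mathfrak C_{\mathcal I}$ consists exactly of the infinitesimal rotations of the frame in the $e_1e_2$-plane, i.e. of the vector fields that fix ${\mathbf x}$ and $e_3$ and along which $e_1$ has velocity $f e_2$ and $e_2$ has velocity $-f e_1$, for some smooth function $f$ on $U$; 3. $\dim_{\mathbb R}\,\mathfrak S_{\mathcal I}/\mathfrak C_{\mathcal I}=6$. -/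

import Mathlib

/-! ### Differential forms over the vector fields of a smooth function algebra

For an algebra `A` of smooth functions, vector fields are the derivations of `A` and
differential forms of degree `k` are the `A`-multilinear alternating maps in `k` vector fields. -/

noncomputable section

/-- Vector fields: derivations of the algebra `A` of smooth functions. The bracket of vector fields
is the commutator bracket of derivations. -/
abbrev VField (A : Type) [CommRing A] [Algebra ℝ A] : Type := Derivation ℝ A A

/-- Differential `k`-forms: alternating `A`-multilinear maps of vector fields. -/
abbrev DForm (A : Type) [CommRing A] [Algebra ℝ A] (k : ℕ) : Type :=
  (VField A) [⋀^Fin k]→ₗ[A] A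

namespace DForm

variable {A : Type} [CommRing A] [Algebra ℝ A]

/-- The differential `df` of a function, `df(X) = X f`. -/
def d₀ (f : A) : DForm A 1 :=
  AlternatingMap.ofSubsingleton A (VField A) A (0 : Fin 1)
    { toFun := fun X => X f
      map_add' := fun _ _ => rfl
      map_smul' := fun _ _ => rfl }

/-- The exterior derivative of a 1-form, `dα(X, Y) = X(α(Y)) - Y(α(X)) - α([X, Y])`. -/
def d₁ (α : DForm A 1) : DForm A 2 where
  toFun w := w 0 (α ![w 1]) - w 1 (α ![w 0]) - α ![⁅w 0, w 1⁆]
  map_update_add' := by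
    have hc : ∀ X : VField A, Function.const (Fin 1) X = ![X] := fun X => by
      ext l; fin_cases l; rfl
    have ha : ∀ X Y : VField A, α ![X + Y] = α ![X] + α ![Y] := fun X Y => by
      have h := α.map_update_add ![0] 0 X Y
      simpa only [Matrix.cons_val_fin_one, Function.update_eq_const_of_subsingleton, hc] using h
    intro inst w i X Y
    obtain rfl : inst = instDecidableEqFin 2 := Subsingleton.elim _ _
    fin_cases i <;> simp [ha] <;> ring
  map_update_smul' := by
    have hc : ∀ X : VField A, Function.const (Fin 1) X = ![X] := fun X => by
      ext l; fin_cases l; rfl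
    have ha : ∀ X Y : VField A, α ![X + Y] = α ![X] + α ![Y] := fun X Y => by
      have h := α.map_update_add ![0] 0 X Y
      simpa only [Matrix.cons_val_fin_one, Function.update_eq_const_of_subsingleton, hc] using h
    have hs : ∀ (c : A) (X : VField A), α ![c • X] = c * α ![X] := fun c X => by
      have h := α.map_update_smul ![0] 0 c X
      simpa only [Matrix.cons_val_fin_one, Function.update_eq_const_of_subsingleton, hc, smul_eq_mul] using h
    have hn : ∀ X : VField A, α ![-X] = - α ![X] := fun X => by
      simpa using hs (-1) X
    have h1 : ∀ (c : A) (X Y : VField A), ⁅X, c • Y⁆ = X c • Y + c • ⁅X, Y⁆ := fun c X Y => by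
      ext a
      simp [Derivation.commutator_apply]
      ring
    have h2 : ∀ (c : A) (X Y : VField A), ⁅c • X, Y⁆ = -(Y c • X) + c • ⁅X, Y⁆ := fun c X Y => by
      ext a
      simp [Derivation.commutator_apply]
      ring
    intro inst w i c X
    obtain rfl : inst = instDecidableEqFin 2 := Subsingleton.elim _ _
    fin_cases i <;> simp [ha, hs, hn, h1, h2] <;> ring
  map_eq_zero_of_eq' := by
    have h0 : α ![(0 : VField A)] = 0 := α.map_coord_zero 0 rfl
    intro w i j hw hij
    have h : w 0 = w 1 := by
      fin_cases i <;> fin_cases j <;> simp_all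
    simp [h, h0]

/-- The wedge product of differential forms (the sum over shuffles). -/
def wedge {j k : ℕ} (α : DForm A j) (β : DForm A k) : DForm A (j + k) :=
  ((LinearMap.mul' A A).compAlternatingMap (α.domCoprod β)).domDomCongr finSumFinEquiv

/-- The Lie derivative of a differential form,
`(L_v φ)(w₁, …, w_k) = v(φ(w₁, …, w_k)) - ∑ᵢ φ(w₁, …, [v, wᵢ], …, w_k)`. -/
def lieDeriv {k : ℕ} (v : VField A) (φ : DForm A k) : DForm A k where
  toFun w := v (φ w) - ∑ i, φ (Function.update w i ⁅v, w i⁆)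
  map_update_add' := by
    intro inst w i X Y
    obtain rfl : inst = instDecidableEqFin k := Subsingleton.elim _ _
    have key : ∀ l, φ (Function.update (Function.update w i (X + Y)) l
          ⁅v, Function.update w i (X + Y) l⁆) =
        φ (Function.update (Function.update w i X) l ⁅v, Function.update w i X l⁆) +
        φ (Function.update (Function.update w i Y) l ⁅v, Function.update w i Y l⁆) := by
      intro l
      by_cases hl : l = i
      · subst hl
        simp [AlternatingMap.map_update_add]
      · simp [Function.update_of_ne hl, Function.update_comm (Ne.symm hl),
          AlternatingMap.map_update_add]
    simp only [key, Finset.sum_add_distrib, AlternatingMap.map_update_add, map_add]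
    ring
  map_update_smul' := by
    intro inst w i c X
    obtain rfl : inst = instDecidableEqFin k := Subsingleton.elim _ _
    have h1 : ⁅v, c • X⁆ = v c • X + c • ⁅v, X⁆ := by
      ext a
      simp [Derivation.commutator_apply]
      ring
    have key : ∀ l, φ (Function.update (Function.update w i (c • X)) l
          ⁅v, Function.update w i (c • X) l⁆) =
        c * φ (Function.update (Function.update w i X) l ⁅v, Function.update w i X l⁆) +
        if l = i then v c * φ (Function.update w i X) else 0 := by
      intro l
      by_cases hl : l = i
      · subst hl
        simp [AlternatingMap.map_update_add, AlternatingMap.map_update_smul, h1]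
        ring
      · simp [hl, Function.update_comm (Ne.symm hl),
          AlternatingMap.map_update_smul]
    simp only [key, Finset.sum_add_distrib, AlternatingMap.map_update_smul, smul_eq_mul,
      Derivation.leibniz, Finset.sum_ite_eq', Finset.mem_univ, if_true, ← Finset.mul_sum]
    ring
  map_eq_zero_of_eq' := by
    intro w i j hw hij
    have key : ∑ l, φ (Function.update w l ⁅v, w l⁆) = 0 := by
      rw [Finset.sum_eq_add_of_mem i j (Finset.mem_univ _) (Finset.mem_univ _) hij]
      · have : Function.update w j ⁅v, w j⁆ =
            (Function.update w i ⁅v, w i⁆) ∘ Equiv.swap i j := by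
          ext1 l
          by_cases h1 : l = i
          · subst h1
            simp [Function.update_of_ne hij, Function.update_of_ne hij.symm, hw]
          · by_cases h2 : l = j
            · subst h2
              simp [hw]
            · simp [Equiv.swap_apply_of_ne_of_ne h1 h2, Function.update_of_ne h1,
                Function.update_of_ne h2]
        rw [this, AlternatingMap.map_swap _ _ hij, add_neg_cancel]
      · rintro l - ⟨h1, h2⟩
        exact φ.map_eq_zero_of_eq _
          (by rw [Function.update_of_ne h1.symm, Function.update_of_ne h2.symm, hw]) hij
    rw [key, φ.map_eq_zero_of_eq w hw hij, map_zero, sub_zero]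

/-- The interior product `v ⌟ φ`. -/
def interior {k : ℕ} (v : VField A) (φ : DForm A (k + 1)) : DForm A k :=
  φ.curryLeft v

/-- Membership in the (homogeneous) ideal, with respect to the wedge product, that is generated by
a set `G` of homogeneous forms. (The wedge product is graded commutative, so that closure under
multiplication from the left makes it a two-sided ideal.) -/
inductive MemIdeal (G : ∀ k : ℕ, Set (DForm A k)) : ∀ k : ℕ, DForm A k → Prop
  | gen {k : ℕ} {φ : DForm A k} (h : φ ∈ G k) : MemIdeal G k φ
  | zero {k : ℕ} : MemIdeal G k 0
  | add {k : ℕ} {φ φ' : DForm A k} (h : MemIdeal G k φ) (h' : MemIdeal G k φ') :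
      MemIdeal G k (φ + φ')
  | smul {k : ℕ} (f : A) {φ : DForm A k} (h : MemIdeal G k φ) : MemIdeal G k (f • φ)
  | wedge {j k : ℕ} (α : DForm A j) {φ : DForm A k} (h : MemIdeal G k φ) :
      MemIdeal G (j + k) (DForm.wedge α φ)

end DForm

/-! ### Symmetries and Cauchy characteristics of an exterior differential system -/

section EDS

variable {A : Type} [CommRing A] [Algebra ℝ A] (G : ∀ k : ℕ, Set (DForm A k))

/-- The infinitesimal symmetries of the ideal generated by `G`: the vector fields `v` such that
`L_v φ` lies in the ideal for every `φ` in the ideal. -/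
def infinitesimalSymmetries : Submodule ℝ (VField A) where
  carrier := {v | ∀ (k : ℕ) (φ : DForm A k), DForm.MemIdeal G k φ →
    DForm.MemIdeal G k (DForm.lieDeriv v φ)}
  zero_mem' := by
    intro k φ _
    have h : DForm.lieDeriv 0 φ = 0 := by
      ext w
      simp [DForm.lieDeriv]
    rw [h]
    exact .zero
  add_mem' := by
    intro v v' hv hv' k φ hφ
    have h : DForm.lieDeriv (v + v') φ = DForm.lieDeriv v φ + DForm.lieDeriv v' φ := by
      ext w
      simp [DForm.lieDeriv, Finset.sum_add_distrib]
      ring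
    rw [h]
    exact (hv k φ hφ).add (hv' k φ hφ)
  smul_mem' := by
    intro c v hv k φ hφ
    have h : DForm.lieDeriv (c • v) φ = (algebraMap ℝ A c) • DForm.lieDeriv v φ := by
      ext w
      have h1 : ∀ i, ⁅c • v, w i⁆ = (algebraMap ℝ A c) • ⁅v, w i⁆ := fun i => by
        rw [smul_lie, algebraMap_smul]
      change (c • v) (φ w) - ∑ i, φ (Function.update w i ⁅c • v, w i⁆) =
        (algebraMap ℝ A c) • (v (φ w) - ∑ i, φ (Function.update w i ⁅v, w i⁆))
      simp only [h1, AlternatingMap.map_update_smul, ← Finset.smul_sum, smul_sub]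
      rw [Derivation.smul_apply, ← algebraMap_smul A c (v (φ w))]
    rw [h]
    exact (hv k φ hφ).smul _

/-- The Cauchy characteristic vector fields of the ideal generated by `G`: the vector fields `v`
such that `v ⌟ φ` lies in the ideal for every `φ` in the ideal. (The interior product of a
`0`-form is zero.) -/
def cauchyCharacteristics : Submodule ℝ (VField A) where
  carrier := {v | ∀ (k : ℕ) (φ : DForm A (k + 1)), DForm.MemIdeal G (k + 1) φ →
    DForm.MemIdeal G k (DForm.interior v φ)}
  zero_mem' := by
    intro k φ _
    simpa [DForm.interior] using DForm.MemIdeal.zero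
  add_mem' := by
    intro v v' hv hv' k φ hφ
    simpa [DForm.interior] using (hv k φ hφ).add (hv' k φ hφ)
  smul_mem' := by
    intro c v hv k φ hφ
    have h : DForm.interior (c • v) φ = (algebraMap ℝ A c) • DForm.interior v φ := by
      rw [DForm.interior, ← algebraMap_smul A c v, map_smul, DForm.interior]
    rw [h]
    exact (hv k φ hφ).smul _

/-- The space of infinitesimal symmetries modulo the Cauchy characteristic vector fields among
them. -/
abbrev SymmetriesModCauchy : Type :=
  infinitesimalSymmetries G ⧸ (cauchyCharacteristics G).submoduleOf (infinitesimalSymmetries G)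

end EDS

/-! ### The orthonormal frame bundle of Euclidean space -/

/-- The ambient vector space `ℝ³ × (ℝ³)³` of tuples `(x; e₁, e₂, e₃)`. -/
abbrev FrameAmbient : Type :=
  EuclideanSpace ℝ (Fin 3) × (Fin 3 → EuclideanSpace ℝ (Fin 3))

/-- The bundle of oriented orthonormal frames `(x; e₁, e₂, e₃)` on `ℝ³`, i.e. `ℝ³ × SO(3)`, where
the vectors `eᵢ` are the columns of the rotation matrix. The index of `eᵢ` is `i - 1 : Fin 3`. -/
abbrev FrameBundle : Type :=
  {p : FrameAmbient // Orthonormal ℝ p.2 ∧ (Matrix.of fun k i : Fin 3 => p.2 i k).det = 1}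

open scoped ContDiff Topology in
/-- The algebra `C^∞(U)` of smooth functions on an open subset `U` of the frame bundle, an embedded
submanifold of the ambient vector space: a function is smooth if near every point of `U` it is the
restriction of a smooth function on the ambient space. -/
def smoothFunctions (U : TopologicalSpace.Opens FrameBundle) : Subalgebra ℝ (U → ℝ) where
  carrier := {f | ∀ p : U, ∃ g : FrameAmbient → ℝ, ContDiff ℝ ∞ g ∧
    ∀ᶠ q : U in 𝓝 p, f q = g ((q : FrameBundle) : FrameAmbient)}
  mul_mem' := by
    intro f₁ f₂ h₁ h₂ p
    obtain ⟨g₁, hg₁, e₁⟩ := h₁ p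
    obtain ⟨g₂, hg₂, e₂⟩ := h₂ p
    refine ⟨fun y => g₁ y * g₂ y, hg₁.mul hg₂, ?_⟩
    filter_upwards [e₁, e₂] with q a₁ a₂
    simp [a₁, a₂]
  add_mem' := by
    intro f₁ f₂ h₁ h₂ p
    obtain ⟨g₁, hg₁, e₁⟩ := h₁ p
    obtain ⟨g₂, hg₂, e₂⟩ := h₂ p
    refine ⟨fun y => g₁ y + g₂ y, hg₁.add hg₂, ?_⟩
    filter_upwards [e₁, e₂] with q a₁ a₂
    simp [a₁, a₂]
  algebraMap_mem' := fun c _ => ⟨fun _ => c, contDiff_const, Filter.Eventually.of_forall fun _ => rfl⟩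

namespace FrameBundle

variable (U : TopologicalSpace.Opens FrameBundle)

/-- The `k`-th coordinate of the base point `x`, as a smooth function. -/
def xCoord (k : Fin 3) : smoothFunctions U :=
  ⟨fun q => (q : FrameBundle).1.1 k, fun _ => ⟨fun y => y.1 k, by fun_prop,
    Filter.Eventually.of_forall fun _ => rfl⟩⟩

/-- The `k`-th coordinate of the frame vector `eᵢ`, as a smooth function. -/
def eCoord (i k : Fin 3) : smoothFunctions U :=
  ⟨fun q => (q : FrameBundle).1.2 i k, fun _ => ⟨fun y => y.2 i k, by fun_prop,
    Filter.Eventually.of_forall fun _ => rfl⟩⟩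

/-- The canonical 1-forms `ηⁱ = eᵢ · dx`, so that `dx = eᵢ ηⁱ`. -/
def eta (i : Fin 3) : DForm (smoothFunctions U) 1 :=
  ∑ k, eCoord U i k • DForm.d₀ (xCoord U k)

/-- The canonical 1-forms `ηʲᵢ = eⱼ · deᵢ`, so that `deᵢ = eⱼ ηʲᵢ`. -/
def etaConn (j i : Fin 3) : DForm (smoothFunctions U) 1 :=
  ∑ k, eCoord U j k • DForm.d₀ (eCoord U i k)

/-- The 2-form `Ψ = η³₁ ∧ η³₂ + η¹ ∧ η²`. -/
def psi : DForm (smoothFunctions U) 2 :=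
  DForm.wedge (etaConn U 2 0) (etaConn U 2 1) + DForm.wedge (eta U 0) (eta U 1)

/-- The generators `η³`, `dη³`, `Ψ` of the system for pseudospherical (`K = -1`) surfaces. By the
structure equations `dΨ` is a multiple of `η³`, so that the algebraic ideal generated by these forms
is closed under exterior differentiation. -/
def pseudosphericalGenerators : ∀ k : ℕ, Set (DForm (smoothFunctions U) k)
  | 1 => {eta U 2}
  | 2 => {DForm.d₁ (eta U 2), psi U}
  | _ => ∅

/-- The infinitesimal Euclidean motions: the vector fields `v` that are induced on frames by the
motions of `ℝ³` with velocity field `y ↦ M y + b`, where `M` is skew-symmetric; along `v` the base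
point has velocity `M x + b` and the frame vector `eᵢ` has velocity `M eᵢ`. -/
def euclideanMotions : Submodule ℝ (VField (smoothFunctions U)) where
  carrier := {v | ∃ (M : Matrix (Fin 3) (Fin 3) ℝ) (b : Fin 3 → ℝ), M.transpose = -M ∧
    (∀ k, v (xCoord U k) = ∑ l, M k l • xCoord U l + algebraMap ℝ _ (b k)) ∧
    ∀ i k, v (eCoord U i k) = ∑ l, M k l • eCoord U i l}
  zero_mem' := ⟨0, 0, by simp, by simp, by simp⟩
  add_mem' := by
    rintro v v' ⟨M, b, hM, hx, he⟩ ⟨M', b', hM', hx', he'⟩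
    refine ⟨M + M', b + b', by rw [Matrix.transpose_add, hM, hM', neg_add], fun k => ?_,
      fun i k => ?_⟩
    · simp only [Derivation.add_apply, hx, hx', Matrix.add_apply, add_smul,
        Finset.sum_add_distrib, Pi.add_apply, map_add]
      abel
    · simp only [Derivation.add_apply, he, he', Matrix.add_apply, add_smul,
        Finset.sum_add_distrib]
  smul_mem' := by
    rintro c v ⟨M, b, hM, hx, he⟩
    refine ⟨c • M, c • b, by rw [Matrix.transpose_smul, hM, smul_neg], fun k => ?_,
      fun i k => ?_⟩
    · simp only [Derivation.smul_apply, hx, Matrix.smul_apply, smul_eq_mul, mul_smul,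
        ← Finset.smul_sum, Pi.smul_apply, smul_add, map_mul, Algebra.smul_def c (algebraMap _ _ _)]
    · simp only [Derivation.smul_apply, he, Matrix.smul_apply, smul_eq_mul, mul_smul,
        ← Finset.smul_sum]

/-- The frame rotations: the vector fields that fix the base point `x` and the vector `e₃` and
rotate `e₁`, `e₂` in the plane which they span, with an arbitrary smooth function `f` as angular
velocity: `e₁` has velocity `f e₂` and `e₂` has velocity `-f e₁`. -/
def frameRotations : Submodule ℝ (VField (smoothFunctions U)) where
  carrier := {v | ∃ f : smoothFunctions U, ∀ k, v (xCoord U k) = 0 ∧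
    v (eCoord U 0 k) = f * eCoord U 1 k ∧ v (eCoord U 1 k) = -(f * eCoord U 0 k) ∧
    v (eCoord U 2 k) = 0}
  zero_mem' := ⟨0, by simp⟩
  add_mem' := by
    rintro v v' ⟨f, h⟩ ⟨f', h'⟩
    refine ⟨f + f', fun k => ?_⟩
    obtain ⟨h1, h2, h3, h4⟩ := h k
    obtain ⟨h1', h2', h3', h4'⟩ := h' k
    simp only [Derivation.add_apply, h1, h2, h3, h4, h1', h2', h3', h4', add_zero, true_and,
      and_true]
    constructor <;> ring
  smul_mem' := by
    rintro c v ⟨f, h⟩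
    refine ⟨c • f, fun k => ?_⟩
    obtain ⟨h1, h2, h3, h4⟩ := h k
    simp only [Derivation.smul_apply, h1, h2, h3, h4, smul_zero, and_true,
      smul_mul_assoc, smul_neg]

end FrameBundle

end

/-! The frame bundle is the Euclidean group acting on itself. Its left-invariant fields `E i`, `P₁`,
`P₂`, `R` (translations along eᵢ, tilts of e₁ and e₂ towards e₃, spin in the e₁e₂-plane) form a
global frame, in which η¹, η², η³, η³₁, η³₂ read off the first five of the coefficients a₁, a₂, g,
p₁, p₂, r of a field v. Everything is computed from the brackets of this frame.

Upper bound for the symmetries. A 1-form of the ideal vanishes on ker η³, so L_v η³ does; this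
expresses a₁, a₂, p₁, p₂ by first derivatives of the generating function g and gives R g = 0
(`contact_equations`). The coefficient r stays free. Modulo η³, the forms Ψ + dη³ and Ψ - dη³ are
decomposable. Their kernels within ker η³ are spanned modulo R by X₁ = E₁ + P₂, X₂ = E₂ - P₁ and by
Y₁ = E₁ - P₂, Y₂ = E₂ + P₁, so every 2-form of the ideal vanishes on the pairs (Xᵢ, Yⱼ). Evaluated
there, L_v Ψ yields Xᵢ Yⱼ g = δᵢⱼ g (`PseudosphericalForms.determiningEquations`).

This overdetermined linear system is prolonged with the bracket relations: commuting derivatives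
forces E₃ g = 0 and determines all second derivatives along the X's and Y's up to one unknown
(`DeterminingEquations.closed`, `DeterminingEquations.euclidean`). The resulting equations say that
the field generated by g, with spin coefficient E₂ P₁ g, commutes with the whole frame
(`EuclideanEquations.lie_E₁` and its companions). A field that commutes with the left-invariant
fields is an infinitesimal left translation, i.e. a Euclidean motion: the matrix M and the vector b
are recovered as functions killed by the frame, hence constant on a connected U
(`mem_euclideanMotions_of_lie_eq_zero`). What remains of v is a multiple of R.

Conversely, Euclidean motions preserve all the canonical forms, and f R preserves η³ and Ψ because
it is annihilated by η³, dη³, Ψ and spin leaves them invariant. For a Cauchy characteristic v, the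
forms v ⌟ η³ and v ⌟ dη³ lie in the ideal; since dη³ is nondegenerate on ker η³ modulo R, v is a
multiple of R. Finally so(3) ⊕ ℝ³ maps isomorphically onto the quotient, since a frame rotation
fixes x and no nonzero infinitesimal Euclidean motion does.

Two foundations are needed. Derivations of C^∞(U) must be controlled by their values on coordinates
(bump functions and Hadamard's lemma, `derivation_eq_zero`), and functions killed by the frame must
be locally constant (`IsInvariant.isLocallyConstant`, by a Gram–Schmidt retraction). Algebraic
ideals are handled by comparing the wedge product with a sum over all permutations
(`factorial_mul_wedge`). -/

noncomputable section

/-! ### Calculus of differential forms -/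

namespace DForm

open Equiv

/-! ### Alternating sums over permutations and over shuffles -/

section ShuffleSum

variable {A V ι ιa ιb : Type} [CommRing A] [Fintype ι] [DecidableEq ι]

/-- The alternating sum of `G` over all permutations of the arguments. -/
def permSum (G : (ι → V) → A) (u : ι → V) : A :=
  ∑ σ : Perm ι, ((Perm.sign σ : ℤ) : A) * G (u ∘ σ)

/-- The part of the alternating sum in which the argument number `i` is moved to place `p`. -/
def permSumAt (G : (ι → V) → A) (i p : ι) (u : ι → V) : A :=
  ∑ σ : Perm ι with σ p = i, ((Perm.sign σ : ℤ) : A) * G (u ∘ σ)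

theorem permSum_eq_sum_permSumAt (G : (ι → V) → A) (i : ι) (u : ι → V) :
    permSum G u = ∑ p, permSumAt G i p u := by
  have h := Finset.sum_fiberwise (Finset.univ : Finset (Perm ι)) (fun σ => σ.symm i)
    (fun σ => ((Perm.sign σ : ℤ) : A) * G (u ∘ σ))
  rw [permSum, ← h]
  refine Finset.sum_congr rfl fun p _ => ?_
  rw [permSumAt]
  congr 1
  ext σ
  simp [Equiv.symm_apply_eq σ, eq_comm (a := i)]

/-- Composing σ with the transposition of the places p and q changes the sign of σ and the sign of
`G`, so the two families of terms agree one by one. -/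
theorem permSumAt_eq_of_swap (G : (ι → V) → A) (i p q : ι) (u : ι → V) (hpq : p ≠ q)
    (h : ∀ w, G (w ∘ swap p q) = -G w) : permSumAt G i p u = permSumAt G i q u := by
  refine Finset.sum_equiv (Equiv.mulRight (swap p q)) (fun σ => by simp) fun σ _ => ?_
  have : u ∘ ⇑(σ * swap p q) = (u ∘ σ) ∘ swap p q := rfl
  rw [coe_mulRight, this, h, Perm.sign_mul, Perm.sign_swap hpq]
  simp

/-- A permutation that sends p to i is the same as a permutation τ of the remaining indices X, once
`e` and `e'` present the index set as X with the extra point i, respectively p. Its sign is that of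
τ times a sign that depends on `e` and `e'` only. -/
theorem permSumAt_option {X : Type} [Fintype X] [DecidableEq X] (G : (ι → V) → A) (i p : ι)
    (e e' : Option X ≃ ι) (he : e none = i) (he' : e' none = p) (u : ι → V) :
    permSumAt G i p u = ((Perm.sign (e'.symm.trans e) : ℤ) : A) *
      ∑ τ : Perm X, ((Perm.sign τ : ℤ) : A) * G (u ∘ e ∘ optionCongr τ ∘ e'.symm) := by
  rw [permSumAt, Finset.mul_sum]
  symm
  refine Finset.sum_bij (fun τ _ => (e'.symm.trans (optionCongr τ)).trans e) ?_ ?_ ?_ ?_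
  · intro τ _
    simp [← he, ← he']
  · intro τ _ τ' _ h
    have : optionCongr τ = optionCongr τ' := by
      ext1 x
      have := Equiv.congr_fun h (e' x)
      simpa using this
    exact Equiv.optionCongr_injective this
  · intro σ hσ
    simp only [Finset.mem_filter, Finset.mem_univ, true_and] at hσ
    have h0 : ((e'.trans σ).trans e.symm) none = none := by
      simp [he', hσ, ← he]
    refine ⟨removeNone ((e'.trans σ).trans e.symm), Finset.mem_univ _, ?_⟩
    have : optionCongr (removeNone ((e'.trans σ).trans e.symm)) = (e'.trans σ).trans e.symm := by
      ext1 x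
      cases x with
      | none => simpa using h0.symm
      | some x =>
        rw [optionCongr_apply, Option.map_some]
        refine removeNone_some _ (Option.ne_none_iff_exists'.mp fun h => ?_)
        rw [← h0] at h
        simpa using ((e'.trans σ).trans e.symm).injective h
    rw [this]
    ext x
    simp
  · intro τ _
    have h1 : (e'.symm.trans (optionCongr τ)).trans e =
        ((e'.symm.trans (optionCongr τ)).trans e').trans (e'.symm.trans e) := by
      ext x
      simp
    have h2 : Perm.sign ((e'.symm.trans (optionCongr τ)).trans e) =
        Perm.sign (e'.symm.trans e) * Perm.sign τ := by
      rw [h1, Perm.sign_trans, Perm.sign_symm_trans_trans, optionCongr_sign]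
    rw [h2]
    push_cast
    rw [mul_assoc]
    rfl

variable [AddCommGroup V] [Module A V]

/-- The product of two alternating maps in separate arguments. -/
def outer (α : V [⋀^ιa]→ₗ[A] A) (φ : V [⋀^ιb]→ₗ[A] A) (u : ιa ⊕ ιb → V) : A :=
  α (u ∘ Sum.inl) * φ (u ∘ Sum.inr)

/-- Each shuffle is a coset of the permutations preserving the two blocks, and all its members
contribute equally; hence the product of factorials. Sums over a quotient of a permutation group
thereby become sums over all permutations. -/
theorem permSum_outer [Fintype ιa] [DecidableEq ιa] [Fintype ιb] [DecidableEq ιb]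
    (α : V [⋀^ιa]→ₗ[A] A) (φ : V [⋀^ιb]→ₗ[A] A) (u : ιa ⊕ ιb → V) :
    permSum (outer α φ) u =
      ((Fintype.card ιa).factorial * (Fintype.card ιb).factorial : ℕ) *
        LinearMap.mul' A A (α.domCoprod φ u) := by
  have h := congrArg (fun m => LinearMap.mul' A A (m u))
    (MultilinearMap.domCoprod_alternization_eq α φ)
  simp only [MultilinearMap.alternatization_apply, map_sum, AlternatingMap.smul_apply,
    map_nsmul] at h
  rw [← nsmul_eq_mul, ← h, permSum]
  refine Finset.sum_congr rfl fun σ _ => ?_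
  rw [Units.smul_def, map_zsmul, zsmul_eq_mul]
  rfl

theorem outer_comp_swap_inl [DecidableEq ιa] [DecidableEq ιb]
    (α : V [⋀^ιa]→ₗ[A] A) (φ : V [⋀^ιb]→ₗ[A] A) (u : ιa ⊕ ιb → V)
    {a b : ιa} (h : a ≠ b) :
    outer α φ (u ∘ swap (Sum.inl a) (Sum.inl b)) = -outer α φ u := by
  have h1 : (u ∘ swap (Sum.inl a) (Sum.inl b)) ∘ Sum.inl = (u ∘ Sum.inl) ∘ swap a b := by
    ext1 i
    simp only [Function.comp_apply, Sum.inl_injective.swap_apply]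
  have h2 : (u ∘ swap (Sum.inl a) (Sum.inl b)) ∘ Sum.inr = u ∘ Sum.inr := by
    ext1 i
    simp [swap_apply_def]
  rw [outer, h1, h2, α.map_swap _ h, outer, neg_mul]

theorem outer_comp_swap_inr [DecidableEq ιa] [DecidableEq ιb]
    (α : V [⋀^ιa]→ₗ[A] A) (φ : V [⋀^ιb]→ₗ[A] A) (u : ιa ⊕ ιb → V)
    {a b : ιb} (h : a ≠ b) :
    outer α φ (u ∘ swap (Sum.inr a) (Sum.inr b)) = -outer α φ u := by
  have h1 : (u ∘ swap (Sum.inr a) (Sum.inr b)) ∘ Sum.inr = (u ∘ Sum.inr) ∘ swap a b := by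
    ext1 i
    simp only [Function.comp_apply, Sum.inr_injective.swap_apply]
  have h2 : (u ∘ swap (Sum.inr a) (Sum.inr b)) ∘ Sum.inl = u ∘ Sum.inl := by
    ext1 i
    simp [swap_apply_def]
  rw [outer, h1, h2, φ.map_swap _ h, outer, mul_neg]

end ShuffleSum

/-! ### Wedge product, Lie derivative and interior product -/

variable {A : Type} [CommRing A] [Algebra ℝ A]

/-- The wedge product with denominators cleared. Identities for it are verified after multiplication
by j! k!, and that factor is cancelled because the coefficients form an ℝ-algebra. -/
theorem factorial_mul_wedge {j k : ℕ} (α : DForm A j) (φ : DForm A k) (w : Fin (j + k) → VField A) :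
    ((j.factorial * k.factorial : ℕ) : A) * wedge α φ w =
      permSum (outer α φ) (w ∘ finSumFinEquiv) := by
  rw [permSum_outer, Fintype.card_fin, Fintype.card_fin]
  rfl

theorem natCast_mul_cancel {n : ℕ} (hn : n ≠ 0) {a b : A} (h : (n : A) * a = n * b) : a = b := by
  have key : ∀ c : A, (n : A) * c = (n : ℝ) • c := fun c => by
    rw [Algebra.smul_def, map_natCast]
  rw [key, key] at h
  have := congrArg (fun c => ((n : ℝ)⁻¹) • c) h
  simpa [smul_smul, inv_mul_cancel₀ (Nat.cast_ne_zero.mpr hn : (n : ℝ) ≠ 0)] using this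

theorem wedge_apply_eq_zero {j k : ℕ} (α : DForm A j) (φ : DForm A k)
    (w : Fin (j + k) → VField A)
    (h : ∀ s : Fin k → Fin (j + k), Function.Injective s → φ (w ∘ s) = 0) :
    wedge α φ w = 0 := by
  refine natCast_mul_cancel (n := j.factorial * k.factorial) (by positivity) ?_
  rw [factorial_mul_wedge, mul_zero, permSum]
  refine Finset.sum_eq_zero fun σ _ => ?_
  have := h (finSumFinEquiv ∘ σ ∘ Sum.inr)
    (finSumFinEquiv.injective.comp (σ.injective.comp Sum.inr_injective))
  rw [outer]
  have h2 : (w ∘ ⇑finSumFinEquiv) ∘ ⇑σ ∘ Sum.inr = w ∘ finSumFinEquiv ∘ σ ∘ Sum.inr := rfl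
  rw [Function.comp_assoc _ _ Sum.inr, h2, this, mul_zero, mul_zero]

theorem wedge_one_one (α β : DForm A 1) (X Y : VField A) :
    wedge α β ![X, Y] = α ![X] * β ![Y] - α ![Y] * β ![X] := by
  have h := factorial_mul_wedge α β ![X, Y]
  have h2 : permSum (outer α β) (![X, Y] ∘ finSumFinEquiv) =
      ∑ σ : Perm (Fin 2), ((Perm.sign σ : ℤ) : A) * (α ![![X, Y] (σ 0)] * β ![![X, Y] (σ 1)]) := by
    refine Fintype.sum_equiv (finSumFinEquiv (m := 1) (n := 1)).permCongr _ _ fun σ => ?_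
    rw [outer]
    congr 2
    · simp
    · congr 1; ext1 i; fin_cases i; rfl
    · congr 1; ext1 i; fin_cases i; rfl
  rw [h2] at h
  have h3 : (Finset.univ : Finset (Perm (Fin 2))) = {1, swap 0 1} := by decide
  rw [h3, Finset.sum_pair (by decide)] at h
  simpa [sub_eq_add_neg] using h

/-- The Leibniz rule for a single term of the shuffle sum: v differentiates one factor at a time,
and a bracket replaces an argument of either the left or the right factor. -/
theorem apply_outer_sub_sum {j k : ℕ} (v : VField A) (α : DForm A j) (φ : DForm A k)
    (u : Fin j ⊕ Fin k → VField A) :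
    v (outer α φ u) - ∑ q, outer α φ (Function.update u q ⁅v, u q⁆) =
      outer (lieDeriv v α) φ u + outer α (lieDeriv v φ) u := by
  change v (outer α φ u) - ∑ q, outer α φ (Function.update u q ⁅v, u q⁆) =
    (v (α (u ∘ Sum.inl)) - ∑ i, α (Function.update (u ∘ Sum.inl) i ⁅v, u (Sum.inl i)⁆)) *
      φ (u ∘ Sum.inr) + α (u ∘ Sum.inl) *
    (v (φ (u ∘ Sum.inr)) - ∑ i, φ (Function.update (u ∘ Sum.inr) i ⁅v, u (Sum.inr i)⁆))
  simp only [outer, Fintype.sum_sum_type, Sum.update_inl_comp_inl, Sum.update_inl_comp_inr,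
    Sum.update_inr_comp_inl, Sum.update_inr_comp_inr, Derivation.leibniz, smul_eq_mul,
    ← Finset.sum_mul, ← Finset.mul_sum]
  ring

/-- The Lie derivative is a derivation of the wedge product. -/
theorem lieDeriv_wedge {j k : ℕ} (v : VField A) (α : DForm A j) (φ : DForm A k) :
    lieDeriv v (wedge α φ) = wedge (lieDeriv v α) φ + wedge α (lieDeriv v φ) := by
  ext w
  refine natCast_mul_cancel (n := j.factorial * k.factorial) (by positivity) ?_
  rw [AlternatingMap.add_apply, mul_add, factorial_mul_wedge, factorial_mul_wedge]
  change _ * (v (wedge α φ w) - ∑ i, wedge α φ (Function.update w i ⁅v, w i⁆)) = _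
  have hv : ((j.factorial * k.factorial : ℕ) : A) * v (wedge α φ w) =
      v (((j.factorial * k.factorial : ℕ) : A) * wedge α φ w) := by
    simp
  rw [mul_sub, Finset.mul_sum, hv]
  simp only [factorial_mul_wedge, permSum, map_sum]
  rw [Finset.sum_comm, ← Finset.sum_sub_distrib, ← Finset.sum_add_distrib]
  refine Finset.sum_congr rfl fun σ _ => ?_
  rw [← mul_add, ← apply_outer_sub_sum, ← Finset.mul_sum, mul_sub]
  congr 1
  · simp
  · congr 1
    symm
    -- The place q of the permuted tuple carries the argument of `w` with index `finSumFinEquiv (σ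
    -- q)`.
    refine Fintype.sum_equiv (σ.trans finSumFinEquiv) _ _ fun q => ?_
    congr 1
    ext1 i
    simp [Function.update_apply]

/-- Splitting off the first element of the left summand. -/
def optionSumLeft (j k : ℕ) : Option (Fin j ⊕ Fin k) ≃ Fin (j + 1) ⊕ Fin k where
  toFun
    | none => Sum.inl 0
    | some (Sum.inl a) => Sum.inl a.succ
    | some (Sum.inr b) => Sum.inr b
  invFun := Sum.elim (Fin.cases none fun a => some (Sum.inl a)) fun b => some (Sum.inr b)
  left_inv := by rintro (_ | _ | _) <;> rfl
  right_inv := by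
    rintro (a | _)
    · refine Fin.cases rfl (fun _ => rfl) a
    · rfl

/-- Splitting off the first element of the right summand. -/
def optionSumRight (j k : ℕ) : Option (Fin j ⊕ Fin k) ≃ Fin j ⊕ Fin (k + 1) where
  toFun
    | none => Sum.inr 0
    | some (Sum.inl a) => Sum.inl a
    | some (Sum.inr b) => Sum.inr b.succ
  invFun := Sum.elim (fun a => some (Sum.inl a)) (Fin.cases none fun b => some (Sum.inr b))
  left_inv := by rintro (_ | _ | _) <;> rfl
  right_inv := by
    rintro (_ | b)
    · rfl
    · refine Fin.cases rfl (fun _ => rfl) b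

/-- These are the terms in which v becomes an argument of α. Its place among the j + 1 arguments of
α is immaterial, so they are j + 1 copies of the terms with v in first place, and (j + 1) j! = (j +
1)!. The coefficient c is the sign for moving v there; its value is irrelevant for membership in an
ideal. -/
theorem sum_permSumAt_inl {j k : ℕ} (v : VField A) (α : DForm A (j + 1)) (φ : DForm A k)
    (i : Fin (j + 1) ⊕ Fin k) (e : Option (Fin j ⊕ Fin k) ≃ Fin (j + 1) ⊕ Fin k)
    (he : e none = i) : ∃ c : A, ∀ (u : Fin (j + 1) ⊕ Fin k → VField A) (w : Fin (j + k) → VField A),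
      u i = v → (∀ x, u (e (some x)) = w (finSumFinEquiv x)) →
      ∑ a, permSumAt (outer α φ) i (Sum.inl a) u =
        (((j + 1).factorial * k.factorial : ℕ) : A) * (c * wedge (interior v α) φ w) := by
  refine ⟨((Perm.sign ((optionSumLeft j k).symm.trans e) : ℤ) : A), fun u w hi hw => ?_⟩
  have h1 : ∀ a, permSumAt (outer α φ) i (Sum.inl a) u =
      permSumAt (outer α φ) i (Sum.inl 0) u := fun a => by
    by_cases ha : a = 0
    · rw [ha]
    · exact permSumAt_eq_of_swap _ _ _ _ _ (by simpa using ha)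
        fun w => outer_comp_swap_inl _ _ _ ha
  rw [Finset.sum_congr rfl fun a _ => h1 a, Finset.sum_const, Finset.card_univ, Fintype.card_fin,
    permSumAt_option _ i (Sum.inl 0) e (optionSumLeft j k) he rfl]
  have h2 : ∑ τ : Perm (Fin j ⊕ Fin k), ((Perm.sign τ : ℤ) : A) *
      outer α φ (u ∘ e ∘ optionCongr τ ∘ (optionSumLeft j k).symm) =
      permSum (outer (interior v α) φ) (w ∘ finSumFinEquiv) := by
    refine Finset.sum_congr rfl fun τ _ => ?_
    congr 1
    rw [outer, outer]
    congr 1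
    · change _ = α (Matrix.vecCons v _)
      congr 1
      ext1 a
      refine Fin.cases ?_ (fun a => ?_) a
      · exact (congrArg u he).trans hi
      · exact hw _
    · congr 1
      ext1 b
      exact hw _
  rw [h2, ← factorial_mul_wedge, Nat.factorial_succ]
  simp only [nsmul_eq_mul]
  push_cast
  ring

theorem sum_permSumAt_inr {j k : ℕ} (v : VField A) (α : DForm A j) (φ : DForm A (k + 1))
    (i : Fin j ⊕ Fin (k + 1)) (e : Option (Fin j ⊕ Fin k) ≃ Fin j ⊕ Fin (k + 1))
    (he : e none = i) : ∃ c : A, ∀ (u : Fin j ⊕ Fin (k + 1) → VField A) (w : Fin (j + k) → VField A),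
      u i = v → (∀ x, u (e (some x)) = w (finSumFinEquiv x)) →
      ∑ b, permSumAt (outer α φ) i (Sum.inr b) u =
        ((j.factorial * (k + 1).factorial : ℕ) : A) * (c * wedge α (interior v φ) w) := by
  refine ⟨((Perm.sign ((optionSumRight j k).symm.trans e) : ℤ) : A), fun u w hi hw => ?_⟩
  have h1 : ∀ b, permSumAt (outer α φ) i (Sum.inr b) u =
      permSumAt (outer α φ) i (Sum.inr 0) u := fun b => by
    by_cases hb : b = 0
    · rw [hb]
    · exact permSumAt_eq_of_swap _ _ _ _ _ (by simpa using hb)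
        fun w => outer_comp_swap_inr _ _ _ hb
  rw [Finset.sum_congr rfl fun b _ => h1 b, Finset.sum_const, Finset.card_univ, Fintype.card_fin,
    permSumAt_option _ i (Sum.inr 0) e (optionSumRight j k) he rfl]
  have h2 : ∑ τ : Perm (Fin j ⊕ Fin k), ((Perm.sign τ : ℤ) : A) *
      outer α φ (u ∘ e ∘ optionCongr τ ∘ (optionSumRight j k).symm) =
      permSum (outer α (interior v φ)) (w ∘ finSumFinEquiv) := by
    refine Finset.sum_congr rfl fun τ _ => ?_
    congr 1
    rw [outer, outer]
    congr 1
    · congr 1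
      ext1 a
      exact hw _
    · change _ = φ (Matrix.vecCons v _)
      congr 1
      ext1 b
      refine Fin.cases ?_ (fun b => ?_) b
      · exact (congrArg u he).trans hi
      · exact hw _
  rw [h2, ← factorial_mul_wedge, Nat.factorial_succ]
  simp only [nsmul_eq_mul]
  push_cast
  ring

theorem cast_apply {m n : ℕ} (h : m = n) (φ : DForm A m) (w : Fin n → VField A) :
    (h ▸ φ : DForm A n) w = φ (w ∘ Fin.cast h) := by
  subst h
  rfl

/-! ### Stability of ideals, and tuples on which an ideal vanishes -/

namespace MemIdeal

variable {G : ∀ k : ℕ, Set (DForm A k)}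

/-- Up to signs, v ⌟ (α ∧ φ) is (v ⌟ α) ∧ φ plus α ∧ (v ⌟ φ), according to whether v lands in α or
in φ. The degrees are tied by equations because j or k may be 0, in which case the corresponding
term is absent. -/
theorem interior_wedge {j k n : ℕ} (v : VField A) (α : DForm A j) {φ : DForm A k}
    (hφ : MemIdeal G k φ)
    (hvφ : ∀ (m : ℕ) (h : k = m + 1), MemIdeal G m (interior v (h ▸ φ : DForm A (m + 1))))
    (h : j + k = n + 1) :
    MemIdeal G n (interior v (h ▸ DForm.wedge α φ : DForm A (n + 1))) := by
  -- The slot that receives the first argument, which is v; `e` enumerates all slots with this one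
  -- split off.
  let i : Fin j ⊕ Fin k := finSumFinEquiv.symm (Fin.cast h.symm 0)
  let y (w : Fin n → VField A) : Fin (j + k) → VField A := Matrix.vecCons v w ∘ Fin.cast h
  let e : Option (Fin n) ≃ Fin j ⊕ Fin k :=
    (finSuccEquiv n).symm.trans ((finCongr h.symm).trans finSumFinEquiv.symm)
  have hy : ∀ w x, y w (finSumFinEquiv (e (some x))) = w x := fun w x => by
    simp [y, e]
  have hyi : ∀ w, y w (finSumFinEquiv i) = v := fun w => by
    simp [y, i]
  have hei : e none = i := by simp [e, i]
  have h1 : ∃ β : DForm A n, MemIdeal G n β ∧ ∀ w,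
      ∑ a, permSumAt (outer α φ) i (Sum.inl a) (y w ∘ finSumFinEquiv) =
        ((j.factorial * k.factorial : ℕ) : A) * β w := by
    cases j with
    | zero => exact ⟨0, .zero, fun w => by simp⟩
    | succ j =>
      obtain rfl : n = j + k := by omega
      obtain ⟨c, hc⟩ := sum_permSumAt_inl v α φ i ((optionCongr finSumFinEquiv).trans e) hei
      exact ⟨c • DForm.wedge (interior v α) φ, .smul _ (.wedge _ hφ), fun w =>
        hc _ w (hyi w) fun x => hy w _⟩
  have h2 : ∃ β : DForm A n, MemIdeal G n β ∧ ∀ w,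
      ∑ b, permSumAt (outer α φ) i (Sum.inr b) (y w ∘ finSumFinEquiv) =
        ((j.factorial * k.factorial : ℕ) : A) * β w := by
    cases k with
    | zero => exact ⟨0, .zero, fun w => by simp⟩
    | succ k =>
      obtain rfl : n = j + k := by omega
      obtain ⟨c, hc⟩ := sum_permSumAt_inr v α φ i ((optionCongr finSumFinEquiv).trans e) hei
      exact ⟨c • DForm.wedge α (interior v φ), .smul _ (.wedge _ (hvφ k rfl)), fun w =>
        hc _ w (hyi w) fun x => hy w _⟩
  obtain ⟨β, hβ, h1⟩ := h1
  obtain ⟨γ, hγ, h2⟩ := h2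
  have key : interior v (h ▸ DForm.wedge α φ : DForm A (n + 1)) = β + γ := by
    ext w
    refine natCast_mul_cancel (n := j.factorial * k.factorial) (by positivity) ?_
    rw [AlternatingMap.add_apply, mul_add, ← h1, ← h2, ← Fintype.sum_sum_type
      (fun p => permSumAt (outer α φ) i p (y w ∘ finSumFinEquiv)), ← permSum_eq_sum_permSumAt,
      ← factorial_mul_wedge]
    congr 1
    exact cast_apply h _ _
  rw [key]
  exact hβ.add hγ

/-- The interior product with `v` maps an ideal to itself if it maps the generators into it. -/
theorem interior {v : VField A}
    (hG : ∀ (k : ℕ) (φ : DForm A (k + 1)), φ ∈ G (k + 1) → MemIdeal G k (DForm.interior v φ))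
    {k : ℕ} {φ : DForm A (k + 1)} (hφ : MemIdeal G (k + 1) φ) :
    MemIdeal G k (DForm.interior v φ) := by
  -- Induction on membership needs the degree as a free index, so k + 1 becomes m together with an
  -- equation.
  suffices H : ∀ {m : ℕ} {ψ : DForm A m}, MemIdeal G m ψ → ∀ (n : ℕ) (h : m = n + 1),
      MemIdeal G n (DForm.interior v (h ▸ ψ : DForm A (n + 1))) from H hφ k rfl
  intro m ψ hψ
  induction hψ with
  | gen h => rintro n rfl; exact hG _ _ h
  | zero => rintro n rfl; simpa [DForm.interior] using MemIdeal.zero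
  | add _ _ h h' =>
    rintro n rfl
    simpa [DForm.interior] using (h n rfl).add (h' n rfl)
  | smul f _ h =>
    rintro n rfl
    simpa [DForm.interior] using (h n rfl).smul f
  | wedge α hφ h => intro n hn; exact interior_wedge v α hφ h hn

/-- The Lie derivative along `v` maps an ideal to itself if it maps the generators into it. -/
theorem lieDeriv {v : VField A}
    (hG : ∀ (k : ℕ) (φ : DForm A k), φ ∈ G k → MemIdeal G k (DForm.lieDeriv v φ))
    {k : ℕ} {φ : DForm A k} (hφ : MemIdeal G k φ) : MemIdeal G k (DForm.lieDeriv v φ) := by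
  induction hφ with
  | gen h => exact hG _ _ h
  | @zero k =>
    have : DForm.lieDeriv v (0 : DForm A k) = 0 := by ext w; simp [DForm.lieDeriv]
    rw [this]
    exact .zero
  | @add k φ φ' _ _ h h' =>
    have : DForm.lieDeriv v (φ + φ') = DForm.lieDeriv v φ + DForm.lieDeriv v φ' := by
      ext w
      simp [DForm.lieDeriv, Finset.sum_add_distrib]
      ring
    rw [this]
    exact h.add h'
  | @smul k f φ hφ h =>
    have : DForm.lieDeriv v (f • φ) = v f • φ + f • DForm.lieDeriv v φ := by
      ext w
      simp [DForm.lieDeriv, ← Finset.mul_sum]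
      ring
    rw [this]
    exact (hφ.smul _).add (h.smul _)
  | wedge α hφ h =>
    rw [lieDeriv_wedge]
    exact (hφ.wedge _).add (h.wedge _)

/-- If all generators vanish on the injective subtuples of `w`, then so do all forms in the
ideal. -/
theorem apply_comp_eq_zero {n : ℕ} {w : Fin n → VField A}
    (hG : ∀ (k : ℕ) (φ : DForm A k), φ ∈ G k → ∀ s : Fin k → Fin n, Function.Injective s →
      φ (w ∘ s) = 0)
    {k : ℕ} {φ : DForm A k} (hφ : MemIdeal G k φ) (s : Fin k → Fin n)
    (hs : Function.Injective s) : φ (w ∘ s) = 0 := by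
  induction hφ with
  | gen h => exact hG _ _ h s hs
  | zero => rfl
  | add _ _ h h' => rw [AlternatingMap.add_apply, h s hs, h' s hs, add_zero]
  | smul f _ h => rw [AlternatingMap.smul_apply, h s hs, smul_zero]
  | wedge α _ h => exact wedge_apply_eq_zero _ _ _ fun t ht => h (s ∘ t) (hs.comp ht)

end MemIdeal

end DForm

end

noncomputable section

/-! ### Smoothness of parametric integrals and the Hadamard lemma -/

section Hadamard

open scoped ContDiff Topology

variable {E : Type} [NormedAddCommGroup E] [NormedSpace ℝ E] [ProperSpace E]

/-- Differentiation under the integral sign. The derivative of the integrand is bounded on the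
compact product of a closed ball and [0, 1], and this constant is the dominating function. -/
theorem hasFDerivAt_integral_unitInterval {V : Type} [NormedAddCommGroup V] [NormedSpace ℝ V]
    {F : E × ℝ → V} (hF : ContDiff ℝ ∞ F) (x : E) :
    HasFDerivAt (fun x => ∫ t in (0 : ℝ)..1, F (x, t))
      (∫ t in (0 : ℝ)..1, (fderiv ℝ F (x, t)).comp (ContinuousLinearMap.inl ℝ E ℝ)) x := by
  have hd : Differentiable ℝ F := hF.differentiable (by simp)
  have hc : Continuous fun z : E × ℝ =>
      (fderiv ℝ F z).comp (ContinuousLinearMap.inl ℝ E ℝ) :=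
    (hF.continuous_fderiv (by simp)).clm_comp continuous_const
  obtain ⟨C, hC⟩ := ((isCompact_closedBall x 1).prod
    (isCompact_Icc : IsCompact (Set.Icc (0 : ℝ) 1))).exists_bound_of_continuousOn hc.continuousOn
  refine (intervalIntegral.hasFDerivAt_integral_of_dominated_of_fderiv_le (𝕜 := ℝ)
    (F := fun x t => F (x, t))
    (F' := fun x t => (fderiv ℝ F (x, t)).comp (ContinuousLinearMap.inl ℝ E ℝ))
    (bound := fun _ => C) (Metric.closedBall_mem_nhds x one_pos) ?_ ?_ ?_ ?_ ?_ ?_)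
  · refine Filter.Eventually.of_forall fun y => ?_
    exact (hF.continuous.comp (by fun_prop : Continuous fun t : ℝ => (y, t))).aestronglyMeasurable
  · exact (hF.continuous.comp
      (by fun_prop : Continuous fun t : ℝ => (x, t))).intervalIntegrable _ _
  · exact (hc.comp (by fun_prop : Continuous fun t : ℝ => (x, t))).aestronglyMeasurable
  · refine Filter.Eventually.of_forall fun t ht y hy => hC (y, t) ⟨hy, ?_⟩
    rw [Set.uIoc_of_le zero_le_one] at ht
    exact ⟨ht.1.le, ht.2⟩
  · exact intervalIntegrable_const
  · refine Filter.Eventually.of_forall fun t _ y _ => ?_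
    have h1 : HasFDerivAt (fun y : E => (y, t)) (ContinuousLinearMap.inl ℝ E ℝ) y :=
      hasFDerivAt_prodMk_left y t
    exact (hd (y, t)).hasFDerivAt.comp y h1

theorem contDiff_integral_unitInterval {V : Type} [NormedAddCommGroup V] [NormedSpace ℝ V]
    {F : E × ℝ → V} (hF : ContDiff ℝ ∞ F) :
    ContDiff ℝ ∞ fun x => ∫ t in (0 : ℝ)..1, F (x, t) := by
  -- The target space is quantified inside the induction: the derivative of the integral is an
  -- integral of the same kind with values in a space of linear maps.
  suffices H : ∀ (n : ℕ) (V : Type) [NormedAddCommGroup V] [NormedSpace ℝ V] (F : E × ℝ → V),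
      ContDiff ℝ ∞ F → ContDiff ℝ n fun x => ∫ t in (0 : ℝ)..1, F (x, t) from
    contDiff_infty.mpr fun n => H n V F hF
  intro n
  induction n with
  | zero =>
    intro V _ _ F hF
    refine contDiff_zero.mpr (continuous_iff_continuousAt.mpr fun x => ?_)
    exact (hasFDerivAt_integral_unitInterval hF x).continuousAt
  | succ n ih =>
    intro V _ _ F hF
    have h := fun x => hasFDerivAt_integral_unitInterval hF x
    push_cast
    refine contDiff_succ_iff_hasFDerivAt.mpr 
      ⟨fun x => ∫ t in (0 : ℝ)..1, (fderiv ℝ F (x, t)).comp (ContinuousLinearMap.inl ℝ E ℝ), ?_, h⟩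
    refine ih _ (fun z : E × ℝ => (fderiv ℝ F z).comp (ContinuousLinearMap.inl ℝ E ℝ)) ?_
    exact (hF.fderiv_right (by simp)).clm_comp contDiff_const

/-- Hadamard's lemma. -/
theorem ContDiff.exists_eq_clm_apply_sub {g : E → ℝ} (hg : ContDiff ℝ ∞ g) (p : E) :
    ∃ H : E → E →L[ℝ] ℝ, ContDiff ℝ ∞ H ∧ ∀ y, g y = g p + H y (y - p) := by
  have hF : ContDiff ℝ ∞ fun z : E × ℝ => fderiv ℝ g (p + z.2 • (z.1 - p)) :=
    (hg.fderiv_right (by simp)).comp (by fun_prop)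
  -- Here H y = ∫₀¹ Dg(p + t(y - p)) dt; the identity is the fundamental theorem of calculus along
  -- the segment from p to y.
  refine ⟨_, contDiff_integral_unitInterval hF, fun y => ?_⟩
  have hc : Continuous fun t : ℝ => fderiv ℝ g (p + t • (y - p)) :=
    hF.continuous.comp (by fun_prop : Continuous fun t : ℝ => (y, t))
  have hd : ∀ t ∈ Set.uIcc (0 : ℝ) 1, HasDerivAt (fun t : ℝ => g (p + t • (y - p)))
      (fderiv ℝ g (p + t • (y - p)) (y - p)) t := fun t _ => by
    have h1 : HasDerivAt (fun t : ℝ => p + t • (y - p)) (y - p) t := by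
      simpa using ((hasDerivAt_id t).smul_const (y - p)).const_add p
    exact ((hg.differentiable (by simp)) _).hasFDerivAt.comp_hasDerivAt t h1
  have h := intervalIntegral.integral_eq_sub_of_hasDerivAt hd
    ((hc.clm_apply continuous_const).intervalIntegrable _ _)
  rw [← ContinuousLinearMap.intervalIntegral_apply (hc.intervalIntegrable _ _)] at h
  simp only [one_smul, add_sub_cancel, zero_smul, add_zero] at h
  rw [h]
  ring

end Hadamard

end

noncomputable section

/-! ### Vector fields on open subsets of the frame bundle -/

namespace FrameBundle

open scoped ContDiff Topology
open Filter

variable (U : TopologicalSpace.Opens FrameBundle)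

/-- The same algebra structure, stated over the semiring that underlies the `CommRing` structure, as
`VField` requires. -/
instance instAlgebraSmoothFunctions :
    @Algebra ℝ (smoothFunctions U) _ CommRing.toCommSemiring.toSemiring :=
  Subalgebra.algebra (smoothFunctions U)

/-- The restriction to `U` of a smooth function on the ambient space. -/
def restrict (g : FrameAmbient → ℝ) (hg : ContDiff ℝ ∞ g) : smoothFunctions U :=
  ⟨fun q => g (q : FrameBundle), fun _ => ⟨g, hg, Eventually.of_forall fun _ => rfl⟩⟩

variable {U}

theorem eventually_nhds_iff {p : U} {P : U → Prop} :
    (∀ᶠ q in 𝓝 p, P q) ↔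
      ∀ᶠ y in 𝓝 ((p : FrameBundle) : FrameAmbient), ∀ q : U, ((q : FrameBundle) : FrameAmbient) = y →
        P q := by
  rw [nhds_subtype_eq_comap, nhds_subtype_eq_comap, comap_comap, eventually_comap]
  rfl

/-- Derivations are local: choose a bump function χ with χ(p) = 1, supported where f vanishes, and
evaluate the Leibniz rule for χ f = 0 at p. -/
theorem derivation_apply_eq_zero_of_eventually (v : VField (smoothFunctions U))
    (f : smoothFunctions U) (p : U) (hf : ∀ᶠ q in 𝓝 p, f.1 q = 0) : (v f).1 p = 0 := by
  obtain ⟨χ, hχs, -, hχ, -, hχp⟩ :=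
    exists_contDiff_tsupport_subset (n := (⊤ : ℕ∞)) (eventually_nhds_iff.mp hf)
  have h0 : restrict U χ hχ * f = 0 := by
    ext q
    by_cases hq : ((q : FrameBundle) : FrameAmbient) ∈ tsupport χ
    · have := hχs hq q rfl
      change _ * f.1 q = 0
      rw [this, mul_zero]
    · change χ _ * f.1 q = 0
      rw [image_eq_zero_of_notMem_tsupport hq, zero_mul]
  have h1 := congrArg v h0
  rw [Derivation.leibniz, map_zero] at h1
  have h2 := congrArg (fun a : smoothFunctions U => a.1 p) h1
  change χ _ * (v f).1 p + f.1 p * _ = 0 at h2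
  rwa [hχp, hf.self_of_nhds, zero_mul, one_mul, add_zero] at h2

theorem ambient_eq_sum (y : FrameAmbient) :
    y = ∑ k, y.1 k • ((EuclideanSpace.single k 1, 0) : FrameAmbient) +
      ∑ i, ∑ k, y.2 i k • ((0, Pi.single i (EuclideanSpace.single k 1)) : FrameAmbient) := by
  ext i
  · simp [Fin.sum_univ_three]
    fin_cases i <;> simp
  · rename_i k
    simp [Fin.sum_univ_three]
    fin_cases i <;> fin_cases k <;> simp

/-- At a point p, locality replaces f by an ambient smooth function. Hadamard's lemma writes that
function as a constant plus products (coordinate - its value at p) · (smooth), and the Leibniz rule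
kills each product at p. -/
theorem derivation_eq_zero {v : VField (smoothFunctions U)} (hx : ∀ k, v (xCoord U k) = 0)
    (he : ∀ i k, v (eCoord U i k) = 0) : v = 0 := by
  ext f p
  obtain ⟨g, hg, hfg⟩ := f.2 p
  have h1 : (v (f - restrict U g hg)).1 p = 0 := by
    refine derivation_apply_eq_zero_of_eventually v _ p ?_
    filter_upwards [hfg] with q hq
    change f.1 q - g _ = 0
    rw [← hq, sub_self]
  rw [map_sub] at h1
  have h2 : (v (restrict U g hg)).1 p = 0 := by
    obtain ⟨H, hH, hgH⟩ := hg.exists_eq_clm_apply_sub ((p : FrameBundle) : FrameAmbient)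
    let c (a : ℝ) : smoothFunctions U := algebraMap ℝ _ a
    let Hx (k : Fin 3) : smoothFunctions U :=
      restrict U (fun y => H y (EuclideanSpace.single k 1, 0)) (hH.clm_apply contDiff_const)
    let He (i k : Fin 3) : smoothFunctions U :=
      restrict U (fun y => H y (0, Pi.single i (EuclideanSpace.single k 1)))
        (hH.clm_apply contDiff_const)
    have h3 : restrict U g hg = c (g (p : FrameBundle)) +
        (∑ k, (xCoord U k - c ((xCoord U k).1 p)) * Hx k +
          ∑ i, ∑ k, (eCoord U i k - c ((eCoord U i k).1 p)) * He i k) := by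
      ext q
      have h := hgH (q : FrameBundle)
      rw [ambient_eq_sum (((q : FrameBundle) : FrameAmbient) - ((p : FrameBundle) : FrameAmbient)),
        map_add, map_sum, map_sum] at h
      simp only [map_sum, map_smul] at h
      simp only [Fin.sum_univ_three] at h ⊢
      exact h
    have h4 : ∀ (a b : smoothFunctions U), v a = 0 →
        (v ((a - c (a.1 p)) * b)).1 p = 0 := fun a b ha => by
      rw [Derivation.leibniz, map_sub, ha, Derivation.map_algebraMap, sub_zero, smul_zero, add_zero]
      change (a.1 p - a.1 p) * _ = 0
      rw [sub_self, zero_mul]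
    have h5 : ∀ (a b : smoothFunctions U), (a + b).1 p = a.1 p + b.1 p := fun _ _ => rfl
    rw [h3, map_add, map_add, Derivation.map_algebraMap, zero_add]
    simp only [Fin.sum_univ_three, map_add, h5, h4 _ _ (hx _), h4 _ _ (he _ _), add_zero]
  change (v f).1 p - _ = 0 at h1
  rw [h2, sub_zero] at h1
  exact h1

/-- A vector field is determined by the velocities of the base point and of the frame vectors. -/
theorem vfield_ext {v w : VField (smoothFunctions U)} (hx : ∀ k, v (xCoord U k) = w (xCoord U k))
    (he : ∀ i k, v (eCoord U i k) = w (eCoord U i k)) : v = w :=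
  sub_eq_zero.mp (derivation_eq_zero (fun k => by rw [Derivation.sub_apply, hx, sub_self])
    fun i k => by rw [Derivation.sub_apply, he, sub_self])

/-! ### Tangent vector fields of the ambient space as derivations -/

/-- A vector field on the ambient space is tangent to the frame bundle. -/
def IsTangent (Ξ : FrameAmbient → FrameAmbient) : Prop :=
  ∀ p : FrameBundle, ∃ γ : ℝ → FrameBundle, γ 0 = p ∧
    HasDerivAt (fun t => (γ t : FrameAmbient)) (Ξ p) 0

/-- The derivative in a tangent direction can be computed along a curve in the frame bundle, which
stays in U for small times; so only the restriction of the function to U near p matters. -/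
theorem IsTangent.fderiv_eq {Ξ : FrameAmbient → FrameAmbient} (hΞ : IsTangent Ξ)
    {g g' : FrameAmbient → ℝ} (hg : ContDiff ℝ ∞ g) (hg' : ContDiff ℝ ∞ g') {p : U}
    (h : ∀ᶠ q : U in 𝓝 p, g (q : FrameBundle) = g' (q : FrameBundle)) :
    fderiv ℝ g (p : FrameBundle) (Ξ (p : FrameBundle)) =
      fderiv ℝ g' (p : FrameBundle) (Ξ (p : FrameBundle)) := by
  obtain ⟨γ, hγ0, hγ⟩ := hΞ p
  have hcont : Tendsto (fun t => (γ t : FrameAmbient)) (𝓝 0) (𝓝 ((p : FrameBundle) : FrameAmbient)) := by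
    have := hγ.continuousAt.tendsto
    rwa [hγ0] at this
  have hcont' : Tendsto γ (𝓝 0) (𝓝 (p : FrameBundle)) :=
    tendsto_subtype_rng.mpr hcont
  have hU : ∀ᶠ t in 𝓝 (0 : ℝ), γ t ∈ U := hcont' (U.isOpen.mem_nhds p.2)
  have key : ∀ {f : FrameAmbient → ℝ}, ContDiff ℝ ∞ f →
      HasDerivAt (fun t => f (γ t)) (fderiv ℝ f (p : FrameBundle) (Ξ (p : FrameBundle))) 0 := by
    intro f hf
    have h1 : HasFDerivAt f (fderiv ℝ f (p : FrameBundle)) (γ 0 : FrameAmbient) := by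
      rw [hγ0]
      exact (hf.differentiable (by simp) _).hasFDerivAt
    exact h1.comp_hasDerivAt 0 hγ
  refine ((key hg').congr_of_eventuallyEq ?_).unique (key hg) |>.symm
  filter_upwards [hU, hcont.eventually (eventually_nhds_iff.mp h)] with t ht ht'
  exact ht' ⟨γ t, ht⟩ rfl

/-- The derivative of a smooth function on `U` along a vector field of the ambient space. -/
def derivAlong (Ξ : FrameAmbient → FrameAmbient) (f : smoothFunctions U) (p : U) : ℝ :=
  fderiv ℝ (f.2 p).choose (p : FrameBundle) (Ξ (p : FrameBundle))

theorem derivAlong_eq {Ξ : FrameAmbient → FrameAmbient} (hΞ : IsTangent Ξ)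
    (f : smoothFunctions U) {p : U} {g : FrameAmbient → ℝ} (hg : ContDiff ℝ ∞ g)
    (h : ∀ᶠ q : U in 𝓝 p, f.1 q = g (q : FrameBundle)) :
    derivAlong Ξ f p = fderiv ℝ g (p : FrameBundle) (Ξ (p : FrameBundle)) := by
  refine hΞ.fderiv_eq (f.2 p).choose_spec.1 hg ?_
  filter_upwards [(f.2 p).choose_spec.2, h] with q h1 h2
  exact h1.symm.trans h2

theorem derivAlong_add {Ξ : FrameAmbient → FrameAmbient} (hΞ : IsTangent Ξ)
    (f f' : smoothFunctions U) (p : U) :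
    derivAlong Ξ (f + f') p = derivAlong Ξ f p + derivAlong Ξ f' p := by
  obtain ⟨g, hg, h⟩ := f.2 p
  obtain ⟨g', hg', h'⟩ := f'.2 p
  have h'' : ∀ᶠ q : U in 𝓝 p, (f + f').1 q = (g + g') (q : FrameBundle) := by
    filter_upwards [h, h'] with q h1 h2
    exact congrArg₂ (· + ·) h1 h2
  rw [derivAlong_eq hΞ f hg h, derivAlong_eq hΞ f' hg' h',
    derivAlong_eq hΞ (f + f') (hg.add hg') h'',
    fderiv_fun_add (hg.differentiable (by simp) _) (hg'.differentiable (by simp) _)]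
  rfl

theorem derivAlong_smul {Ξ : FrameAmbient → FrameAmbient} (hΞ : IsTangent Ξ)
    (c : ℝ) (f : smoothFunctions U) (p : U) :
    derivAlong Ξ (c • f) p = c * derivAlong Ξ f p := by
  obtain ⟨g, hg, h⟩ := f.2 p
  have h'' : ∀ᶠ q : U in 𝓝 p, (c • f).1 q = (c • g) (q : FrameBundle) := by
    filter_upwards [h] with q h1
    exact congrArg (c * ·) h1
  rw [derivAlong_eq hΞ f hg h, derivAlong_eq hΞ (c • f) (hg.const_smul c) h'',
    fderiv_fun_const_smul (hg.differentiable (by simp) _)]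
  rfl

theorem derivAlong_mul {Ξ : FrameAmbient → FrameAmbient} (hΞ : IsTangent Ξ)
    (f f' : smoothFunctions U) (p : U) :
    derivAlong Ξ (f * f') p = f.1 p * derivAlong Ξ f' p + f'.1 p * derivAlong Ξ f p := by
  obtain ⟨g, hg, h⟩ := f.2 p
  obtain ⟨g', hg', h'⟩ := f'.2 p
  have h'' : ∀ᶠ q : U in 𝓝 p, (f * f').1 q = (g * g') (q : FrameBundle) := by
    filter_upwards [h, h'] with q h1 h2
    exact congrArg₂ (· * ·) h1 h2
  rw [derivAlong_eq hΞ f hg h, derivAlong_eq hΞ f' hg' h',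
    derivAlong_eq hΞ (f * f') (hg.mul hg') h'',
    fderiv_fun_mul (hg.differentiable (by simp) _) (hg'.differentiable (by simp) _),
    h.self_of_nhds, h'.self_of_nhds]
  rfl

theorem derivAlong_smooth {Ξ : FrameAmbient → FrameAmbient} (hs : ContDiff ℝ ∞ Ξ)
    (hΞ : IsTangent Ξ) (f : smoothFunctions U) : derivAlong Ξ f ∈ smoothFunctions U := fun p => by
  obtain ⟨g, hg, h⟩ := f.2 p
  refine ⟨fun y => fderiv ℝ g y (Ξ y), (hg.fderiv_right (by simp)).clm_apply hs, ?_⟩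
  -- One ambient extension serves all points near p, so nearby values of the derivative come from
  -- the single smooth function y ↦ Dg(y)(Ξ y).
  filter_upwards [h.eventually_nhds] with q hq
  exact derivAlong_eq hΞ f hg hq

variable (U) in
/-- The derivation of the algebra of smooth functions that is given by a smooth vector field of the
ambient space which is tangent to the frame bundle. -/
def tangentField (Ξ : FrameAmbient → FrameAmbient) (hs : ContDiff ℝ ∞ Ξ) (hΞ : IsTangent Ξ) :
    VField (smoothFunctions U) :=
  Derivation.mk'
    { toFun := fun f => ⟨derivAlong Ξ f, derivAlong_smooth hs hΞ f⟩
      map_add' := fun f f' => Subtype.ext (funext (derivAlong_add hΞ f f'))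
      map_smul' := fun c f => Subtype.ext (funext (derivAlong_smul hΞ c f)) }
    fun f f' => Subtype.ext (funext (derivAlong_mul hΞ f f'))

theorem tangentField_apply {Ξ : FrameAmbient → FrameAmbient} (hs : ContDiff ℝ ∞ Ξ)
    (hΞ : IsTangent Ξ) (f : smoothFunctions U) {p : U} {g : FrameAmbient → ℝ} (hg : ContDiff ℝ ∞ g)
    (h : ∀ᶠ q : U in 𝓝 p, f.1 q = g (q : FrameBundle)) :
    (tangentField U Ξ hs hΞ f).1 p = fderiv ℝ g (p : FrameBundle) (Ξ (p : FrameBundle)) :=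
  derivAlong_eq hΞ f hg h

/-! ### The frame fields -/

/-- Translation of the base point. -/
def translate (w : EuclideanSpace ℝ (Fin 3)) (p : FrameBundle) : FrameBundle :=
  ⟨(p.1.1 + w, p.1.2), p.2⟩

/-- The rotation by the angle `t` in the plane of the `i`-th and `j`-th vectors. -/
def rotateVectors (i j : Fin 3) (t : ℝ) (e : Fin 3 → EuclideanSpace ℝ (Fin 3)) :
    Fin 3 → EuclideanSpace ℝ (Fin 3) := fun l =>
  if l = i then Real.cos t • e i + Real.sin t • e j else
    if l = j then -(Real.sin t • e i) + Real.cos t • e j else e l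

/-- The rotation of the frame by the angle `t` in the plane of `eᵢ` and `eⱼ`. -/
def rotate {i j : Fin 3} (hij : i ≠ j) (t : ℝ) (p : FrameBundle) : FrameBundle :=
  ⟨(p.1.1, rotateVectors i j t p.1.2), by
    obtain ⟨⟨x, e⟩, h1, h2⟩ := p
    have h := orthonormal_iff_ite.mp h1
    have hc := Real.cos_sq_add_sin_sq t
    constructor
    · rw [orthonormal_iff_ite]
      intro l m
      simp only [rotateVectors]
      dsimp only at h
      fin_cases i <;> fin_cases j <;> simp at hij <;> fin_cases l <;> fin_cases m <;>
        simp [-inner_self_eq_norm_sq_to_K, inner_add_left, inner_add_right, inner_smul_left,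
          inner_smul_right, h] <;>
        first | linear_combination hc | ring
    · simp only [Matrix.det_fin_three, Matrix.of_apply, rotateVectors] at h2 ⊢
      -- The determinant is multiplied by cos² + sin².
      fin_cases i <;> fin_cases j <;> simp at hij ⊢ <;> 
        linear_combination (Real.cos t ^ 2 + Real.sin t ^ 2) * h2 + hc⟩

/-- The infinitesimal rotation of the frame in the plane of `eᵢ` and `eⱼ`. -/
def rotationVelocity (i j : Fin 3) (y : FrameAmbient) : FrameAmbient :=
  (0, fun l => if l = i then y.2 j else if l = j then -y.2 i else 0)

theorem contDiff_rotationVelocity (i j : Fin 3) : ContDiff ℝ ∞ (rotationVelocity i j) := by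
  refine contDiff_const.prodMk (contDiff_pi.mpr fun l => ?_)
  split_ifs <;> fun_prop

theorem isTangent_rotationVelocity {i j : Fin 3} (hij : i ≠ j) :
    IsTangent (rotationVelocity i j) := fun p => by
  refine ⟨fun t => rotate hij t p, ?_, ?_⟩
  · refine Subtype.ext (Prod.ext rfl (funext fun l => ?_))
    simp only [rotate, rotateVectors]
    split_ifs with h1 h2 <;> simp [*]
  · refine (hasDerivAt_const _ _).prodMk (hasDerivAt_pi.mpr fun l => ?_)
    simp only [rotateVectors]
    have hs := Real.hasDerivAt_sin 0
    have hc := Real.hasDerivAt_cos 0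
    split_ifs with h1 h2
    · simpa using (hc.smul_const (p.1.2 i)).fun_add (hs.smul_const (p.1.2 j))
    · simpa using (hs.smul_const (p.1.2 i)).fun_neg.fun_add (hc.smul_const (p.1.2 j))
    · exact hasDerivAt_const _ _

theorem contDiff_translationVelocity (i : Fin 3) :
    ContDiff ℝ ∞ fun y : FrameAmbient => ((y.2 i, 0) : FrameAmbient) := by
  fun_prop

theorem isTangent_translationVelocity (i : Fin 3) :
    IsTangent fun y : FrameAmbient => ((y.2 i, 0) : FrameAmbient) := fun p => by
  refine ⟨fun t => translate (t • p.1.2 i) p, ?_, ?_⟩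
  · simp [translate]
  · refine HasDerivAt.prodMk ?_ (hasDerivAt_const _ _)
    simpa using ((hasDerivAt_id (0 : ℝ)).smul_const (p.1.2 i)).const_add p.1.1

variable (U)

/-- The vector field that translates the base point in the direction `eᵢ`. -/
def translationField (i : Fin 3) : VField (smoothFunctions U) :=
  tangentField U _ (contDiff_translationVelocity i) (isTangent_translationVelocity i)

/-- The vector field along which `eᵢ` has velocity `eⱼ` and `eⱼ` has velocity `-eᵢ`. -/
def rotationField {i j : Fin 3} (hij : i ≠ j) : VField (smoothFunctions U) :=
  tangentField U _ (contDiff_rotationVelocity i j) (isTangent_rotationVelocity hij)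

theorem fderiv_xCoord (k : Fin 3) (y w : FrameAmbient) :
    fderiv ℝ (fun y : FrameAmbient => y.1 k) y w = w.1 k := by
  have : (fun y : FrameAmbient => y.1 k) =
      ((EuclideanSpace.proj k).comp (ContinuousLinearMap.fst ℝ _ _) : FrameAmbient →L[ℝ] ℝ) := rfl
  rw [this, ContinuousLinearMap.fderiv]
  rfl

theorem fderiv_eCoord (i k : Fin 3) (y w : FrameAmbient) :
    fderiv ℝ (fun y : FrameAmbient => y.2 i k) y w = w.2 i k := by
  have : (fun y : FrameAmbient => y.2 i k) =
      ((EuclideanSpace.proj k).comp ((ContinuousLinearMap.proj i).comp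
        (ContinuousLinearMap.snd ℝ _ _)) : FrameAmbient →L[ℝ] ℝ) := rfl
  rw [this, ContinuousLinearMap.fderiv]
  rfl

variable {U}

theorem tangentField_xCoord {Ξ : FrameAmbient → FrameAmbient} (hs : ContDiff ℝ ∞ Ξ)
    (hΞ : IsTangent Ξ) (k : Fin 3) (p : U) :
    (tangentField U Ξ hs hΞ (xCoord U k)).1 p = (Ξ (p : FrameBundle)).1 k := by
  rw [tangentField_apply hs hΞ _ (g := fun y => y.1 k) (by fun_prop)
    (Eventually.of_forall fun _ => rfl), fderiv_xCoord]

theorem tangentField_eCoord {Ξ : FrameAmbient → FrameAmbient} (hs : ContDiff ℝ ∞ Ξ)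
    (hΞ : IsTangent Ξ) (i k : Fin 3) (p : U) :
    (tangentField U Ξ hs hΞ (eCoord U i k)).1 p = (Ξ (p : FrameBundle)).2 i k := by
  rw [tangentField_apply hs hΞ _ (g := fun y => y.2 i k) (by fun_prop)
    (Eventually.of_forall fun _ => rfl), fderiv_eCoord]

@[simp]
theorem translationField_xCoord (i k : Fin 3) :
    translationField U i (xCoord U k) = eCoord U i k :=
  Subtype.ext (funext fun p => tangentField_xCoord _ _ k p)

@[simp]
theorem translationField_eCoord (i j k : Fin 3) :
    translationField U i (eCoord U j k) = 0 :=
  Subtype.ext (funext fun p => tangentField_eCoord _ _ j k p)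

@[simp]
theorem rotationField_xCoord {i j : Fin 3} (hij : i ≠ j) (k : Fin 3) :
    rotationField U hij (xCoord U k) = 0 :=
  Subtype.ext (funext fun p => tangentField_xCoord _ _ k p)

theorem rotationField_eCoord {i j : Fin 3} (hij : i ≠ j) (l k : Fin 3) :
    rotationField U hij (eCoord U l k) =
      if l = i then eCoord U j k else if l = j then -eCoord U i k else 0 := by
  refine Subtype.ext (funext fun p => (tangentField_eCoord _ _ l k p).trans ?_)
  simp only [rotationVelocity]
  split_ifs <;> rfl

/-! ### Orthonormality of the frame -/

theorem sum_eCoord_mul_eCoord (i j : Fin 3) :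
    ∑ k, eCoord U i k * eCoord U j k = if i = j then 1 else 0 := by
  ext p
  have h := orthonormal_iff_ite.mp (p : FrameBundle).2.1 i j
  simp only [PiLp.inner_apply, Fin.sum_univ_three] at h
  simp only [Fin.sum_univ_three]
  have h2 : ((if i = j then 1 else 0 : smoothFunctions U)).1 p = if i = j then 1 else 0 := by
    split_ifs <;> rfl
  rw [h2, ← h]
  let e := (p : FrameBundle).1.2
  change e i 0 * e j 0 + e i 1 * e j 1 + e i 2 * e j 2 = _
  simp only [RCLike.inner_apply, conj_trivial]
  ring

/-- Orthonormal rows imply orthonormal columns: a one-sided inverse of a square matrix over a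
commutative ring is two-sided. -/
theorem sum_eCoord_mul_eCoord' (k l : Fin 3) :
    ∑ i, eCoord U i k * eCoord U i l = if k = l then 1 else 0 := by
  let M : Matrix (Fin 3) (Fin 3) (smoothFunctions U) := Matrix.of (eCoord U)
  have h1 : M * M.transpose = 1 := by
    ext1 i j
    rw [Matrix.mul_apply, Matrix.one_apply]
    exact sum_eCoord_mul_eCoord i j
  have h2 : (M.transpose * M) k l = (1 : Matrix (Fin 3) (Fin 3) (smoothFunctions U)) k l := by
    rw [mul_eq_one_comm.mp h1]
  rw [Matrix.mul_apply, Matrix.one_apply] at h2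
  exact h2

end FrameBundle

end

noncomputable section

/-! ### Functions with vanishing derivatives -/

namespace FrameBundle

open scoped ContDiff Topology
open Filter

/-! ### Gram–Schmidt retraction onto the frame bundle -/

/-- The ambient space of the frame vectors. -/
abbrev E3 : Type := EuclideanSpace ℝ (Fin 3)

/-- The unit vector in the direction of `w`. -/
def unitVec (w : E3) : E3 := ‖w‖⁻¹ • w

theorem inner_unitVec_self {w : E3} (hw : w ≠ 0) : inner ℝ (unitVec w) (unitVec w) = 1 := by
  have : ‖w‖ ≠ 0 := norm_ne_zero_iff.mpr hw
  rw [unitVec, inner_smul_left, inner_smul_right, real_inner_self_eq_norm_sq]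
  simp
  field_simp

theorem inner_unitVec_right_eq_zero {u w : E3} (h : inner ℝ u w = 0) : inner ℝ u (unitVec w) = 0 := by
  rw [unitVec, inner_smul_right, h, mul_zero]

theorem unitVec_eq_self {w : E3} (hw : ‖w‖ = 1) : unitVec w = w := by
  rw [unitVec, hw, inv_one, one_smul]

theorem _root_.DifferentiableAt.unitVec {w : FrameAmbient → E3} {y : FrameAmbient}
    (h : DifferentiableAt ℝ w y) (h0 : w y ≠ 0) : DifferentiableAt ℝ (fun y => unitVec (w y)) y :=
  ((h.norm ℝ h0).inv (norm_ne_zero_iff.mpr h0)).smul h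

/-- The component of the second frame vector that is orthogonal to the first one. -/
def gsVec₁ (y : FrameAmbient) : E3 := y.2 1 - inner ℝ (unitVec (y.2 0)) (y.2 1) • unitVec (y.2 0)

/-- The component of the third frame vector that is orthogonal to the other two. -/
def gsVec₂ (y : FrameAmbient) : E3 :=
  y.2 2 - inner ℝ (unitVec (y.2 0)) (y.2 2) • unitVec (y.2 0) -
    inner ℝ (unitVec (gsVec₁ y)) (y.2 2) • unitVec (gsVec₁ y)

/-- Gram–Schmidt orthonormalization, a retraction of a neighbourhood of the frame bundle. -/
def gramSchmidtRetract (y : FrameAmbient) : FrameAmbient :=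
  (y.1, ![unitVec (y.2 0), unitVec (gsVec₁ y), unitVec (gsVec₂ y)])

/-- The tuples to which Gram–Schmidt orthonormalization can be applied. -/
def IsNondegenerate (y : FrameAmbient) : Prop := y.2 0 ≠ 0 ∧ gsVec₁ y ≠ 0 ∧ gsVec₂ y ≠ 0

theorem differentiableAt_gsVec₁ {y : FrameAmbient} (h : y.2 0 ≠ 0) : DifferentiableAt ℝ gsVec₁ y := by
  have h0 : DifferentiableAt ℝ (fun y : FrameAmbient => unitVec (y.2 0)) y :=
    DifferentiableAt.unitVec (by fun_prop) h
  have h1 : DifferentiableAt ℝ (fun y : FrameAmbient => y.2 1) y := by fun_prop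
  exact h1.sub ((h0.inner ℝ h1).smul h0)

theorem differentiableAt_gsVec₂ {y : FrameAmbient} (h : y.2 0 ≠ 0) (h' : gsVec₁ y ≠ 0) :
    DifferentiableAt ℝ gsVec₂ y := by
  have h0 : DifferentiableAt ℝ (fun y : FrameAmbient => unitVec (y.2 0)) y :=
    DifferentiableAt.unitVec (by fun_prop) h
  have h1 : DifferentiableAt ℝ (fun y : FrameAmbient => unitVec (gsVec₁ y)) y :=
    DifferentiableAt.unitVec (differentiableAt_gsVec₁ h) h'
  have h2 : DifferentiableAt ℝ (fun y : FrameAmbient => y.2 2) y := by fun_prop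
  exact (h2.sub ((h0.inner ℝ h2).smul h0)).sub ((h1.inner ℝ h2).smul h1)

theorem IsNondegenerate.differentiableAt {y : FrameAmbient} (h : IsNondegenerate y) :
    DifferentiableAt ℝ gramSchmidtRetract y := by
  refine differentiableAt_fst.prodMk (differentiableAt_pi.mpr fun i => ?_)
  have h0 : DifferentiableAt ℝ (fun y : FrameAmbient => unitVec (y.2 0)) y :=
    DifferentiableAt.unitVec (by fun_prop) h.1
  fin_cases i
  · exact h0
  · exact (differentiableAt_gsVec₁ h.1).unitVec h.2.1
  · exact (differentiableAt_gsVec₂ h.1 h.2.1).unitVec h.2.2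

theorem IsNondegenerate.orthonormal {y : FrameAmbient} (h : IsNondegenerate y) :
    Orthonormal ℝ (gramSchmidtRetract y).2 := by
  obtain ⟨h0, h1, h2⟩ := h
  have n0 := inner_unitVec_self h0
  have n1 := inner_unitVec_self h1
  have n2 := inner_unitVec_self h2
  have o1 : inner ℝ (unitVec (y.2 0)) (unitVec (gsVec₁ y)) = 0 := by
    refine inner_unitVec_right_eq_zero ?_
    rw [gsVec₁, inner_sub_right, inner_smul_right, n0]
    ring
  have o2 : inner ℝ (unitVec (y.2 0)) (unitVec (gsVec₂ y)) = 0 := by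
    refine inner_unitVec_right_eq_zero ?_
    rw [gsVec₂, inner_sub_right, inner_sub_right, inner_smul_right, inner_smul_right, n0, o1]
    ring
  have o3 : inner ℝ (unitVec (gsVec₁ y)) (unitVec (gsVec₂ y)) = 0 := by
    refine inner_unitVec_right_eq_zero ?_
    rw [gsVec₂, inner_sub_right, inner_sub_right, inner_smul_right, inner_smul_right, n1,
      real_inner_comm (unitVec (y.2 0)), o1]
    ring
  rw [orthonormal_iff_ite]
  intro i j
  fin_cases i <;> fin_cases j
  · exact n0
  · exact o1
  · exact o2
  · exact (real_inner_comm _ _).trans o1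
  · exact n1
  · exact o3
  · exact (real_inner_comm _ _).trans o2
  · exact (real_inner_comm _ _).trans o3
  · exact n2

theorem gsVec₁_coe (p : FrameBundle) : gsVec₁ p = p.1.2 1 := by
  have h := orthonormal_iff_ite.mp p.2.1
  rw [gsVec₁, unitVec_eq_self (p.2.1.1 0), h 0 1]
  simp

theorem gsVec₂_coe (p : FrameBundle) : gsVec₂ p = p.1.2 2 := by
  have h := orthonormal_iff_ite.mp p.2.1
  rw [gsVec₂, gsVec₁_coe, unitVec_eq_self (p.2.1.1 0), unitVec_eq_self (p.2.1.1 1), h 0 2, h 1 2]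
  simp

theorem gramSchmidtRetract_coe (p : FrameBundle) : gramSchmidtRetract p = p := by
  refine Prod.ext rfl (funext fun i => ?_)
  simp only [gramSchmidtRetract, gsVec₁_coe, gsVec₂_coe, unitVec_eq_self (p.2.1.1 _)]
  fin_cases i <;> rfl

theorem isNondegenerate_coe (p : FrameBundle) : IsNondegenerate p := by
  rw [IsNondegenerate, gsVec₁_coe, gsVec₂_coe]
  exact ⟨p.2.1.ne_zero 0, p.2.1.ne_zero 1, p.2.1.ne_zero 2⟩

theorem eventually_isNondegenerate (p : FrameBundle) :
    ∀ᶠ y in 𝓝 (p : FrameAmbient), IsNondegenerate y := by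
  obtain ⟨h0, h1, h2⟩ := isNondegenerate_coe p
  have c0 : ContinuousAt (fun y : FrameAmbient => y.2 0) p := by fun_prop
  filter_upwards [c0.eventually_ne h0, (differentiableAt_gsVec₁ h0).continuousAt.eventually_ne h1,
    (differentiableAt_gsVec₂ h0 h1).continuousAt.eventually_ne h2] with y a b c
  exact ⟨a, b, c⟩

/-- The determinant of the matrix with columns `e i`. -/
def frameDet (y : FrameAmbient) : ℝ := (Matrix.of fun k i : Fin 3 => y.2 i k).det

theorem continuous_frameDet : Continuous frameDet := by
  unfold frameDet
  simp only [Matrix.det_fin_three, Matrix.of_apply]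
  fun_prop

theorem frameDet_mul_self {y : FrameAmbient} (h : Orthonormal ℝ y.2) :
    frameDet y * frameDet y = 1 := by
  let M : Matrix (Fin 3) (Fin 3) ℝ := Matrix.of fun k i : Fin 3 => y.2 i k
  have h1 : M.transpose * M = 1 := by
    ext i j
    rw [Matrix.mul_apply, Matrix.one_apply, ← orthonormal_iff_ite.mp h i j, PiLp.inner_apply]
    refine Finset.sum_congr rfl fun k _ => ?_
    change y.2 i k * y.2 j k = _
    rw [RCLike.inner_apply, conj_trivial, mul_comm]
  have h2 := congrArg Matrix.det h1
  rwa [Matrix.det_mul, Matrix.det_transpose, Matrix.det_one] at h2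

/-- An orthonormal triple has determinant ±1, and by continuity the determinant of the retracted
triple is positive near p, hence 1. Openness of U does the rest. -/
theorem eventually_gramSchmidtRetract_mem {U : TopologicalSpace.Opens FrameBundle} (p : U) :
    ∀ᶠ y in 𝓝 ((p : FrameBundle) : FrameAmbient),
      ∃ q : U, ((q : FrameBundle) : FrameAmbient) = gramSchmidtRetract y := by
  have hr : Tendsto gramSchmidtRetract (𝓝 ((p : FrameBundle) : FrameAmbient))
      (𝓝 ((p : FrameBundle) : FrameAmbient)) := by
    have := (isNondegenerate_coe p).differentiableAt.continuousAt.tendsto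
    rwa [gramSchmidtRetract_coe] at this
  have hdet : ∀ᶠ y in 𝓝 ((p : FrameBundle) : FrameAmbient), 0 < frameDet y := by
    have : frameDet (p : FrameBundle) = 1 := (p : FrameBundle).2.2
    exact continuous_frameDet.continuousAt.eventually (lt_mem_nhds (by rw [this]; exact one_pos))
  have hU : ∀ᶠ y in 𝓝 ((p : FrameBundle) : FrameAmbient),
      ∀ q : FrameBundle, (q : FrameAmbient) = y → q ∈ U := by
    have := U.isOpen.mem_nhds p.2
    rw [nhds_subtype_eq_comap] at this
    exact eventually_comap.mp this
  filter_upwards [hr.eventually hdet, hr.eventually hU, eventually_isNondegenerate p]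
    with y h1 h2 h3
  have h4 : frameDet (gramSchmidtRetract y) = 1 := by
    nlinarith [frameDet_mul_self h3.orthonormal]
  exact ⟨⟨⟨gramSchmidtRetract y, h3.orthonormal, h4⟩, h2 _ rfl⟩, rfl⟩

theorem eq_sum_inner_smul {e : Fin 3 → E3} (he : Orthonormal ℝ e) (w : E3) :
    w = ∑ i, inner ℝ (e i) w • e i := by
  let b := basisOfOrthonormalOfCardEqFinrank he (by simp)
  have hb : ⇑b = e := coe_basisOfOrthonormalOfCardEqFinrank he (by simp)
  let ob : OrthonormalBasis (Fin 3) ℝ E3 := b.toOrthonormalBasis (by rwa [hb])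
  have hob : ⇑ob = e := by rw [Module.Basis.coe_toOrthonormalBasis, hb]
  have := (ob.sum_repr' w).symm
  rwa [hob] at this

/-! ### Functions annihilated by the moving frame -/

variable {U : TopologicalSpace.Opens FrameBundle}

/-- The vector fields of the moving frame annihilate `f`. -/
def IsInvariant (f : smoothFunctions U) : Prop :=
  (∀ i, translationField U i f = 0) ∧ ∀ (i j : Fin 3) (hij : i ≠ j), rotationField U hij f = 0

/-- The condition on τ is the linearization of ⟨eᵢ, eⱼ⟩ = δᵢⱼ. Such a τ is a combination at p of the
translations and of the three rotations of the frame, and the derivative of g vanishes along each of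
these. -/
theorem IsInvariant.fderiv_eq_zero {f : smoothFunctions U} (hf : IsInvariant f)
    {g : FrameAmbient → ℝ} (hg : ContDiff ℝ ∞ g) {p : U}
    (h : ∀ᶠ q : U in 𝓝 p, f.1 q = g (q : FrameBundle)) {τ : FrameAmbient}
    (hτ : ∀ i j, inner ℝ (τ.2 i) ((p : FrameBundle).1.2 j) +
      inner ℝ ((p : FrameBundle).1.2 i) (τ.2 j) = 0) :
    fderiv ℝ g (p : FrameBundle) τ = 0 := by
  have ht : ∀ i, fderiv ℝ g (p : FrameBundle) ((p : FrameBundle).1.2 i, 0) = 0 := fun i => by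
    have := tangentField_apply (contDiff_translationVelocity i) (isTangent_translationVelocity i)
      f hg h
    rw [← this]
    exact congrArg (fun a : smoothFunctions U => a.1 p) (hf.1 i)
  have hr : ∀ (i j : Fin 3), i ≠ j →
      fderiv ℝ g (p : FrameBundle) (rotationVelocity i j (p : FrameBundle)) = 0 := fun i j hij => by
    have := tangentField_apply (contDiff_rotationVelocity i j) (isTangent_rotationVelocity hij)
      f hg h
    rw [← this]
    exact congrArg (fun a : smoothFunctions U => a.1 p) (hf.2 i j hij)
  obtain ⟨⟨⟨x, e⟩, he, hdet⟩, hp⟩ := p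
  obtain ⟨τx, τe⟩ := τ
  simp only at hτ
  have hs : ∀ i, inner ℝ (e i) (τe i) = 0 := fun i => by
    have := hτ i i
    rw [real_inner_comm] at this
    linarith
  have ha : ∀ i j, inner ℝ (e i) (τe j) = - inner ℝ (e j) (τe i) := fun i j => by
    have := hτ i j
    rw [real_inner_comm] at this
    linarith
  have key : ((τx, τe) : FrameAmbient) = ∑ i, inner ℝ (e i) τx • ((e i, 0) : FrameAmbient) +
      (inner ℝ (e 1) (τe 0) • rotationVelocity 0 1 (x, e) +
      inner ℝ (e 2) (τe 0) • rotationVelocity 0 2 (x, e) +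
      inner ℝ (e 2) (τe 1) • rotationVelocity 1 2 (x, e)) := by
    refine Prod.ext ?_ (funext fun l => ?_)
    · conv_lhs => rw [show ((τx, τe) : FrameAmbient).1 = τx from rfl, eq_sum_inner_smul he τx]
      simp [rotationVelocity, Fin.sum_univ_three]
    · conv_lhs => rw [show ((τx, τe) : FrameAmbient).2 l = τe l from rfl,
        eq_sum_inner_smul he (τe l)]
      have h1 := ha 0 1
      have h2 := ha 0 2
      have h3 := ha 1 2
      fin_cases l <;> simp [rotationVelocity, Fin.sum_univ_three, hs, h1, h2, h3]
  rw [key]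
  simp only [map_add, map_sum, map_smul, smul_eq_mul]
  have h1 := hr 0 1 (by decide)
  have h2 := hr 0 2 (by decide)
  have h3 := hr 1 2 (by decide)
  simp only at h1 h2 h3 ht
  simp [ht, h1, h2, h3]

/-- Compose an ambient extension g with the Gram–Schmidt retraction. The differential of the
retraction has tangent values, so the composite has zero derivative on a ball and is constant there;
on the frame bundle the retraction is the identity. -/
theorem IsInvariant.isLocallyConstant {f : smoothFunctions U} (hf : IsInvariant f) :
    IsLocallyConstant f.1 := by
  rw [IsLocallyConstant.iff_eventually_eq]
  intro p
  obtain ⟨g, hg, hfg⟩ := f.2 p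
  have hr : Tendsto gramSchmidtRetract (𝓝 ((p : FrameBundle) : FrameAmbient))
      (𝓝 ((p : FrameBundle) : FrameAmbient)) := by
    have := (isNondegenerate_coe p).differentiableAt.continuousAt.tendsto
    rwa [gramSchmidtRetract_coe] at this
  have hfg' := eventually_nhds_iff.mp hfg.eventually_nhds
  obtain ⟨ε, hε, hball⟩ := Metric.eventually_nhds_iff_ball.mp
    ((eventually_gramSchmidtRetract_mem p).and
      ((hr.eventually hfg').and (eventually_isNondegenerate p)))
  set B := Metric.ball ((p : FrameBundle) : FrameAmbient) ε
  have hd : ∀ y ∈ B, HasFDerivAt (fun y => g (gramSchmidtRetract y)) (0 : FrameAmbient →L[ℝ] ℝ) y := by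
    intro y hy
    obtain ⟨⟨q, hq⟩, h2, h3⟩ := hball y hy
    have hD := h3.differentiableAt.hasFDerivAt
    have h := (hg.differentiable (by simp) (gramSchmidtRetract y)).hasFDerivAt.comp y hD
    have h0 : (fderiv ℝ g (gramSchmidtRetract y)).comp (fderiv ℝ gramSchmidtRetract y) = 0 := by
      refine ContinuousLinearMap.ext fun w => ?_
      rw [ContinuousLinearMap.comp_apply, zero_apply, ← hq]
      refine hf.fderiv_eq_zero hg (h2 q hq) fun i j => ?_
      rw [hq]
      have hcomp : ∀ i, HasFDerivAt (fun y => (gramSchmidtRetract y).2 i)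
          ((ContinuousLinearMap.proj i).comp ((ContinuousLinearMap.snd ℝ E3 (Fin 3 → E3)).comp
            (fderiv ℝ gramSchmidtRetract y))) y := fun i =>
        ((ContinuousLinearMap.proj (R := ℝ) (φ := fun _ : Fin 3 => E3) i).comp
          (ContinuousLinearMap.snd ℝ E3 (Fin 3 → E3))).hasFDerivAt.comp y hD
      have hin := (hcomp i).inner ℝ (hcomp j)
      -- Near y the retracted triple is orthonormal, so its inner products are constant; their
      -- vanishing derivative is the tangency condition.
      have hconst : HasFDerivAt (fun y => inner ℝ ((gramSchmidtRetract y).2 i)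
          ((gramSchmidtRetract y).2 j)) (0 : FrameAmbient →L[ℝ] ℝ) y := by
        refine (hasFDerivAt_const (if i = j then (1 : ℝ) else 0) y).congr_of_eventuallyEq ?_
        filter_upwards [Metric.isOpen_ball.mem_nhds hy] with z hz
        exact orthonormal_iff_ite.mp (hball z hz).2.2.orthonormal i j
      have := DFunLike.congr_fun (hin.unique hconst) w
      simp only [ContinuousLinearMap.comp_apply, fderivInnerCLM_apply, ContinuousLinearMap.prod_apply,
        zero_apply] at this
      rw [add_comm]
      exact this
    rwa [h0] at h
  have hconst : ∀ y ∈ B, g (gramSchmidtRetract y) = g (p : FrameBundle) := by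
    intro y hy
    have := (convex_ball ((p : FrameBundle) : FrameAmbient) ε).is_const_of_fderivWithin_eq_zero
      (𝕜 := ℝ) (f := fun y => g (gramSchmidtRetract y))
      (fun z hz => (hd z hz).differentiableAt.differentiableWithinAt)
      (fun z hz => by
        rw [fderivWithin_of_isOpen Metric.isOpen_ball hz, (hd z hz).fderiv])
      hy (Metric.mem_ball_self hε)
    rwa [gramSchmidtRetract_coe] at this
  filter_upwards [hfg, eventually_nhds_iff.mpr (Filter.Eventually.mono
    (Metric.ball_mem_nhds ((p : FrameBundle) : FrameAmbient) hε) fun y hy q hq =>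
      (show ((q : FrameBundle) : FrameAmbient) ∈ B from hq ▸ hy))] with q h1 h2
  rw [h1, hfg.self_of_nhds, ← hconst _ h2, gramSchmidtRetract_coe]

theorem IsInvariant.exists_eq_algebraMap {f : smoothFunctions U} (hf : IsInvariant f)
    (hU : IsConnected (U : Set FrameBundle)) : ∃ c : ℝ, f = algebraMap ℝ _ c := by
  have : ConnectedSpace U := isConnected_iff_connectedSpace.mp hU
  obtain ⟨p⟩ := this.toNonempty
  exact ⟨f.1 p, Subtype.ext (funext fun q => hf.isLocallyConstant.apply_eq_of_isPreconnected
    isPreconnected_univ (Set.mem_univ q) (Set.mem_univ p))⟩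

/-! ### Connectedness of the frame bundle -/

theorem rotate_zero {i j : Fin 3} (hij : i ≠ j) (p : FrameBundle) : rotate hij 0 p = p := by
  refine Subtype.ext (Prod.ext rfl (funext fun l => ?_))
  simp only [rotate, rotateVectors]
  split_ifs with h1 h2 <;> simp [*]

theorem connectedComponent_rotate {i j : Fin 3} (hij : i ≠ j) (t : ℝ) (p : FrameBundle) :
    connectedComponent (rotate hij t p) = connectedComponent p := by
  have hc : Continuous fun t => rotate hij t p := by
    refine Continuous.subtype_mk (continuous_const.prodMk (continuous_pi fun l => ?_)) _
    simp only [rotateVectors]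
    split_ifs <;> fun_prop
  refine (connectedComponent_eq ((isPreconnected_range hc).subset_connectedComponent ?_ ?_)).symm
  · exact ⟨0, rotate_zero hij p⟩
  · exact ⟨t, rfl⟩

theorem connectedComponent_translate (w : E3) (p : FrameBundle) :
    connectedComponent (translate w p) = connectedComponent p := by
  have hc : Continuous fun t : ℝ => translate (t • w) p :=
    Continuous.subtype_mk (by fun_prop) _
  refine (connectedComponent_eq ((isPreconnected_range hc).subset_connectedComponent ?_ ?_)).symm
  · exact ⟨0, by simp [translate]⟩
  · exact ⟨1, by simp [translate]⟩

theorem exists_rotation_angle (a b : ℝ) :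
    ∃ t, Real.cos t * a + Real.sin t * b = 0 ∧ 0 ≤ -(Real.sin t * a) + Real.cos t * b := by
  let z : ℂ := ⟨a, b⟩
  have ha : ‖z‖ * Real.cos z.arg = a := Complex.norm_mul_cos_arg z
  have hb : ‖z‖ * Real.sin z.arg = b := Complex.norm_mul_sin_arg z
  -- This angle rotates (a, b) onto the nonnegative second axis, where it becomes (0, ‖z‖).
  refine ⟨z.arg - Real.pi / 2, ?_, ?_⟩
  · rw [Real.cos_sub_pi_div_two, Real.sin_sub_pi_div_two]
    linear_combination -Real.sin z.arg * ha + Real.cos z.arg * hb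
  · rw [Real.cos_sub_pi_div_two, Real.sin_sub_pi_div_two]
    have : -(-Real.cos z.arg * a) + Real.sin z.arg * b = ‖z‖ := by
      linear_combination -Real.cos z.arg * ha - Real.sin z.arg * hb +
        ‖z‖ * Real.sin_sq_add_cos_sq z.arg
    rw [this]
    exact norm_nonneg _

theorem exists_rotate {i j : Fin 3} (hij : i ≠ j) (k : Fin 3) (p : FrameBundle) :
    ∃ t, (rotate hij t p).1.2 i k = 0 ∧ 0 ≤ (rotate hij t p).1.2 j k := by
  obtain ⟨t, h1, h2⟩ := exists_rotation_angle (p.1.2 i k) (p.1.2 j k)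
  refine ⟨t, ?_, ?_⟩
  · simpa [rotate, rotateVectors] using h1
  · simpa [rotate, rotateVectors, hij.symm] using h2

/-- An orthonormal triangular matrix is diagonal with entries ±1. Two of the signs are given, and
the third follows from determinant 1. -/
theorem frame_eq_of_triangular (p : FrameBundle) (h02 : p.1.2 0 2 = 0) (h12 : p.1.2 1 2 = 0)
    (h01 : p.1.2 0 1 = 0) (h11 : 0 ≤ p.1.2 1 1) (h22 : 0 ≤ p.1.2 2 2) :
    p.1.2 = fun i => EuclideanSpace.single i 1 := by
  obtain ⟨⟨x, e⟩, he, hdet⟩ := p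
  have h := orthonormal_iff_ite.mp he
  simp only [Matrix.det_fin_three, Matrix.of_apply] at hdet h02 h12 h01 h11 h22
  simp only [PiLp.inner_apply, Fin.sum_univ_three, RCLike.inner_apply, conj_trivial] at h
  have q00 := h 0 0
  have q01 := h 0 1
  have q02 := h 0 2
  have q11 := h 1 1
  have q12 := h 1 2
  have q22 := h 2 2
  simp [h02, h12, h01] at q00 q01 q02 q11 q12 q22 hdet
  have a0 : e 0 0 ≠ 0 := fun h => by simp [h] at q00
  have b0 : e 1 0 = 0 := by tauto
  have c0 : e 2 0 = 0 := by tauto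
  simp [b0, c0] at q11 q12 q22 hdet
  have b1 : e 1 1 = 1 := by nlinarith
  simp [b1] at q12 hdet
  simp [q12] at q22
  have c2 : e 2 2 = 1 := by nlinarith
  simp [c2] at hdet
  ext i k
  fin_cases i <;> fin_cases k <;> simp [*]

/-- Three rotations in coordinate planes of the frame, as with Euler angles, make any frame
triangular with the required signs, and a translation moves the base point to 0. Each move runs
along a path and so stays in one connected component. -/
theorem isConnected_univ_frameBundle : IsConnected (Set.univ : Set FrameBundle) := by
  let o : FrameBundle := ⟨(0, fun i => EuclideanSpace.single i 1), by
    constructor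
    · exact EuclideanSpace.orthonormal_single
    · simp [Matrix.det_fin_three]⟩
  have key : ∀ p : FrameBundle, connectedComponent p = connectedComponent o := fun p => by
    obtain ⟨t₁, h1, -⟩ := exists_rotate (show (0 : Fin 3) ≠ 1 by decide) 2 p
    set p₁ := rotate (show (0 : Fin 3) ≠ 1 by decide) t₁ p with hp₁
    obtain ⟨t₂, h2, h2'⟩ := exists_rotate (show (1 : Fin 3) ≠ 2 by decide) 2 p₁
    have h3 : (rotate (show (1 : Fin 3) ≠ 2 by decide) t₂ p₁).1.2 0 2 = 0 := h1
    set p₂ := rotate (show (1 : Fin 3) ≠ 2 by decide) t₂ p₁ with hp₂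
    obtain ⟨t₃, h4, h4'⟩ := exists_rotate (show (0 : Fin 3) ≠ 1 by decide) 1 p₂
    have h5 : (rotate (show (0 : Fin 3) ≠ 1 by decide) t₃ p₂).1.2 0 2 = 0 := by
      simp [rotate, rotateVectors, h2, h3]
    have h6 : (rotate (show (0 : Fin 3) ≠ 1 by decide) t₃ p₂).1.2 1 2 = 0 := by
      simp [rotate, rotateVectors, h2, h3]
    have h7 : 0 ≤ (rotate (show (0 : Fin 3) ≠ 1 by decide) t₃ p₂).1.2 2 2 := h2'
    set p₃ := rotate (show (0 : Fin 3) ≠ 1 by decide) t₃ p₂ with hp₃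
    have h8 : translate (-p₃.1.1) p₃ = o :=
      Subtype.ext (Prod.ext (by simp [translate, o]) (frame_eq_of_triangular p₃ h5 h6 h4 h4' h7))
    rw [← h8, connectedComponent_translate, hp₃, connectedComponent_rotate, hp₂,
      connectedComponent_rotate, hp₁, connectedComponent_rotate]
  have : connectedComponent o = Set.univ :=
    Set.eq_univ_of_forall fun p => key p ▸ mem_connectedComponent
  rw [← this]
  exact isConnected_connectedComponent

end FrameBundle

end

noncomputable section

/-! ### One-forms, and forms of the shape `f dg` -/

namespace DForm

variable {A : Type} [CommRing A] [Algebra ℝ A]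

theorem apply_one_add (α : DForm A 1) (X Y : VField A) : α ![X + Y] = α ![X] + α ![Y] := by
  have hc : ∀ X : VField A, Function.const (Fin 1) X = ![X] := fun X => by
    ext l; fin_cases l; rfl
  have h := α.map_update_add ![0] 0 X Y
  simpa only [Matrix.cons_val_fin_one, Function.update_eq_const_of_subsingleton, hc] using h

theorem apply_one_smul (α : DForm A 1) (c : A) (X : VField A) : α ![c • X] = c * α ![X] := by
  have hc : ∀ X : VField A, Function.const (Fin 1) X = ![X] := fun X => by
    ext l; fin_cases l; rfl
  have h := α.map_update_smul ![0] 0 c X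
  simpa only [Matrix.cons_val_fin_one, Function.update_eq_const_of_subsingleton, hc,
    smul_eq_mul] using h

theorem apply_one_neg (α : DForm A 1) (X : VField A) : α ![-X] = -α ![X] := by
  simpa using apply_one_smul α (-1) X

theorem apply_one_sub (α : DForm A 1) (X Y : VField A) : α ![X - Y] = α ![X] - α ![Y] := by
  rw [sub_eq_add_neg, apply_one_add, apply_one_neg, sub_eq_add_neg]

theorem apply_one_zero (α : DForm A 1) : α ![(0 : VField A)] = 0 := by
  simpa using apply_one_smul α 0 0

theorem lie_smul_left (c : A) (X Y : VField A) : ⁅c • X, Y⁆ = c • ⁅X, Y⁆ - Y c • X := by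
  ext a
  simp [Derivation.commutator_apply]
  ring

@[simp]
theorem d₀_apply (f : A) (X : VField A) : d₀ f ![X] = X f := rfl

theorem one_ext {α β : DForm A 1} (h : ∀ X, α ![X] = β ![X]) : α = β := by
  ext w
  have : w = ![w 0] := by ext i; fin_cases i; rfl
  rw [this]
  exact h _

theorem two_ext {α β : DForm A 2} (h : ∀ X Y, α ![X, Y] = β ![X, Y]) : α = β := by
  ext w
  have : w = ![w 0, w 1] := by ext i; fin_cases i <;> rfl
  rw [this]
  exact h _ _

theorem d₁_apply (α : DForm A 1) (X Y : VField A) :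
    d₁ α ![X, Y] = X (α ![Y]) - Y (α ![X]) - α ![⁅X, Y⁆] := rfl

theorem lieDeriv_one_apply (v : VField A) (α : DForm A 1) (X : VField A) :
    lieDeriv v α ![X] = v (α ![X]) - α ![⁅v, X⁆] := by
  change v (α ![X]) - ∑ i, α (Function.update ![X] i ⁅v, ![X] i⁆) = _
  rw [Fin.sum_univ_one]
  congr 2
  ext i
  fin_cases i
  rfl

theorem lieDeriv_two_apply (v : VField A) (α : DForm A 2) (X Y : VField A) :
    lieDeriv v α ![X, Y] = v (α ![X, Y]) - α ![⁅v, X⁆, Y] - α ![X, ⁅v, Y⁆] := by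
  change v (α ![X, Y]) - ∑ i, α (Function.update ![X, Y] i ⁅v, ![X, Y] i⁆) = _
  rw [Fin.sum_univ_two, sub_sub]
  congr 3
  · ext i
    fin_cases i <;> rfl
  · ext i
    fin_cases i <;> rfl

/-- The Lie derivative commutes with the exterior derivative. -/
theorem lieDeriv_d₁ (v : VField A) (α : DForm A 1) : lieDeriv v (d₁ α) = d₁ (lieDeriv v α) := by
  refine two_ext fun X Y => ?_
  have hJ : ⁅v, ⁅X, Y⁆⁆ = ⁅⁅v, X⁆, Y⁆ + ⁅X, ⁅v, Y⁆⁆ := leibniz_lie v X Y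
  have h1 : ∀ f, v (X f) = X (v f) + ⁅v, X⁆ f := fun f => by
    rw [Derivation.commutator_apply]; ring
  have h2 : ∀ f, v (Y f) = Y (v f) + ⁅v, Y⁆ f := fun f => by
    rw [Derivation.commutator_apply]; ring
  simp only [lieDeriv_two_apply, d₁_apply, lieDeriv_one_apply, hJ, apply_one_add, map_sub, h1, h2]
  ring

theorem lieDeriv_smul_d₀ (v : VField A) (f g : A) :
    lieDeriv v (f • d₀ g) = v f • d₀ g + f • d₀ (v g) := by
  refine one_ext fun X => ?_
  simp only [lieDeriv_one_apply, AlternatingMap.smul_apply, AlternatingMap.add_apply, d₀_apply,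
    smul_eq_mul, Derivation.leibniz, Derivation.commutator_apply]
  ring

theorem lieDeriv_add (v : VField A) {k : ℕ} (α β : DForm A k) :
    lieDeriv v (α + β) = lieDeriv v α + lieDeriv v β := by
  ext w
  simp [lieDeriv, Finset.sum_add_distrib]
  ring

theorem lieDeriv_zero (v : VField A) {k : ℕ} : lieDeriv v (0 : DForm A k) = 0 := by
  ext w
  simp [lieDeriv]

theorem lieDeriv_sum (v : VField A) {k : ℕ} {ι : Type} (s : Finset ι) (α : ι → DForm A k) :
    lieDeriv v (∑ i ∈ s, α i) = ∑ i ∈ s, lieDeriv v (α i) := by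
  classical
  induction s using Finset.induction_on with
  | empty => simp [lieDeriv_zero]
  | insert a s ha ih => rw [Finset.sum_insert ha, Finset.sum_insert ha, lieDeriv_add, ih]

theorem finset_sum_apply {k : ℕ} {ι : Type} (s : Finset ι) (α : ι → DForm A k)
    (w : Fin k → VField A) : (∑ i ∈ s, α i) w = ∑ i ∈ s, α i w := by
  classical
  induction s using Finset.induction_on with
  | empty => rfl
  | insert a s ha ih => rw [Finset.sum_insert ha, Finset.sum_insert ha, AlternatingMap.add_apply, ih]

theorem wedge_add_wedge_apply (α β γ δ : DForm A 1) (X Y : VField A) :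
    (wedge α β + wedge γ δ : DForm A 2) ![X, Y] = α ![X] * β ![Y] - α ![Y] * β ![X] +
      (γ ![X] * δ ![Y] - γ ![Y] * δ ![X]) := by
  rw [← wedge_one_one, ← wedge_one_one]
  rfl

end DForm

/-! ### The moving frame -/

namespace FrameBundle

open DForm

variable (U : TopologicalSpace.Opens FrameBundle)

/-- The rotation of the frame along which `e₁` moves towards `e₃`. -/
def tiltField₁ : VField (smoothFunctions U) := rotationField U (show (0 : Fin 3) ≠ 2 by decide)

/-- The rotation of the frame along which `e₂` moves towards `e₃`. -/
def tiltField₂ : VField (smoothFunctions U) := rotationField U (show (1 : Fin 3) ≠ 2 by decide)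

/-- The rotation of the frame in the plane of `e₁` and `e₂`. -/
def spinField : VField (smoothFunctions U) := rotationField U (show (0 : Fin 3) ≠ 1 by decide)

local notation "E" => translationField U
local notation "P₁" => tiltField₁ U
local notation "P₂" => tiltField₂ U
local notation "R" => spinField U

@[simp] theorem tiltField₁_xCoord (k : Fin 3) : P₁ (xCoord U k) = 0 := rotationField_xCoord _ k
@[simp] theorem tiltField₂_xCoord (k : Fin 3) : P₂ (xCoord U k) = 0 := rotationField_xCoord _ k
@[simp] theorem spinField_xCoord (k : Fin 3) : R (xCoord U k) = 0 := rotationField_xCoord _ k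

@[simp] theorem tiltField₁_eCoord_zero (k : Fin 3) : P₁ (eCoord U 0 k) = eCoord U 2 k := by
  simp [tiltField₁, rotationField_eCoord]
@[simp] theorem tiltField₁_eCoord_one (k : Fin 3) : P₁ (eCoord U 1 k) = 0 := by
  simp [tiltField₁, rotationField_eCoord]
@[simp] theorem tiltField₁_eCoord_two (k : Fin 3) : P₁ (eCoord U 2 k) = -eCoord U 0 k := by
  simp [tiltField₁, rotationField_eCoord]
@[simp] theorem tiltField₂_eCoord_zero (k : Fin 3) : P₂ (eCoord U 0 k) = 0 := by
  simp [tiltField₂, rotationField_eCoord]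
@[simp] theorem tiltField₂_eCoord_one (k : Fin 3) : P₂ (eCoord U 1 k) = eCoord U 2 k := by
  simp [tiltField₂, rotationField_eCoord]
@[simp] theorem tiltField₂_eCoord_two (k : Fin 3) : P₂ (eCoord U 2 k) = -eCoord U 1 k := by
  simp [tiltField₂, rotationField_eCoord]
@[simp] theorem spinField_eCoord_zero (k : Fin 3) : R (eCoord U 0 k) = eCoord U 1 k := by
  simp [spinField, rotationField_eCoord]
@[simp] theorem spinField_eCoord_one (k : Fin 3) : R (eCoord U 1 k) = -eCoord U 0 k := by
  simp [spinField, rotationField_eCoord]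
@[simp] theorem spinField_eCoord_two (k : Fin 3) : R (eCoord U 2 k) = 0 := by
  simp [spinField, rotationField_eCoord]

theorem vfield_ext_components {v w : VField (smoothFunctions U)}
    (hx : ∀ k, v (xCoord U k) = w (xCoord U k)) (h0 : ∀ k, v (eCoord U 0 k) = w (eCoord U 0 k))
    (h1 : ∀ k, v (eCoord U 1 k) = w (eCoord U 1 k))
    (h2 : ∀ k, v (eCoord U 2 k) = w (eCoord U 2 k)) : v = w :=
  vfield_ext hx fun i => by
    fin_cases i
    exacts [h0, h1, h2]

/-- These brackets are the structure constants of the Lie algebra of the Euclidean group. Frame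
fields send coordinate functions to coordinate functions up to sign, or to 0, so the brackets can be
compared on coordinates. -/
theorem lie_E_E (i j : Fin 3) : ⁅E i, E j⁆ = 0 := by
  apply vfield_ext_components <;> intro k <;> simp [Derivation.commutator_apply]
theorem lie_P₁_E_zero : ⁅P₁, E 0⁆ = E 2 := by
  apply vfield_ext_components <;> intro k <;> simp [Derivation.commutator_apply]
theorem lie_P₁_E_one : ⁅P₁, E 1⁆ = 0 := by
  apply vfield_ext_components <;> intro k <;> simp [Derivation.commutator_apply]
theorem lie_P₁_E_two : ⁅P₁, E 2⁆ = -E 0 := by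
  apply vfield_ext_components <;> intro k <;> simp [Derivation.commutator_apply]
theorem lie_P₂_E_zero : ⁅P₂, E 0⁆ = 0 := by
  apply vfield_ext_components <;> intro k <;> simp [Derivation.commutator_apply]
theorem lie_P₂_E_one : ⁅P₂, E 1⁆ = E 2 := by
  apply vfield_ext_components <;> intro k <;> simp [Derivation.commutator_apply]
theorem lie_P₂_E_two : ⁅P₂, E 2⁆ = -E 1 := by
  apply vfield_ext_components <;> intro k <;> simp [Derivation.commutator_apply]
theorem lie_R_E_zero : ⁅R, E 0⁆ = E 1 := by
  apply vfield_ext_components <;> intro k <;> simp [Derivation.commutator_apply]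
theorem lie_R_E_one : ⁅R, E 1⁆ = -E 0 := by
  apply vfield_ext_components <;> intro k <;> simp [Derivation.commutator_apply]
theorem lie_R_E_two : ⁅R, E 2⁆ = 0 := by
  apply vfield_ext_components <;> intro k <;> simp [Derivation.commutator_apply]
theorem lie_R_P₁ : ⁅R, P₁⁆ = P₂ := by
  apply vfield_ext_components <;> intro k <;> simp [Derivation.commutator_apply]
theorem lie_R_P₂ : ⁅R, P₂⁆ = -P₁ := by
  apply vfield_ext_components <;> intro k <;> simp [Derivation.commutator_apply]
theorem lie_P₁_P₂ : ⁅P₁, P₂⁆ = R := by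
  apply vfield_ext_components <;> intro k <;> simp [Derivation.commutator_apply]

/-! ### Components of vector fields -/

theorem eta_apply (i : Fin 3) (X : VField (smoothFunctions U)) :
    eta U i ![X] = ∑ k, eCoord U i k * X (xCoord U k) := by
  rw [eta, finset_sum_apply]
  rfl

theorem etaConn_apply (j i : Fin 3) (X : VField (smoothFunctions U)) :
    etaConn U j i ![X] = ∑ k, eCoord U j k * X (eCoord U i k) := by
  rw [etaConn, finset_sum_apply]
  rfl

theorem etaConn_add_etaConn (i j : Fin 3) (X : VField (smoothFunctions U)) :
    etaConn U i j ![X] + etaConn U j i ![X] = 0 := by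
  have h := congrArg X (sum_eCoord_mul_eCoord (U := U) i j)
  have h0 : X (if i = j then 1 else 0) = 0 := by split_ifs <;> simp
  rw [h0, map_sum] at h
  rw [etaConn_apply, etaConn_apply, ← Finset.sum_add_distrib, ← h]
  refine Finset.sum_congr rfl fun k _ => ?_
  simp

theorem apply_xCoord (X : VField (smoothFunctions U)) (l : Fin 3) :
    X (xCoord U l) = ∑ i, eta U i ![X] * eCoord U i l := by
  simp only [eta_apply, Finset.sum_mul]
  rw [Finset.sum_comm]
  have h : ∀ k, ∑ i, eCoord U i k * X (xCoord U k) * eCoord U i l =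
      X (xCoord U k) * if k = l then 1 else 0 := fun k => by
    rw [← sum_eCoord_mul_eCoord', Finset.mul_sum]
    exact Finset.sum_congr rfl fun i _ => by ring
  simp [h]

theorem apply_eCoord (X : VField (smoothFunctions U)) (j l : Fin 3) :
    X (eCoord U j l) = ∑ i, etaConn U i j ![X] * eCoord U i l := by
  simp only [etaConn_apply, Finset.sum_mul]
  rw [Finset.sum_comm]
  have h : ∀ k, ∑ i, eCoord U i k * X (eCoord U j k) * eCoord U i l =
      X (eCoord U j k) * if k = l then 1 else 0 := fun k => by
    rw [← sum_eCoord_mul_eCoord', Finset.mul_sum]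
    exact Finset.sum_congr rfl fun i _ => by ring
  simp [h]

theorem etaConn_self (i : Fin 3) (X : VField (smoothFunctions U)) : etaConn U i i ![X] = 0 := by
  have h := etaConn_add_etaConn U i i X
  refine natCast_mul_cancel (n := 2) two_ne_zero ?_
  linear_combination h

/-- The expansion of a vector field in the moving frame. -/
theorem eq_sum_components (X : VField (smoothFunctions U)) :
    X = eta U 0 ![X] • E 0 + eta U 1 ![X] • E 1 + eta U 2 ![X] • E 2 + etaConn U 2 0 ![X] • P₁ +
      etaConn U 2 1 ![X] • P₂ + etaConn U 1 0 ![X] • R := by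
  have h01 := etaConn_add_etaConn U 0 1 X
  have h02 := etaConn_add_etaConn U 0 2 X
  have h12 := etaConn_add_etaConn U 1 2 X
  have hx := apply_xCoord U X
  have he := apply_eCoord U X
  have hs := fun i => etaConn_self U i X
  simp only [Fin.sum_univ_three] at hx he
  apply vfield_ext_components <;> intro k <;> simp only [hx, he, Derivation.add_apply,
    Derivation.smul_apply, smul_eq_mul, translationField_xCoord, translationField_eCoord,
    tiltField₁_xCoord, tiltField₂_xCoord, spinField_xCoord, hs]
  · ring
  · simp only [tiltField₁_eCoord_zero, tiltField₂_eCoord_zero, spinField_eCoord_zero]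
    ring
  · simp only [tiltField₁_eCoord_one, tiltField₂_eCoord_one, spinField_eCoord_one]
    linear_combination eCoord U 0 k * h01
  · simp only [tiltField₁_eCoord_two, tiltField₂_eCoord_two, spinField_eCoord_two]
    linear_combination eCoord U 0 k * h02 + eCoord U 1 k * h12

theorem eta_E (i j : Fin 3) : eta U i ![E j] = if i = j then 1 else 0 := by
  rw [eta_apply, ← sum_eCoord_mul_eCoord]
  simp

theorem eta_P₁ (i : Fin 3) : eta U i ![P₁] = 0 := by simp [eta_apply]
theorem eta_P₂ (i : Fin 3) : eta U i ![P₂] = 0 := by simp [eta_apply]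
theorem eta_R (i : Fin 3) : eta U i ![R] = 0 := by simp [eta_apply]
theorem etaConn_E (i j k : Fin 3) : etaConn U i j ![E k] = 0 := by simp [etaConn_apply]
theorem etaConn_zero_P₁ : etaConn U 2 0 ![P₁] = 1 := by
  simpa [etaConn_apply] using sum_eCoord_mul_eCoord (U := U) 2 2
theorem etaConn_one_P₁ : etaConn U 2 1 ![P₁] = 0 := by simp [etaConn_apply]
theorem etaConn_zero_P₂ : etaConn U 2 0 ![P₂] = 0 := by simp [etaConn_apply]
theorem etaConn_one_P₂ : etaConn U 2 1 ![P₂] = 1 := by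
  simpa [etaConn_apply] using sum_eCoord_mul_eCoord (U := U) 2 2
theorem etaConn_zero_R : etaConn U 2 0 ![R] = 0 := by
  simpa [etaConn_apply] using sum_eCoord_mul_eCoord (U := U) 2 1
theorem etaConn_one_R : etaConn U 2 1 ![R] = 0 := by
  have h := sum_eCoord_mul_eCoord (U := U) 2 0
  simp only [etaConn_apply, spinField_eCoord_one, Fin.sum_univ_three] at h ⊢
  rw [if_neg (by decide)] at h
  linear_combination -h

theorem psi_apply (X Y : VField (smoothFunctions U)) :
    psi U ![X, Y] = etaConn U 2 0 ![X] * etaConn U 2 1 ![Y] - etaConn U 2 0 ![Y] * etaConn U 2 1 ![X] +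
      (eta U 0 ![X] * eta U 1 ![Y] - eta U 0 ![Y] * eta U 1 ![X]) :=
  wedge_add_wedge_apply _ _ _ _ X Y

end FrameBundle

end

noncomputable section

/-! ### Prolongation of the symmetry equations -/

section Prolongation

variable {A : Type} [CommRing A] [Algebra ℝ A]

theorem eq_zero_of_two_mul {a : A} (h : 2 * a = 0) : a = 0 :=
  DForm.natCast_mul_cancel (n := 2) two_ne_zero (by rw [mul_zero]; exact_mod_cast h)

theorem eq_zero_of_four_mul {a : A} (h : 4 * a = 0) : a = 0 :=
  DForm.natCast_mul_cancel (n := 4) four_ne_zero (by rw [mul_zero]; exact_mod_cast h)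

theorem Derivation.apply_apply_eq (D D' : VField A) (f : A) : D (D' f) = D' (D f) + ⁅D, D'⁆ f := by
  rw [Derivation.commutator_apply]
  ring

/-- The commutation relations of the moving frame of Euclidean space. -/
structure EuclideanBrackets (E₁ E₂ E₃ P₁ P₂ R : VField A) : Prop where
  E₁_E₂ : ⁅E₁, E₂⁆ = 0
  E₁_E₃ : ⁅E₁, E₃⁆ = 0
  E₂_E₃ : ⁅E₂, E₃⁆ = 0
  P₁_E₁ : ⁅P₁, E₁⁆ = E₃
  P₁_E₂ : ⁅P₁, E₂⁆ = 0
  P₁_E₃ : ⁅P₁, E₃⁆ = -E₁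
  P₂_E₁ : ⁅P₂, E₁⁆ = 0
  P₂_E₂ : ⁅P₂, E₂⁆ = E₃
  P₂_E₃ : ⁅P₂, E₃⁆ = -E₂
  R_E₁ : ⁅R, E₁⁆ = E₂
  R_E₂ : ⁅R, E₂⁆ = -E₁
  R_E₃ : ⁅R, E₃⁆ = 0
  R_P₁ : ⁅R, P₁⁆ = P₂
  R_P₂ : ⁅R, P₂⁆ = -P₁
  P₁_P₂ : ⁅P₁, P₂⁆ = R

/-- The commutation relations of the characteristic vector fields `X₁ = E₁ + P₂`, `X₂ = E₂ - P₁`,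
`Y₁ = E₁ - P₂`, `Y₂ = E₂ + P₁`, in terms of their action on functions. -/
structure CharacteristicBrackets (E₃ R X₁ X₂ Y₁ Y₂ : VField A) : Prop where
  X₁_X₂ (f : A) : X₁ (X₂ f) = X₂ (X₁ f) + 2 * E₃ f + R f
  Y₁_Y₂ (f : A) : Y₁ (Y₂ f) = Y₂ (Y₁ f) - 2 * E₃ f + R f
  X₁_Y₁ (f : A) : X₁ (Y₁ f) = Y₁ (X₁ f)
  X₂_Y₂ (f : A) : X₂ (Y₂ f) = Y₂ (X₂ f)
  X₁_Y₂ (f : A) : X₁ (Y₂ f) = Y₂ (X₁ f) - R f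
  X₂_Y₁ (f : A) : X₂ (Y₁ f) = Y₁ (X₂ f) + R f
  R_X₁ (f : A) : R (X₁ f) = X₁ (R f) + X₂ f
  R_X₂ (f : A) : R (X₂ f) = X₂ (R f) - X₁ f
  R_Y₁ (f : A) : R (Y₁ f) = Y₁ (R f) + Y₂ f
  R_Y₂ (f : A) : R (Y₂ f) = Y₂ (R f) - Y₁ f
  E₃_X₁ (f : A) : 2 * E₃ (X₁ f) = 2 * X₁ (E₃ f) + (X₂ f + Y₂ f)
  E₃_X₂ (f : A) : 2 * E₃ (X₂ f) = 2 * X₂ (E₃ f) - (X₁ f + Y₁ f)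
  E₃_Y₁ (f : A) : 2 * E₃ (Y₁ f) = 2 * Y₁ (E₃ f) - (X₂ f + Y₂ f)
  E₃_Y₂ (f : A) : 2 * E₃ (Y₂ f) = 2 * Y₂ (E₃ f) + (X₁ f + Y₁ f)

variable {E₁ E₂ E₃ P₁ P₂ R X₁ X₂ Y₁ Y₂ : VField A}

namespace EuclideanBrackets

theorem E₁_E₂_apply (h : EuclideanBrackets E₁ E₂ E₃ P₁ P₂ R) (f : A) : E₁ (E₂ f) = E₂ (E₁ f) := by
  rw [E₁.apply_apply_eq, h.E₁_E₂, Derivation.zero_apply, add_zero]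
theorem E₁_E₃_apply (h : EuclideanBrackets E₁ E₂ E₃ P₁ P₂ R) (f : A) : E₁ (E₃ f) = E₃ (E₁ f) := by
  rw [E₁.apply_apply_eq, h.E₁_E₃, Derivation.zero_apply, add_zero]
theorem E₂_E₃_apply (h : EuclideanBrackets E₁ E₂ E₃ P₁ P₂ R) (f : A) : E₂ (E₃ f) = E₃ (E₂ f) := by
  rw [E₂.apply_apply_eq, h.E₂_E₃, Derivation.zero_apply, add_zero]
theorem P₁_E₁_apply (h : EuclideanBrackets E₁ E₂ E₃ P₁ P₂ R) (f : A) :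
    P₁ (E₁ f) = E₁ (P₁ f) + E₃ f := by rw [P₁.apply_apply_eq, h.P₁_E₁]
theorem P₁_E₂_apply (h : EuclideanBrackets E₁ E₂ E₃ P₁ P₂ R) (f : A) : P₁ (E₂ f) = E₂ (P₁ f) := by
  rw [P₁.apply_apply_eq, h.P₁_E₂, Derivation.zero_apply, add_zero]
theorem P₁_E₃_apply (h : EuclideanBrackets E₁ E₂ E₃ P₁ P₂ R) (f : A) :
    P₁ (E₃ f) = E₃ (P₁ f) - E₁ f := by
  rw [P₁.apply_apply_eq, h.P₁_E₃, Derivation.neg_apply, sub_eq_add_neg]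
theorem P₂_E₁_apply (h : EuclideanBrackets E₁ E₂ E₃ P₁ P₂ R) (f : A) : P₂ (E₁ f) = E₁ (P₂ f) := by
  rw [P₂.apply_apply_eq, h.P₂_E₁, Derivation.zero_apply, add_zero]
theorem P₂_E₂_apply (h : EuclideanBrackets E₁ E₂ E₃ P₁ P₂ R) (f : A) :
    P₂ (E₂ f) = E₂ (P₂ f) + E₃ f := by rw [P₂.apply_apply_eq, h.P₂_E₂]
theorem P₂_E₃_apply (h : EuclideanBrackets E₁ E₂ E₃ P₁ P₂ R) (f : A) :
    P₂ (E₃ f) = E₃ (P₂ f) - E₂ f := by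
  rw [P₂.apply_apply_eq, h.P₂_E₃, Derivation.neg_apply, sub_eq_add_neg]
theorem R_E₁_apply (h : EuclideanBrackets E₁ E₂ E₃ P₁ P₂ R) (f : A) :
    R (E₁ f) = E₁ (R f) + E₂ f := by rw [R.apply_apply_eq, h.R_E₁]
theorem R_E₂_apply (h : EuclideanBrackets E₁ E₂ E₃ P₁ P₂ R) (f : A) :
    R (E₂ f) = E₂ (R f) - E₁ f := by
  rw [R.apply_apply_eq, h.R_E₂, Derivation.neg_apply, sub_eq_add_neg]
theorem R_E₃_apply (h : EuclideanBrackets E₁ E₂ E₃ P₁ P₂ R) (f : A) : R (E₃ f) = E₃ (R f) := by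
  rw [R.apply_apply_eq, h.R_E₃, Derivation.zero_apply, add_zero]
theorem R_P₁_apply (h : EuclideanBrackets E₁ E₂ E₃ P₁ P₂ R) (f : A) :
    R (P₁ f) = P₁ (R f) + P₂ f := by rw [R.apply_apply_eq, h.R_P₁]
theorem R_P₂_apply (h : EuclideanBrackets E₁ E₂ E₃ P₁ P₂ R) (f : A) :
    R (P₂ f) = P₂ (R f) - P₁ f := by
  rw [R.apply_apply_eq, h.R_P₂, Derivation.neg_apply, sub_eq_add_neg]
theorem P₁_P₂_apply (h : EuclideanBrackets E₁ E₂ E₃ P₁ P₂ R) (f : A) :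
    P₁ (P₂ f) = P₂ (P₁ f) + R f := by rw [P₁.apply_apply_eq, h.P₁_P₂]

/-- The X's commute with the Y's modulo R, which kills g, while [X₁, X₂] = 2E₃ + R and [Y₁, Y₂] =
-2E₃ + R. The relations with E₃ are doubled because 2E₁ = X₁ + Y₁ and 2E₂ = X₂ + Y₂. -/
theorem characteristic (h : EuclideanBrackets E₁ E₂ E₃ P₁ P₂ R) :
    CharacteristicBrackets E₃ R (E₁ + P₂) (E₂ - P₁) (E₁ - P₂) (E₂ + P₁) := by
  constructor <;> intro f <;> simp only [Derivation.add_apply, Derivation.sub_apply, map_add,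
    map_sub, h.E₁_E₂_apply, h.E₁_E₃_apply, h.E₂_E₃_apply, h.P₁_E₁_apply, h.P₁_E₂_apply,
    h.P₁_E₃_apply, h.P₂_E₁_apply, h.P₂_E₂_apply, h.P₂_E₃_apply, h.R_E₁_apply, h.R_E₂_apply,
    h.R_P₁_apply, h.R_P₂_apply, h.P₁_P₂_apply] <;> ring

end EuclideanBrackets

/-! ### Brackets of a general vector field with the frame -/

/-- The vector field with the given components in a frame. -/
def frameComb (E₁ E₂ E₃ P₁ P₂ R : VField A) (a₁ a₂ g p₁ p₂ r : A) : VField A :=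
  a₁ • E₁ + a₂ • E₂ + g • E₃ + p₁ • P₁ + p₂ • P₂ + r • R

namespace EuclideanBrackets

variable (a₁ a₂ g p₁ p₂ r : A)

theorem lie_frameComb_E₁ (h : EuclideanBrackets E₁ E₂ E₃ P₁ P₂ R) :
    ⁅frameComb E₁ E₂ E₃ P₁ P₂ R a₁ a₂ g p₁ p₂ r, E₁⁆ = frameComb E₁ E₂ E₃ P₁ P₂ R
      (-E₁ a₁) (r - E₁ a₂) (p₁ - E₁ g) (-E₁ p₁) (-E₁ p₂) (-E₁ r) := by
  ext f
  simp only [frameComb, Derivation.commutator_apply, Derivation.add_apply, Derivation.smul_apply,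
    smul_eq_mul, map_add, Derivation.leibniz, h.E₁_E₂_apply, h.E₁_E₃_apply, h.P₁_E₁_apply,
    h.P₂_E₁_apply, h.R_E₁_apply]
  ring

theorem lie_frameComb_E₂ (h : EuclideanBrackets E₁ E₂ E₃ P₁ P₂ R) :
    ⁅frameComb E₁ E₂ E₃ P₁ P₂ R a₁ a₂ g p₁ p₂ r, E₂⁆ = frameComb E₁ E₂ E₃ P₁ P₂ R
      (-r - E₂ a₁) (-E₂ a₂) (p₂ - E₂ g) (-E₂ p₁) (-E₂ p₂) (-E₂ r) := by
  ext f
  simp only [frameComb, Derivation.commutator_apply, Derivation.add_apply, Derivation.smul_apply,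
    smul_eq_mul, map_add, Derivation.leibniz, h.E₁_E₂_apply, h.E₂_E₃_apply, h.P₁_E₂_apply,
    h.P₂_E₂_apply, h.R_E₂_apply]
  ring

theorem lie_frameComb_P₁ (h : EuclideanBrackets E₁ E₂ E₃ P₁ P₂ R) :
    ⁅frameComb E₁ E₂ E₃ P₁ P₂ R a₁ a₂ g p₁ p₂ r, P₁⁆ = frameComb E₁ E₂ E₃ P₁ P₂ R
      (g - P₁ a₁) (-P₁ a₂) (-a₁ - P₁ g) (-P₁ p₁) (r - P₁ p₂) (-p₂ - P₁ r) := by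
  ext f
  simp only [frameComb, Derivation.commutator_apply, Derivation.add_apply, Derivation.smul_apply,
    smul_eq_mul, map_add, Derivation.leibniz, h.P₁_E₁_apply, h.P₁_E₂_apply, h.P₁_E₃_apply,
    h.P₁_P₂_apply, h.R_P₁_apply]
  ring

theorem lie_frameComb_P₂ (h : EuclideanBrackets E₁ E₂ E₃ P₁ P₂ R) :
    ⁅frameComb E₁ E₂ E₃ P₁ P₂ R a₁ a₂ g p₁ p₂ r, P₂⁆ = frameComb E₁ E₂ E₃ P₁ P₂ R
      (-P₂ a₁) (g - P₂ a₂) (-a₂ - P₂ g) (-r - P₂ p₁) (-P₂ p₂) (p₁ - P₂ r) := by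
  ext f
  simp only [frameComb, Derivation.commutator_apply, Derivation.add_apply, Derivation.smul_apply,
    smul_eq_mul, map_add, Derivation.leibniz, h.P₂_E₁_apply, h.P₂_E₂_apply, h.P₂_E₃_apply,
    h.P₁_P₂_apply, h.R_P₂_apply]
  ring

theorem lie_frameComb_R (h : EuclideanBrackets E₁ E₂ E₃ P₁ P₂ R) :
    ⁅frameComb E₁ E₂ E₃ P₁ P₂ R a₁ a₂ g p₁ p₂ r, R⁆ = frameComb E₁ E₂ E₃ P₁ P₂ R
      (a₂ - R a₁) (-a₁ - R a₂) (-R g) (p₂ - R p₁) (-p₁ - R p₂) (-R r) := by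
  ext f
  simp only [frameComb, Derivation.commutator_apply, Derivation.add_apply, Derivation.smul_apply,
    smul_eq_mul, map_add, Derivation.leibniz, h.R_E₁_apply, h.R_E₂_apply, h.R_E₃_apply,
    h.R_P₁_apply, h.R_P₂_apply]
  ring

end EuclideanBrackets

/-! ### Determining equations and their prolongation -/

/-- The determining equations of a contact symmetry with generating function `g`. -/
structure DeterminingEquations (R X₁ X₂ Y₁ Y₂ : VField A) (g : A) : Prop where
  R_eq : R g = 0
  X₁_Y₁ : X₁ (Y₁ g) = g
  X₂_Y₂ : X₂ (Y₂ g) = g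
  X₁_Y₂ : X₁ (Y₂ g) = 0
  X₂_Y₁ : X₂ (Y₁ g) = 0

/-- All solutions of the determining equations satisfy a closed system of second order. -/
structure ClosedEquations (E₃ X₁ X₂ Y₁ Y₂ : VField A) (g : A) : Prop where
  E₃_eq : E₃ g = 0
  X₁_X₂ : X₁ (X₂ g) = 0
  X₂_X₁ : X₂ (X₁ g) = 0
  Y₁_Y₂ : Y₁ (Y₂ g) = 0
  Y₂_Y₁ : Y₂ (Y₁ g) = 0
  X₁_Y₁ : X₁ (Y₁ g) = g
  X₂_Y₂ : X₂ (Y₂ g) = g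
  X₁_Y₂ : X₁ (Y₂ g) = 0
  X₂_Y₁ : X₂ (Y₁ g) = 0
  Y₁_X₁ : Y₁ (X₁ g) = g
  Y₂_X₂ : Y₂ (X₂ g) = g
  Y₂_X₁ : Y₂ (X₁ g) = 0
  Y₁_X₂ : Y₁ (X₂ g) = 0
  X₂_X₂ : X₂ (X₂ g) = X₁ (X₁ g)
  Y₁_Y₁ : Y₁ (Y₁ g) = -2 * g - X₁ (X₁ g)
  Y₂_Y₂ : Y₂ (Y₂ g) = -2 * g - X₁ (X₁ g)

/-- Since the mixed second derivatives XᵢYⱼ g are known, so are the third derivatives Yᵢ(X₁X₂ g),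
Yᵢ(X₂X₁ g), Xᵢ(Y₁Y₂ g), Xᵢ(Y₂Y₁ g): they all vanish. As E₃ g is half of [X₁, X₂]g and also half of
-[Y₁, Y₂]g, it is killed by all four characteristic fields. Differentiating the determining
equations along E₃ then gives E₃ g = 0 and relates the XX-derivatives to the YY-derivatives. The
action of R, which rotates (X₁g, X₂g) and (Y₁g, Y₂g), settles the rest; only X₁X₁ g stays
undetermined. -/
theorem DeterminingEquations.closed {g : A} (h : DeterminingEquations R X₁ X₂ Y₁ Y₂ g)
    (c : CharacteristicBrackets E₃ R X₁ X₂ Y₁ Y₂) : ClosedEquations E₃ X₁ X₂ Y₁ Y₂ g := by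
  have hR := h.R_eq
  have h11 := h.X₁_Y₁
  have h22 := h.X₂_Y₂
  have h12 := h.X₁_Y₂
  have h21 := h.X₂_Y₁
  have k11 : Y₁ (X₁ g) = g := by rw [← c.X₁_Y₁, h11]
  have k22 : Y₂ (X₂ g) = g := by rw [← c.X₂_Y₂, h22]
  have k12 : Y₂ (X₁ g) = 0 := by linear_combination h12 - c.X₁_Y₂ g + hR
  have k21 : Y₁ (X₂ g) = 0 := by linear_combination h21 - c.X₂_Y₁ g - hR
  have rX₁ : R (X₁ g) = X₂ g := by rw [c.R_X₁, hR, map_zero, zero_add]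
  have rX₂ : R (X₂ g) = -X₁ g := by rw [c.R_X₂, hR, map_zero, zero_sub]
  have rY₁ : R (Y₁ g) = Y₂ g := by rw [c.R_Y₁, hR, map_zero, zero_add]
  have rY₂ : R (Y₂ g) = -Y₁ g := by rw [c.R_Y₂, hR, map_zero, zero_sub]
  have hX := c.X₁_X₂ g
  have hY := c.Y₁_Y₂ g
  rw [hR] at hX hY
  -- third derivatives
  have t1 : Y₁ (X₁ (X₂ g)) = 0 := by rw [← c.X₁_Y₁, k21, map_zero]
  have t2 : Y₁ (X₂ (X₁ g)) = 0 := by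
    have := c.X₂_Y₁ (X₁ g)
    rw [k11, rX₁] at this
    linear_combination -this
  have t3 : Y₂ (X₁ (X₂ g)) = 0 := by
    have := c.X₁_Y₂ (X₂ g)
    rw [k22, rX₂] at this
    linear_combination -this
  have t4 : Y₂ (X₂ (X₁ g)) = 0 := by rw [← c.X₂_Y₂, k12, map_zero]
  have t5 : X₁ (Y₁ (Y₂ g)) = 0 := by rw [c.X₁_Y₁, h12, map_zero]
  have t6 : X₁ (Y₂ (Y₁ g)) = 0 := by
    have := c.X₁_Y₂ (Y₁ g)
    rw [h11, rY₁] at this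
    linear_combination this
  have t7 : X₂ (Y₁ (Y₂ g)) = 0 := by
    have := c.X₂_Y₁ (Y₂ g)
    rw [h22, rY₂] at this
    linear_combination this
  have t8 : X₂ (Y₂ (Y₁ g)) = 0 := by rw [c.X₂_Y₂, h21, map_zero]
  have two : ∀ (D : VField A) (f : A), D (2 * f) = 2 * D f := fun D f => by
    rw [two_mul, map_add, two_mul]
  have key : ∀ (D : VField A), D (X₁ (X₂ g)) = 0 → D (X₂ (X₁ g)) = 0 → D (E₃ g) = 0 := by
    intro D h h'
    have := congrArg D hX
    rw [map_add, map_add, two, h, h', map_zero] at this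
    exact eq_zero_of_two_mul (by linear_combination -this)
  have key' : ∀ (D : VField A), D (Y₁ (Y₂ g)) = 0 → D (Y₂ (Y₁ g)) = 0 → D (E₃ g) = 0 := by
    intro D h h'
    have := congrArg D hY
    rw [map_add, map_sub, two, h, h', map_zero] at this
    exact eq_zero_of_two_mul (by linear_combination this)
  have eY₁ := key Y₁ t1 t2
  have eY₂ := key Y₂ t3 t4
  have eX₁ := key' X₁ t5 t6
  have eX₂ := key' X₂ t7 t8
  have fX₁ := c.E₃_X₁ g
  have fX₂ := c.E₃_X₂ g
  have fY₁ := c.E₃_Y₁ g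
  have fY₂ := c.E₃_Y₂ g
  rw [eX₁] at fX₁
  rw [eX₂] at fX₂
  rw [eY₁] at fY₁
  rw [eY₂] at fY₂
  -- differentiate the determining equations along `E₃`
  have q11 := c.E₃_X₁ (Y₁ g)
  have q22 := c.E₃_X₂ (Y₂ g)
  have q12 := c.E₃_X₁ (Y₂ g)
  have q21 := c.E₃_X₂ (Y₁ g)
  rw [← two X₁, fY₁] at q11
  rw [← two X₂, fY₁] at q21
  rw [← two X₂, fY₂] at q22
  rw [← two X₁, fY₂] at q12
  simp only [mul_zero, zero_add, zero_sub, map_neg, map_add, h11, h12, h21, h22, map_zero] at q11 q12 q21 q22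
  -- `q11` and `q22` add up to 4E₃ g = -[X₁, X₂]g - [Y₁, Y₂]g, in which the contributions 2E₃ g and
  -- -2E₃ g cancel.
  have hE : E₃ g = 0 := by
    refine eq_zero_of_four_mul ?_
    linear_combination q11 + q22 - hX - hY
  rw [hE] at hX hY
  have hXX : X₁ (X₂ g) = X₂ (X₁ g) := by linear_combination hX
  have hYY : Y₁ (Y₂ g) = Y₂ (Y₁ g) := by linear_combination hY
  have hXY : X₁ (X₂ g) = Y₂ (Y₁ g) := by
    rw [hE] at q11
    linear_combination q11
  have sX₁ : X₁ (X₁ (X₂ g)) = 0 := by rw [hXY, t6]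
  have sX₂ : X₂ (X₁ (X₂ g)) = 0 := by rw [hXY, t8]
  -- The function s = X₁X₂ g = Y₂Y₁ g is killed by all X's and Y's, hence by [X₁, X₂] + [Y₁, Y₂] =
  -- 2R.
  have r0 : R (X₁ (X₂ g)) = 0 := by
    have u1 := c.X₁_X₂ (X₁ (X₂ g))
    have u2 := c.Y₁_Y₂ (X₁ (X₂ g))
    rw [sX₁, sX₂, map_zero, map_zero] at u1
    rw [t1, t3, map_zero, map_zero] at u2
    exact eq_zero_of_two_mul (by linear_combination -u1 - u2)
  have hd : X₂ (X₂ g) = X₁ (X₁ g) := by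
    rw [c.R_X₁, rX₂, map_neg] at r0
    linear_combination r0
  -- Applying R to X₂X₂ g = X₁X₁ g turns the left side into -2s and the right side into 2s.
  have hs : X₁ (X₂ g) = 0 := by
    have u := congrArg R hd
    rw [c.R_X₁, c.R_X₂, rX₁, rX₂, map_neg] at u
    refine eq_zero_of_four_mul ?_
    linear_combination 2 * hXX - u
  exact
    { E₃_eq := hE
      X₁_X₂ := hs
      X₂_X₁ := hXX ▸ hs
      Y₁_Y₂ := by rw [hYY, ← hXY, hs]
      Y₂_Y₁ := by rw [← hXY, hs]
      X₁_Y₁ := h11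
      X₂_Y₂ := h22
      X₁_Y₂ := h12
      X₂_Y₁ := h21
      Y₁_X₁ := k11
      Y₂_X₂ := k22
      Y₂_X₁ := k12
      Y₁_X₂ := k21
      X₂_X₂ := hd
      Y₁_Y₁ := by linear_combination q21 - hd
      Y₂_Y₂ := by linear_combination -q12 }

/-- The second derivatives of the generating functions of infinitesimal Euclidean motions. -/
structure EuclideanEquations (E₁ E₂ E₃ P₁ P₂ R : VField A) (g : A) : Prop where
  E₃_eq : E₃ g = 0
  E₁_E₁ : E₁ (E₁ g) = 0
  E₁_E₂ : E₁ (E₂ g) = 0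
  E₂_E₁ : E₂ (E₁ g) = 0
  E₂_E₂ : E₂ (E₂ g) = 0
  P₁_P₁ : P₁ (P₁ g) = -g
  P₁_P₂ : P₁ (P₂ g) = 0
  P₂_P₁ : P₂ (P₁ g) = 0
  P₂_P₂ : P₂ (P₂ g) = -g
  E₁_P₁ : E₁ (P₁ g) = 0
  E₂_P₂ : E₂ (P₂ g) = 0
  E₁_P₂ : E₁ (P₂ g) = -E₂ (P₁ g)

/-- From 2E₁ = X₁ + Y₁, 2E₂ = X₂ + Y₂, 2P₁ = Y₂ - X₂ and 2P₂ = X₁ - Y₁, four times a second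
derivative along these fields is a signed sum of four characteristic ones. The undetermined X₁X₁ g
survives only in E₁P₂ g = -E₂P₁ g. -/
theorem DeterminingEquations.euclidean {g : A} (h : EuclideanBrackets E₁ E₂ E₃ P₁ P₂ R)
    (hg : DeterminingEquations R (E₁ + P₂) (E₂ - P₁) (E₁ - P₂) (E₂ + P₁) g) :
    EuclideanEquations E₁ E₂ E₃ P₁ P₂ R g := by
  have c := hg.closed h.characteristic
  have hE := c.E₃_eq
  have c1 := c.X₁_X₂
  have c2 := c.X₂_X₁
  have c3 := c.Y₁_Y₂
  have c4 := c.Y₂_Y₁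
  have c5 := c.X₁_Y₁
  have c6 := c.X₂_Y₂
  have c7 := c.X₁_Y₂
  have c8 := c.X₂_Y₁
  have c9 := c.Y₁_X₁
  have c10 := c.Y₂_X₂
  have c11 := c.Y₂_X₁
  have c12 := c.Y₁_X₂
  have c13 := c.X₂_X₂
  have c14 := c.Y₁_Y₁
  have c15 := c.Y₂_Y₂
  simp only [Derivation.add_apply, Derivation.sub_apply, map_add, map_sub]
    at c1 c2 c3 c4 c5 c6 c7 c8 c9 c10 c11 c12 c13 c14 c15
  refine ⟨hE, ?_, ?_, ?_, ?_, ?_, ?_, ?_, ?_, ?_, ?_, ?_⟩ <;> rw [← sub_eq_zero] <;>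
    apply eq_zero_of_four_mul
  · linear_combination c5 + c9 + c14
  · linear_combination c1 + c7 + c12 + c3
  · linear_combination c2 + c8 + c11 + c4
  · linear_combination c6 + c10 + c15 + c13
  · linear_combination c15 - c6 - c10 + c13
  · linear_combination c11 - c4 - c2 + c8
  · linear_combination c7 - c1 - c3 + c12
  · linear_combination c14 - c5 - c9
  · linear_combination c7 - c1 + c3 - c12
  · linear_combination c2 - c8 + c11 - c4
  · linear_combination c9 - c5 - c14 + c6 - c13 + c15 - c10

/-! ### The generated field commutes with the frame -/

/-- The vector field with generating function `g`, with a suitable angular velocity in the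
plane of `e₁` and `e₂`. -/
def generatedField (E₁ E₂ E₃ P₁ P₂ R : VField A) (g : A) : VField A :=
  frameComb E₁ E₂ E₃ P₁ P₂ R (-P₁ g) (-P₂ g) g (E₁ g) (E₂ g) (E₂ (P₁ g))

theorem frameComb_eq_zero {a₁ a₂ g p₁ p₂ r : A} (h1 : a₁ = 0) (h2 : a₂ = 0) (h3 : g = 0)
    (h4 : p₁ = 0) (h5 : p₂ = 0) (h6 : r = 0) :
    frameComb E₁ E₂ E₃ P₁ P₂ R a₁ a₂ g p₁ p₂ r = 0 := by
  simp [frameComb, h1, h2, h3, h4, h5, h6]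

namespace EuclideanEquations

variable {g : A}

/-- The components of the bracket are second derivatives of g in combinations that vanish, together
with one third derivative that vanishes after commuting. The E₂-component is r + E₁P₂ g = r - E₂P₁
g, which dictates the spin coefficient r = E₂P₁ g. -/
theorem lie_E₁ (c : EuclideanEquations E₁ E₂ E₃ P₁ P₂ R g)
    (h : EuclideanBrackets E₁ E₂ E₃ P₁ P₂ R) : ⁅generatedField E₁ E₂ E₃ P₁ P₂ R g, E₁⁆ = 0 := by
  rw [generatedField, h.lie_frameComb_E₁]
  apply frameComb_eq_zero
  · rw [map_neg, c.E₁_P₁, neg_zero, neg_zero]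
  · rw [map_neg, c.E₁_P₂, neg_neg, sub_self]
  · exact sub_self _
  · rw [c.E₁_E₁, neg_zero]
  · rw [c.E₁_E₂, neg_zero]
  · rw [h.E₁_E₂_apply, c.E₁_P₁, map_zero, neg_zero]

theorem lie_E₂ (c : EuclideanEquations E₁ E₂ E₃ P₁ P₂ R g)
    (h : EuclideanBrackets E₁ E₂ E₃ P₁ P₂ R) : ⁅generatedField E₁ E₂ E₃ P₁ P₂ R g, E₂⁆ = 0 := by
  rw [generatedField, h.lie_frameComb_E₂]
  apply frameComb_eq_zero
  · rw [map_neg, sub_neg_eq_add, neg_add_cancel]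
  · rw [map_neg, c.E₂_P₂, neg_zero, neg_zero]
  · exact sub_self _
  · rw [c.E₂_E₁, neg_zero]
  · rw [c.E₂_E₂, neg_zero]
  · have := congrArg E₂ c.E₁_P₂
    rw [map_neg, ← h.E₁_E₂_apply, c.E₂_P₂, map_zero] at this
    exact this.symm

theorem lie_P₁ (c : EuclideanEquations E₁ E₂ E₃ P₁ P₂ R g)
    (h : EuclideanBrackets E₁ E₂ E₃ P₁ P₂ R) : ⁅generatedField E₁ E₂ E₃ P₁ P₂ R g, P₁⁆ = 0 := by
  rw [generatedField, h.lie_frameComb_P₁]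
  apply frameComb_eq_zero
  · rw [map_neg, c.P₁_P₁, neg_neg, sub_self]
  · rw [map_neg, c.P₁_P₂, neg_zero, neg_zero]
  · rw [neg_neg, sub_self]
  · rw [h.P₁_E₁_apply, c.E₁_P₁, c.E₃_eq, add_zero, neg_zero]
  · rw [h.P₁_E₂_apply, sub_self]
  -- The spin component requires P₁E₂P₁ g = -E₂ g. Both sides equal -E₃P₂ g: differentiate E₁P₂ g =
  -- -E₂P₁ g along P₁, and E₃ g = 0 along P₂.
  · have h1 := congrArg P₁ c.E₁_P₂
    have h2 := h.P₂_E₃_apply g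
    rw [c.E₃_eq, map_zero] at h2
    rw [h.P₁_E₁_apply, c.P₁_P₂, map_zero, map_neg] at h1
    linear_combination -h1 - h2

theorem lie_P₂ (c : EuclideanEquations E₁ E₂ E₃ P₁ P₂ R g)
    (h : EuclideanBrackets E₁ E₂ E₃ P₁ P₂ R) : ⁅generatedField E₁ E₂ E₃ P₁ P₂ R g, P₂⁆ = 0 := by
  rw [generatedField, h.lie_frameComb_P₂]
  apply frameComb_eq_zero
  · rw [map_neg, c.P₂_P₁, neg_zero, neg_zero]
  · rw [map_neg, c.P₂_P₂, neg_neg, sub_self]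
  · rw [neg_neg, sub_self]
  · rw [h.P₂_E₁_apply, c.E₁_P₂, sub_neg_eq_add, neg_add_cancel]
  · rw [h.P₂_E₂_apply, c.E₂_P₂, c.E₃_eq, add_zero, neg_zero]
  · have h2 := h.P₁_E₃_apply g
    rw [c.E₃_eq, map_zero] at h2
    rw [h.P₂_E₂_apply, c.P₂_P₁, map_zero, zero_add]
    linear_combination h2

/-- E₃ = [P₁, E₁], so the Jacobi identity suffices; likewise for R = [P₁, P₂]. -/
theorem lie_E₃ (c : EuclideanEquations E₁ E₂ E₃ P₁ P₂ R g)
    (h : EuclideanBrackets E₁ E₂ E₃ P₁ P₂ R) : ⁅generatedField E₁ E₂ E₃ P₁ P₂ R g, E₃⁆ = 0 := by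
  have h1 := c.lie_P₁ h
  have h2 := c.lie_E₁ h
  generalize generatedField E₁ E₂ E₃ P₁ P₂ R g = v at h1 h2 ⊢
  rw [← h.P₁_E₁, leibniz_lie, h1, h2, zero_lie, lie_zero, add_zero]

theorem lie_R (c : EuclideanEquations E₁ E₂ E₃ P₁ P₂ R g)
    (h : EuclideanBrackets E₁ E₂ E₃ P₁ P₂ R) : ⁅generatedField E₁ E₂ E₃ P₁ P₂ R g, R⁆ = 0 := by
  have h1 := c.lie_P₁ h
  have h2 := c.lie_P₂ h
  generalize generatedField E₁ E₂ E₃ P₁ P₂ R g = v at h1 h2 ⊢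
  rw [← h.P₁_P₂, leibniz_lie, h1, h2, zero_lie, lie_zero, add_zero]

end EuclideanEquations

end Prolongation

end

noncomputable section

/-! ### The symmetries of the pseudospherical system -/

namespace FrameBundle

open DForm

variable (U : TopologicalSpace.Opens FrameBundle)

local notation "E" => translationField U
local notation "P₁" => tiltField₁ U
local notation "P₂" => tiltField₂ U
local notation "R" => spinField U

theorem euclideanBrackets : EuclideanBrackets (E 0) (E 1) (E 2) P₁ P₂ R where
  E₁_E₂ := lie_E_E U 0 1
  E₁_E₃ := lie_E_E U 0 2
  E₂_E₃ := lie_E_E U 1 2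
  P₁_E₁ := lie_P₁_E_zero U
  P₁_E₂ := lie_P₁_E_one U
  P₁_E₃ := lie_P₁_E_two U
  P₂_E₁ := lie_P₂_E_zero U
  P₂_E₂ := lie_P₂_E_one U
  P₂_E₃ := lie_P₂_E_two U
  R_E₁ := lie_R_E_zero U
  R_E₂ := lie_R_E_one U
  R_E₃ := lie_R_E_two U
  R_P₁ := lie_R_P₁ U
  R_P₂ := lie_R_P₂ U
  P₁_P₂ := lie_P₁_P₂ U

section Components

variable {A : Type} [CommRing A] [Algebra ℝ A] {α : DForm A 1} {D₁ D₂ D₃ D₄ D₅ D₆ : VField A}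
  (a₁ a₂ g p₁ p₂ r : A)

theorem frameComb_first (h₁ : α ![D₁] = 1) (h₂ : α ![D₂] = 0) (h₃ : α ![D₃] = 0)
    (h₄ : α ![D₄] = 0) (h₅ : α ![D₅] = 0) (h₆ : α ![D₆] = 0) :
    α ![frameComb D₁ D₂ D₃ D₄ D₅ D₆ a₁ a₂ g p₁ p₂ r] = a₁ := by
  simp only [frameComb, apply_one_add, apply_one_smul, h₁, h₂, h₃, h₄, h₅, h₆]
  ring

theorem frameComb_second (h₁ : α ![D₁] = 0) (h₂ : α ![D₂] = 1) (h₃ : α ![D₃] = 0)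
    (h₄ : α ![D₄] = 0) (h₅ : α ![D₅] = 0) (h₆ : α ![D₆] = 0) :
    α ![frameComb D₁ D₂ D₃ D₄ D₅ D₆ a₁ a₂ g p₁ p₂ r] = a₂ := by
  simp only [frameComb, apply_one_add, apply_one_smul, h₁, h₂, h₃, h₄, h₅, h₆]
  ring

theorem frameComb_third (h₁ : α ![D₁] = 0) (h₂ : α ![D₂] = 0) (h₃ : α ![D₃] = 1)
    (h₄ : α ![D₄] = 0) (h₅ : α ![D₅] = 0) (h₆ : α ![D₆] = 0) :
    α ![frameComb D₁ D₂ D₃ D₄ D₅ D₆ a₁ a₂ g p₁ p₂ r] = g := by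
  simp only [frameComb, apply_one_add, apply_one_smul, h₁, h₂, h₃, h₄, h₅, h₆]
  ring

theorem frameComb_fourth (h₁ : α ![D₁] = 0) (h₂ : α ![D₂] = 0) (h₃ : α ![D₃] = 0)
    (h₄ : α ![D₄] = 1) (h₅ : α ![D₅] = 0) (h₆ : α ![D₆] = 0) :
    α ![frameComb D₁ D₂ D₃ D₄ D₅ D₆ a₁ a₂ g p₁ p₂ r] = p₁ := by
  simp only [frameComb, apply_one_add, apply_one_smul, h₁, h₂, h₃, h₄, h₅, h₆]
  ring

theorem frameComb_fifth (h₁ : α ![D₁] = 0) (h₂ : α ![D₂] = 0) (h₃ : α ![D₃] = 0)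
    (h₄ : α ![D₄] = 0) (h₅ : α ![D₅] = 1) (h₆ : α ![D₆] = 0) :
    α ![frameComb D₁ D₂ D₃ D₄ D₅ D₆ a₁ a₂ g p₁ p₂ r] = p₂ := by
  simp only [frameComb, apply_one_add, apply_one_smul, h₁, h₂, h₃, h₄, h₅, h₆]
  ring

end Components

variable (a₁ a₂ g p₁ p₂ r : smoothFunctions U)

local notation "comb" => frameComb (E 0) (E 1) (E 2) P₁ P₂ R

theorem eta_zero_comb : eta U 0 ![comb a₁ a₂ g p₁ p₂ r] = a₁ :=
  frameComb_first _ _ _ _ _ _ (eta_E U 0 0) (eta_E U 0 1) (eta_E U 0 2) (eta_P₁ U 0) (eta_P₂ U 0)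
    (eta_R U 0)

theorem eta_one_comb : eta U 1 ![comb a₁ a₂ g p₁ p₂ r] = a₂ :=
  frameComb_second _ _ _ _ _ _ (eta_E U 1 0) (eta_E U 1 1) (eta_E U 1 2) (eta_P₁ U 1) (eta_P₂ U 1)
    (eta_R U 1)

theorem eta_two_comb : eta U 2 ![comb a₁ a₂ g p₁ p₂ r] = g :=
  frameComb_third _ _ _ _ _ _ (eta_E U 2 0) (eta_E U 2 1) (eta_E U 2 2) (eta_P₁ U 2) (eta_P₂ U 2)
    (eta_R U 2)

theorem etaConn_zero_comb : etaConn U 2 0 ![comb a₁ a₂ g p₁ p₂ r] = p₁ :=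
  frameComb_fourth _ _ _ _ _ _ (etaConn_E U 2 0 0) (etaConn_E U 2 0 1) (etaConn_E U 2 0 2)
    (etaConn_zero_P₁ U) (etaConn_zero_P₂ U) (etaConn_zero_R U)

theorem etaConn_one_comb : etaConn U 2 1 ![comb a₁ a₂ g p₁ p₂ r] = p₂ :=
  frameComb_fifth _ _ _ _ _ _ (etaConn_E U 2 1 0) (etaConn_E U 2 1 1) (etaConn_E U 2 1 2)
    (etaConn_one_P₁ U) (etaConn_one_P₂ U) (etaConn_one_R U)

theorem psi_comb (b₁ b₂ h q₁ q₂ s : smoothFunctions U) :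
    psi U ![comb a₁ a₂ g p₁ p₂ r, comb b₁ b₂ h q₁ q₂ s] =
      p₁ * q₂ - q₁ * p₂ + (a₁ * b₂ - b₁ * a₂) := by
  simp only [psi_apply, eta_zero_comb, eta_one_comb, etaConn_zero_comb, etaConn_one_comb]

/-! ### Forms in the ideal -/

variable {U}

/-- Two vector fields that are annihilated by `η³` and on which `dη³` and `Ψ` vanish. -/
structure IsIntegralPair (X Y : VField (smoothFunctions U)) : Prop where
  left : eta U 2 ![X] = 0
  right : eta U 2 ![Y] = 0
  d₁_eta : d₁ (eta U 2) ![X, Y] = 0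
  psi : psi U ![X, Y] = 0

theorem apply_two_swap {A : Type} [CommRing A] [Algebra ℝ A] (φ : DForm A 2) (X Y : VField A) :
    φ ![Y, X] = -φ ![X, Y] := by
  have h := φ.map_swap ![X, Y] (show (0 : Fin 2) ≠ 1 by decide)
  rw [← h]
  congr 1
  ext i
  fin_cases i <;> rfl

/-- This is the hypothesis of `MemIdeal.apply_comp_eq_zero`, through which a pair becomes a test for
membership of 2-forms in the ideal. -/
theorem IsIntegralPair.generator_eq_zero {X Y : VField (smoothFunctions U)}
    (h : IsIntegralPair X Y) (k : ℕ) (φ : DForm (smoothFunctions U) k)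
    (hφ : φ ∈ pseudosphericalGenerators U k) (s : Fin k → Fin 2) (hs : Function.Injective s) :
    φ (![X, Y] ∘ s) = 0 := by
  match k, φ, hφ, s, hs with
  | 0, _, hφ, _, _ => exact hφ.elim
  | 1, φ, hφ, s, _ =>
    obtain rfl : φ = eta U 2 := hφ
    have h1 : ![X, Y] ∘ s = ![![X, Y] (s 0)] := by ext i; fin_cases i; rfl
    rw [h1]
    generalize s 0 = i
    fin_cases i
    exacts [h.left, h.right]
  | 2, φ, hφ, s, hs =>
    have h0 : φ ![X, Y] = 0 := by
      rcases hφ with rfl | rfl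
      exacts [h.d₁_eta, h.psi]
    have h1 : ![X, Y] ∘ s = ![![X, Y] (s 0), ![X, Y] (s 1)] := by ext i; fin_cases i <;> rfl
    have h2 : s 0 ≠ s 1 := hs.ne (by decide)
    rw [h1]
    generalize s 0 = i at h2
    generalize s 1 = j at h2
    fin_cases i <;> fin_cases j
    · exact absurd rfl h2
    · exact h0
    · exact (apply_two_swap φ X Y).trans (by rw [h0, neg_zero])
    · exact absurd rfl h2
  | k + 3, _, hφ, _, _ => exact hφ.elim

theorem IsIntegralPair.apply_eq_zero {X Y : VField (smoothFunctions U)}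
    (h : IsIntegralPair X Y) {φ : DForm (smoothFunctions U) 2}
    (hφ : MemIdeal (pseudosphericalGenerators U) 2 φ) : φ ![X, Y] = 0 :=
  MemIdeal.apply_comp_eq_zero h.generator_eq_zero hφ id Function.injective_id

theorem apply_two_self {A : Type} [CommRing A] [Algebra ℝ A] (φ : DForm A 2) (X : VField A) :
    φ ![X, X] = 0 :=
  φ.map_eq_zero_of_eq ![X, X] (i := 0) (j := 1) rfl (by decide)

/-- The degenerate pair (X, X) lets the same vanishing criterion serve in degree 1, and (0, 0) in
degree 0. -/
theorem isIntegralPair_self {X : VField (smoothFunctions U)} (h : eta U 2 ![X] = 0) :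
    IsIntegralPair X X :=
  ⟨h, h, apply_two_self _ _, apply_two_self _ _⟩

theorem apply_eq_zero_of_memIdeal_one {X : VField (smoothFunctions U)} (h : eta U 2 ![X] = 0)
    {φ : DForm (smoothFunctions U) 1} (hφ : MemIdeal (pseudosphericalGenerators U) 1 φ) :
    φ ![X] = 0 := by
  have := MemIdeal.apply_comp_eq_zero (isIntegralPair_self h).generator_eq_zero hφ
    (fun _ => 0) (Function.injective_of_subsingleton _)
  have h1 : ![X, X] ∘ (fun _ : Fin 1 => (0 : Fin 2)) = ![X] := by ext i; fin_cases i; rfl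
  rwa [h1] at this

theorem eq_zero_of_memIdeal_zero {φ : DForm (smoothFunctions U) 0}
    (hφ : MemIdeal (pseudosphericalGenerators U) 0 φ) (w : Fin 0 → VField (smoothFunctions U)) :
    φ w = 0 := by
  have := MemIdeal.apply_comp_eq_zero
    (isIntegralPair_self (apply_one_zero (eta U 2))).generator_eq_zero hφ Fin.elim0
    (Function.injective_of_subsingleton _)
  rwa [Subsingleton.elim (![0, 0] ∘ Fin.elim0) w] at this

end FrameBundle

end

noncomputable section

/-! ### The determining equations -/

section DeterminingEquations

variable {A : Type} [CommRing A] [Algebra ℝ A] {E₁ E₂ E₃ P₁ P₂ R : VField A}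

open DForm

theorem frameComb_add (a₁ a₂ g p₁ p₂ r b₁ b₂ h q₁ q₂ s : A) :
    frameComb E₁ E₂ E₃ P₁ P₂ R a₁ a₂ g p₁ p₂ r + frameComb E₁ E₂ E₃ P₁ P₂ R b₁ b₂ h q₁ q₂ s =
      frameComb E₁ E₂ E₃ P₁ P₂ R (a₁ + b₁) (a₂ + b₂) (g + h) (p₁ + q₁) (p₂ + q₂) (r + s) := by
  simp only [frameComb]
  module

theorem frameComb_sub (a₁ a₂ g p₁ p₂ r b₁ b₂ h q₁ q₂ s : A) :
    frameComb E₁ E₂ E₃ P₁ P₂ R a₁ a₂ g p₁ p₂ r - frameComb E₁ E₂ E₃ P₁ P₂ R b₁ b₂ h q₁ q₂ s =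
      frameComb E₁ E₂ E₃ P₁ P₂ R (a₁ - b₁) (a₂ - b₂) (g - h) (p₁ - q₁) (p₂ - q₂) (r - s) := by
  simp only [frameComb]
  module

theorem frameComb_X₁ : frameComb E₁ E₂ E₃ P₁ P₂ R 1 0 0 0 1 0 = E₁ + P₂ := by
  simp only [frameComb]
  module

theorem frameComb_X₂ : frameComb E₁ E₂ E₃ P₁ P₂ R 0 1 0 (-1) 0 0 = E₂ - P₁ := by
  simp only [frameComb]
  module

theorem frameComb_Y₁ : frameComb E₁ E₂ E₃ P₁ P₂ R 1 0 0 0 (-1) 0 = E₁ - P₂ := by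
  simp only [frameComb]
  module

theorem frameComb_Y₂ : frameComb E₁ E₂ E₃ P₁ P₂ R 0 1 0 1 0 0 = E₂ + P₁ := by
  simp only [frameComb]
  module

/-- A 1-form `θ` and a 2-form `ψ` that are given by `η³` and `Ψ` in components. -/
structure PseudosphericalForms (E₁ E₂ E₃ P₁ P₂ R : VField A) (θ : DForm A 1) (ψ : DForm A 2) :
    Prop where
  brackets : EuclideanBrackets E₁ E₂ E₃ P₁ P₂ R
  θ_apply (a₁ a₂ g p₁ p₂ r : A) : θ ![frameComb E₁ E₂ E₃ P₁ P₂ R a₁ a₂ g p₁ p₂ r] = g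
  ψ_apply (a₁ a₂ g p₁ p₂ r b₁ b₂ h q₁ q₂ s : A) :
    ψ ![frameComb E₁ E₂ E₃ P₁ P₂ R a₁ a₂ g p₁ p₂ r, frameComb E₁ E₂ E₃ P₁ P₂ R b₁ b₂ h q₁ q₂ s] =
      p₁ * q₂ - q₁ * p₂ + (a₁ * b₂ - b₁ * a₂)

namespace PseudosphericalForms

variable {θ : DForm A 1} {ψ : DForm A 2} (H : PseudosphericalForms E₁ E₂ E₃ P₁ P₂ R θ ψ)
include H

theorem θ_E₁ : θ ![E₁] = 0 := by
  have := H.θ_apply 1 0 0 0 0 0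
  rwa [show frameComb E₁ E₂ E₃ P₁ P₂ R 1 0 0 0 0 0 = E₁ by simp only [frameComb]; module] at this

theorem θ_E₂ : θ ![E₂] = 0 := by
  have := H.θ_apply 0 1 0 0 0 0
  rwa [show frameComb E₁ E₂ E₃ P₁ P₂ R 0 1 0 0 0 0 = E₂ by simp only [frameComb]; module] at this

theorem θ_P₁ : θ ![P₁] = 0 := by
  have := H.θ_apply 0 0 0 1 0 0
  rwa [show frameComb E₁ E₂ E₃ P₁ P₂ R 0 0 0 1 0 0 = P₁ by simp only [frameComb]; module] at this

theorem θ_P₂ : θ ![P₂] = 0 := by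
  have := H.θ_apply 0 0 0 0 1 0
  rwa [show frameComb E₁ E₂ E₃ P₁ P₂ R 0 0 0 0 1 0 = P₂ by simp only [frameComb]; module] at this

theorem θ_R : θ ![R] = 0 := by
  have := H.θ_apply 0 0 0 0 0 1
  rwa [show frameComb E₁ E₂ E₃ P₁ P₂ R 0 0 0 0 0 1 = R by simp only [frameComb]; module] at this

variable (a₁ a₂ g p₁ p₂ r : A)

theorem d₁_θ_E₁ : d₁ θ ![frameComb E₁ E₂ E₃ P₁ P₂ R a₁ a₂ g p₁ p₂ r, E₁] = -p₁ := by
  rw [d₁_apply, H.brackets.lie_frameComb_E₁, H.θ_apply, H.θ_apply, H.θ_E₁, map_zero]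
  ring

theorem d₁_θ_E₂ : d₁ θ ![frameComb E₁ E₂ E₃ P₁ P₂ R a₁ a₂ g p₁ p₂ r, E₂] = -p₂ := by
  rw [d₁_apply, H.brackets.lie_frameComb_E₂, H.θ_apply, H.θ_apply, H.θ_E₂, map_zero]
  ring

theorem d₁_θ_P₁ : d₁ θ ![frameComb E₁ E₂ E₃ P₁ P₂ R a₁ a₂ g p₁ p₂ r, P₁] = a₁ := by
  rw [d₁_apply, H.brackets.lie_frameComb_P₁, H.θ_apply, H.θ_apply, H.θ_P₁, map_zero]
  ring

theorem d₁_θ_P₂ : d₁ θ ![frameComb E₁ E₂ E₃ P₁ P₂ R a₁ a₂ g p₁ p₂ r, P₂] = a₂ := by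
  rw [d₁_apply, H.brackets.lie_frameComb_P₂, H.θ_apply, H.θ_apply, H.θ_P₂, map_zero]
  ring

/-- Modulo θ, dθ = η¹∧η³₁ + η²∧η³₂, so ψ + dθ = (η¹ - η³₂)∧(η² + η³₁) and ψ - dθ = (η¹ + η³₂)∧(η² -
η³₁). The X's annihilate the factors of the first product and the Y's those of the second; hence dθ
and ψ both vanish on every pair (Xᵢ, Yⱼ). -/
theorem d₁_θ_X₁_Y₁ : d₁ θ ![E₁ + P₂, E₁ - P₂] = 0 := by
  rw [d₁_apply, ← frameComb_X₁ (E₂ := E₂) (E₃ := E₃) (P₁ := P₁) (R := R), lie_sub,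
    H.brackets.lie_frameComb_E₁, H.brackets.lie_frameComb_P₂, frameComb_sub, H.θ_apply, H.θ_apply,
    apply_one_sub, H.θ_E₁, H.θ_P₂]
  simp

theorem d₁_θ_X₁_Y₂ : d₁ θ ![E₁ + P₂, E₂ + P₁] = 0 := by
  rw [d₁_apply, ← frameComb_X₁ (E₂ := E₂) (E₃ := E₃) (P₁ := P₁) (R := R), lie_add,
    H.brackets.lie_frameComb_E₂, H.brackets.lie_frameComb_P₁, frameComb_add, H.θ_apply, H.θ_apply,
    apply_one_add, H.θ_E₂, H.θ_P₁]
  simp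

theorem d₁_θ_X₂_Y₁ : d₁ θ ![E₂ - P₁, E₁ - P₂] = 0 := by
  rw [d₁_apply, ← frameComb_X₂ (E₁ := E₁) (E₃ := E₃) (P₂ := P₂) (R := R), lie_sub,
    H.brackets.lie_frameComb_E₁, H.brackets.lie_frameComb_P₂, frameComb_sub, H.θ_apply, H.θ_apply,
    apply_one_sub, H.θ_E₁, H.θ_P₂]
  simp

theorem d₁_θ_X₂_Y₂ : d₁ θ ![E₂ - P₁, E₂ + P₁] = 0 := by
  rw [d₁_apply, ← frameComb_X₂ (E₁ := E₁) (E₃ := E₃) (P₂ := P₂) (R := R), lie_add,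
    H.brackets.lie_frameComb_E₂, H.brackets.lie_frameComb_P₁, frameComb_add, H.θ_apply, H.θ_apply,
    apply_one_add, H.θ_E₂, H.θ_P₁]
  simp

theorem ψ_X₁_Y₁ : ψ ![E₁ + P₂, E₁ - P₂] = 0 := by
  rw [← frameComb_X₁ (E₂ := E₂) (E₃ := E₃) (P₁ := P₁) (R := R),
    ← frameComb_Y₁ (E₂ := E₂) (E₃ := E₃) (P₁ := P₁) (R := R), H.ψ_apply]
  ring

theorem ψ_X₁_Y₂ : ψ ![E₁ + P₂, E₂ + P₁] = 0 := by
  rw [← frameComb_X₁ (E₂ := E₂) (E₃ := E₃) (P₁ := P₁) (R := R),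
    ← frameComb_Y₂ (E₁ := E₁) (E₃ := E₃) (P₂ := P₂) (R := R), H.ψ_apply]
  ring

theorem ψ_X₂_Y₁ : ψ ![E₂ - P₁, E₁ - P₂] = 0 := by
  rw [← frameComb_X₂ (E₁ := E₁) (E₃ := E₃) (P₂ := P₂) (R := R),
    ← frameComb_Y₁ (E₂ := E₂) (E₃ := E₃) (P₁ := P₁) (R := R), H.ψ_apply]
  ring

theorem ψ_X₂_Y₂ : ψ ![E₂ - P₁, E₂ + P₁] = 0 := by
  rw [← frameComb_X₂ (E₁ := E₁) (E₃ := E₃) (P₂ := P₂) (R := R),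
    ← frameComb_Y₂ (E₁ := E₁) (E₃ := E₃) (P₂ := P₂) (R := R), H.ψ_apply]
  ring

variable {a₁ a₂ g p₁ p₂ r}

/-- The vector field preserves the contact system. -/
theorem contact_equations
    (h : ∀ X, θ ![X] = 0 → lieDeriv (frameComb E₁ E₂ E₃ P₁ P₂ R a₁ a₂ g p₁ p₂ r) θ ![X] = 0) :
    a₁ = -P₁ g ∧ a₂ = -P₂ g ∧ p₁ = E₁ g ∧ p₂ = E₂ g ∧ R g = 0 := by
  have h1 := h E₁ H.θ_E₁
  have h2 := h E₂ H.θ_E₂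
  have h3 := h P₁ H.θ_P₁
  have h4 := h P₂ H.θ_P₂
  have h5 := h R H.θ_R
  rw [lieDeriv_one_apply, H.brackets.lie_frameComb_E₁, H.θ_apply, H.θ_E₁, map_zero] at h1
  rw [lieDeriv_one_apply, H.brackets.lie_frameComb_E₂, H.θ_apply, H.θ_E₂, map_zero] at h2
  rw [lieDeriv_one_apply, H.brackets.lie_frameComb_P₁, H.θ_apply, H.θ_P₁, map_zero] at h3
  rw [lieDeriv_one_apply, H.brackets.lie_frameComb_P₂, H.θ_apply, H.θ_P₂, map_zero] at h4
  rw [lieDeriv_one_apply, H.brackets.lie_frameComb_R, H.θ_apply, H.θ_R, map_zero] at h5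
  refine ⟨?_, ?_, ?_, ?_, ?_⟩
  · linear_combination h3
  · linear_combination h4
  · linear_combination -h1
  · linear_combination -h2
  · linear_combination h5

/-- After the contact equations are inserted, L_vψ(Xᵢ, Yⱼ) is -(XᵢYⱼ g + YⱼXᵢ g - 2δᵢⱼ g), and r
drops out. Since [Xᵢ, Yⱼ] is 0 or ±R and R g = 0, the two orders of differentiation agree. -/
theorem determiningEquations
    (h : ∀ X, θ ![X] = 0 → lieDeriv (frameComb E₁ E₂ E₃ P₁ P₂ R a₁ a₂ g p₁ p₂ r) θ ![X] = 0)
    (h11 : lieDeriv (frameComb E₁ E₂ E₃ P₁ P₂ R a₁ a₂ g p₁ p₂ r) ψ ![E₁ + P₂, E₁ - P₂] = 0)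
    (h12 : lieDeriv (frameComb E₁ E₂ E₃ P₁ P₂ R a₁ a₂ g p₁ p₂ r) ψ ![E₁ + P₂, E₂ + P₁] = 0)
    (h21 : lieDeriv (frameComb E₁ E₂ E₃ P₁ P₂ R a₁ a₂ g p₁ p₂ r) ψ ![E₂ - P₁, E₁ - P₂] = 0)
    (h22 : lieDeriv (frameComb E₁ E₂ E₃ P₁ P₂ R a₁ a₂ g p₁ p₂ r) ψ ![E₂ - P₁, E₂ + P₁] = 0) :
    DeterminingEquations R (E₁ + P₂) (E₂ - P₁) (E₁ - P₂) (E₂ + P₁) g := by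
  obtain ⟨rfl, rfl, rfl, rfl, hR⟩ := H.contact_equations h
  have c := H.brackets.characteristic
  have b := H.brackets
  have x₁ : frameComb E₁ E₂ E₃ P₁ P₂ R 1 0 0 0 1 0 = E₁ + P₂ := frameComb_X₁
  have x₂ : frameComb E₁ E₂ E₃ P₁ P₂ R 0 1 0 (-1) 0 0 = E₂ - P₁ := frameComb_X₂
  have y₁ : frameComb E₁ E₂ E₃ P₁ P₂ R 1 0 0 0 (-1) 0 = E₁ - P₂ := frameComb_Y₁
  have y₂ : frameComb E₁ E₂ E₃ P₁ P₂ R 0 1 0 1 0 0 = E₂ + P₁ := frameComb_Y₂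
  rw [lieDeriv_two_apply, H.ψ_X₁_Y₁, lie_add, lie_sub, b.lie_frameComb_E₁, b.lie_frameComb_P₂,
    frameComb_add, frameComb_sub, ← x₁,
    ← y₁, H.ψ_apply, H.ψ_apply] at h11
  rw [lieDeriv_two_apply, H.ψ_X₁_Y₂, lie_add, lie_add, b.lie_frameComb_E₁, b.lie_frameComb_P₂,
    b.lie_frameComb_E₂, b.lie_frameComb_P₁,
    frameComb_add, frameComb_add, ← x₁,
    ← y₂, H.ψ_apply, H.ψ_apply] at h12
  rw [lieDeriv_two_apply, H.ψ_X₂_Y₁, lie_sub, lie_sub, b.lie_frameComb_E₁, b.lie_frameComb_P₂,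
    b.lie_frameComb_E₂, b.lie_frameComb_P₁,
    frameComb_sub, frameComb_sub, ← x₂,
    ← y₁, H.ψ_apply, H.ψ_apply] at h21
  rw [lieDeriv_two_apply, H.ψ_X₂_Y₂, lie_sub, lie_add, b.lie_frameComb_E₂, b.lie_frameComb_P₁,
    frameComb_add, frameComb_sub, ← x₂,
    ← y₂, H.ψ_apply, H.ψ_apply] at h22
  have c11 := c.X₁_Y₁ g
  have c12 := c.X₁_Y₂ g
  have c21 := c.X₂_Y₁ g
  have c22 := c.X₂_Y₂ g
  rw [map_zero] at h11 h12 h21 h22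
  clear h x₁ x₂ y₁ y₂ b H
  simp only [Derivation.add_apply, Derivation.sub_apply, map_add, map_sub, map_neg]
    at c11 c12 c21 c22 h11 h12 h21 h22
  refine ⟨hR, ?_, ?_, ?_, ?_⟩ <;>
    simp only [Derivation.add_apply, Derivation.sub_apply, map_add, map_sub] <;>
    rw [← sub_eq_zero] <;> apply eq_zero_of_two_mul
  · linear_combination c11 - h11
  · linear_combination c22 - h22
  · linear_combination c12 - h12 - hR
  · linear_combination c21 - h21 + hR

end PseudosphericalForms

end DeterminingEquations

end

noncomputable section

/-! ### Symmetries are sums of frame rotations and Euclidean motions -/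

namespace FrameBundle

open DForm

variable {U : TopologicalSpace.Opens FrameBundle}

local notation "E" => translationField U
local notation "P₁" => tiltField₁ U
local notation "P₂" => tiltField₂ U
local notation "R" => spinField U

theorem pseudosphericalForms :
    PseudosphericalForms (E 0) (E 1) (E 2) P₁ P₂ R (eta U 2) (psi U) where
  brackets := euclideanBrackets U
  θ_apply := eta_two_comb U
  ψ_apply := psi_comb U

theorem memIdeal_eta : MemIdeal (pseudosphericalGenerators U) 1 (eta U 2) :=
  .gen (Set.mem_singleton _)

theorem memIdeal_d₁_eta : MemIdeal (pseudosphericalGenerators U) 2 (d₁ (eta U 2)) :=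
  .gen (Set.mem_insert _ _)

theorem memIdeal_psi : MemIdeal (pseudosphericalGenerators U) 2 (psi U) :=
  .gen (Set.mem_insert_of_mem _ (Set.mem_singleton _))

theorem eta_X₁ : eta U 2 ![E 0 + P₂] = 0 := by
  rw [apply_one_add, pseudosphericalForms.θ_E₁, pseudosphericalForms.θ_P₂, add_zero]

theorem eta_X₂ : eta U 2 ![E 1 - P₁] = 0 := by
  rw [apply_one_sub, pseudosphericalForms.θ_E₂, pseudosphericalForms.θ_P₁, sub_zero]

theorem eta_Y₁ : eta U 2 ![E 0 - P₂] = 0 := by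
  rw [apply_one_sub, pseudosphericalForms.θ_E₁, pseudosphericalForms.θ_P₂, sub_zero]

theorem eta_Y₂ : eta U 2 ![E 1 + P₁] = 0 := by
  rw [apply_one_add, pseudosphericalForms.θ_E₂, pseudosphericalForms.θ_P₁, add_zero]

theorem exists_eq_frameComb (v : VField (smoothFunctions U)) :
    ∃ a₁ a₂ g p₁ p₂ r, v = frameComb (E 0) (E 1) (E 2) P₁ P₂ R a₁ a₂ g p₁ p₂ r :=
  ⟨_, _, _, _, _, _, eq_sum_components U v⟩

theorem smul_spinField_mem_frameRotations (f : smoothFunctions U) : f • R ∈ frameRotations U := by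
  refine ⟨f, fun k => ⟨?_, ?_, ?_, ?_⟩⟩ <;> rw [Derivation.smul_apply, smul_eq_mul]
  · rw [spinField_xCoord, mul_zero]
  · rw [spinField_eCoord_zero]
  · rw [spinField_eCoord_one]
    ring
  · rw [spinField_eCoord_two, mul_zero]

theorem mem_frameRotations_iff {v : VField (smoothFunctions U)} :
    v ∈ frameRotations U ↔ ∃ f : smoothFunctions U, v = f • R := by
  refine ⟨fun ⟨f, h⟩ => ⟨f, ?_⟩, ?_⟩
  · apply vfield_ext_components <;> intro k <;> rw [Derivation.smul_apply, smul_eq_mul]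
    · rw [spinField_xCoord, mul_zero, (h k).1]
    · rw [spinField_eCoord_zero, (h k).2.1]
    · rw [spinField_eCoord_one, (h k).2.2.1]
      ring
    · rw [spinField_eCoord_two, mul_zero, (h k).2.2.2]
  · rintro ⟨f, rfl⟩
    exact smul_spinField_mem_frameRotations f

theorem rotationField_symm {i j : Fin 3} (hij : i ≠ j) :
    rotationField U hij.symm = -rotationField U hij := by
  refine vfield_ext (fun k => ?_) fun m k => ?_
  · simp
  · rw [Derivation.neg_apply, rotationField_eCoord, rotationField_eCoord]
    by_cases h1 : m = i
    · subst h1; simp [hij]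
    · by_cases h2 : m = j
      · subst h2; simp [h1]
      · simp [h1, h2]

theorem IsInvariant.of_frame {f : smoothFunctions U} (hE : ∀ i, E i f = 0) (h1 : P₁ f = 0)
    (h2 : P₂ f = 0) (hR : R f = 0) : IsInvariant f := by
  refine ⟨hE, ?_⟩
  have key : ∀ i j (hij : i ≠ j), rotationField U hij f = 0 → rotationField U hij.symm f = 0 :=
    fun i j hij h => by rw [rotationField_symm hij, Derivation.neg_apply, h, neg_zero]
  intro i j hij
  fin_cases i <;> fin_cases j
  · exact absurd rfl hij
  · exact hR
  · exact h1
  · exact key 0 1 (by decide) hR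
  · exact absurd rfl hij
  · exact h2
  · exact key 0 2 (by decide) h1
  · exact key 1 2 (by decide) h2
  · exact absurd rfl hij

theorem algebraMap_injective (hU : (U : Set FrameBundle).Nonempty) :
    Function.Injective (algebraMap ℝ (smoothFunctions U)) := by
  obtain ⟨q, hq⟩ := hU
  intro a b h
  exact congrFun (congrArg Subtype.val h) ⟨q, hq⟩

theorem _root_.Derivation.apply_comm_of_lie_eq_zero {A : Type} [CommRing A] [Algebra ℝ A]
    {D D' : VField A} (h : ⁅D, D'⁆ = 0) (f : A) : D' (D f) = D (D' f) := by
  rw [D.apply_apply_eq, h, Derivation.zero_apply, add_zero]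

/-- This is the entry of the matrix that maps eⱼ to w(eⱼ), namely Σ w(eᵢ) ⊗ eᵢ. As w commutes with
the frame fields, each of them rotates w(eᵢ) in the same way as eᵢ, and the sum is invariant under a
common rotation. -/
theorem isInvariant_sum_apply_eCoord_mul {w : VField (smoothFunctions U)} (hE : ∀ i : Fin 3, ⁅w, E i⁆ = 0)
    (h1 : ⁅w, P₁⁆ = 0) (h2 : ⁅w, P₂⁆ = 0) (hR : ⁅w, R⁆ = 0) (k l : Fin 3) :
    IsInvariant (∑ i, w (eCoord U i k) * eCoord U i l) := by
  have cE := fun i => Derivation.apply_comm_of_lie_eq_zero (hE i)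
  have c1 := Derivation.apply_comm_of_lie_eq_zero h1
  have c2 := Derivation.apply_comm_of_lie_eq_zero h2
  have cR := Derivation.apply_comm_of_lie_eq_zero hR
  refine IsInvariant.of_frame (fun i => ?_) ?_ ?_ ?_
  · simp only [map_sum, Derivation.leibniz, cE, translationField_eCoord, map_zero, smul_zero,
      add_zero, Finset.sum_const_zero]
  · simp only [Fin.sum_univ_three, map_add, Derivation.leibniz, c1, tiltField₁_eCoord_zero,
      tiltField₁_eCoord_one, tiltField₁_eCoord_two, map_zero, map_neg, smul_eq_mul]
    ring
  · simp only [Fin.sum_univ_three, map_add, Derivation.leibniz, c2, tiltField₂_eCoord_zero,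
      tiltField₂_eCoord_one, tiltField₂_eCoord_two, map_zero, map_neg, smul_eq_mul]
    ring
  · simp only [Fin.sum_univ_three, map_add, Derivation.leibniz, cR, spinField_eCoord_zero,
      spinField_eCoord_one, spinField_eCoord_two, map_zero, map_neg, smul_eq_mul]
    ring

theorem apply_eCoord_eq_sum (w : VField (smoothFunctions U)) (j k : Fin 3) :
    w (eCoord U j k) = ∑ l, (∑ i, w (eCoord U i k) * eCoord U i l) * eCoord U j l := by
  simp only [Finset.sum_mul, mul_assoc]
  rw [Finset.sum_comm]
  simp only [← Finset.mul_sum, sum_eCoord_mul_eCoord, mul_ite, mul_one, mul_zero,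
    Finset.sum_ite_eq', Finset.mem_univ, if_true]

theorem sum_apply_eCoord_mul_skew (w : VField (smoothFunctions U)) (k l : Fin 3) :
    ∑ i, w (eCoord U i l) * eCoord U i k = -∑ i, w (eCoord U i k) * eCoord U i l := by
  have h := congrArg w (sum_eCoord_mul_eCoord' (U := U) k l)
  have h0 : w (if k = l then 1 else 0) = 0 := by split_ifs <;> simp
  rw [h0, map_sum] at h
  rw [eq_neg_iff_add_eq_zero, ← Finset.sum_add_distrib, ← h]
  refine Finset.sum_congr rfl fun i _ => ?_
  rw [Derivation.leibniz, smul_eq_mul, smul_eq_mul]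
  ring

/-- A frame field D satisfies D(w x) = w(D x). For `E i` this is w(eᵢ) = M eᵢ, which cancels against
the derivative of M x; the rotations kill x. -/
theorem isInvariant_apply_xCoord_sub {w : VField (smoothFunctions U)} (hE : ∀ i : Fin 3, ⁅w, E i⁆ = 0)
    (h1 : ⁅w, P₁⁆ = 0) (h2 : ⁅w, P₂⁆ = 0) (hR : ⁅w, R⁆ = 0)
    {M : Fin 3 → Fin 3 → ℝ} (he : ∀ i k, w (eCoord U i k) = ∑ l, M k l • eCoord U i l) (k : Fin 3) :
    IsInvariant (w (xCoord U k) - ∑ l, M k l • xCoord U l) := by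
  have key : ∀ D : VField (smoothFunctions U), D (w (xCoord U k) - ∑ l, M k l • xCoord U l) =
      D (w (xCoord U k)) - ∑ l, M k l • D (xCoord U l) := fun D => by
    rw [map_sub, map_sum]
    simp only [Derivation.map_smul]
  refine IsInvariant.of_frame (fun i => ?_) ?_ ?_ ?_
  · rw [key, Derivation.apply_comm_of_lie_eq_zero (hE i)]
    simp only [translationField_xCoord, he, sub_self]
  · rw [key, Derivation.apply_comm_of_lie_eq_zero h1]
    simp only [tiltField₁_xCoord, smul_zero, Finset.sum_const_zero, map_zero, sub_self]
  · rw [key, Derivation.apply_comm_of_lie_eq_zero h2]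
    simp only [tiltField₂_xCoord, smul_zero, Finset.sum_const_zero, map_zero, sub_self]
  · rw [key, Derivation.apply_comm_of_lie_eq_zero hR]
    simp only [spinField_xCoord, smul_zero, Finset.sum_const_zero, map_zero, sub_self]

/-- The centralizer of the left-invariant fields consists of the infinitesimal left translations.
Connectedness turns the invariant entries of M and b into constants; M is skew because w
differentiates the constant matrix Σ eᵢ ⊗ eᵢ to 0. -/
theorem mem_euclideanMotions_of_lie_eq_zero {w : VField (smoothFunctions U)} (hE : ∀ i : Fin 3, ⁅w, E i⁆ = 0)
    (h1 : ⁅w, P₁⁆ = 0) (h2 : ⁅w, P₂⁆ = 0) (hR : ⁅w, R⁆ = 0)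
    (hU : IsConnected (U : Set FrameBundle)) : w ∈ euclideanMotions U := by
  choose M hM using fun k l =>
    (isInvariant_sum_apply_eCoord_mul hE h1 h2 hR k l).exists_eq_algebraMap hU
  have he : ∀ i k, w (eCoord U i k) = ∑ l, M k l • eCoord U i l := fun i k => by
    rw [apply_eCoord_eq_sum]
    exact Finset.sum_congr rfl fun l _ => by rw [hM, Algebra.smul_def]
  choose b hb using fun k =>
    (isInvariant_apply_xCoord_sub hE h1 h2 hR he k).exists_eq_algebraMap hU
  refine ⟨Matrix.of M, b, ?_, fun k => sub_eq_iff_eq_add'.mp (hb k), he⟩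
  ext k l
  apply algebraMap_injective hU.nonempty
  rw [Matrix.transpose_apply, Matrix.neg_apply, Matrix.of_apply, Matrix.of_apply, map_neg, ← hM,
    ← hM]
  exact sum_apply_eCoord_mul_skew w k l

theorem frameComb_eq_add_smul {A : Type} [CommRing A] [Algebra ℝ A]
    {D₁ D₂ D₃ D₄ D₅ D₆ : VField A} (a₁ a₂ g p₁ p₂ r r' : A) :
    frameComb D₁ D₂ D₃ D₄ D₅ D₆ a₁ a₂ g p₁ p₂ r =
      (r - r') • D₆ + frameComb D₁ D₂ D₃ D₄ D₅ D₆ a₁ a₂ g p₁ p₂ r' := by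
  simp only [frameComb]
  module

theorem isIntegralPair_X₁_Y₁ : IsIntegralPair (U := U) (E 0 + P₂) (E 0 - P₂) :=
  ⟨eta_X₁, eta_Y₁, pseudosphericalForms.d₁_θ_X₁_Y₁, pseudosphericalForms.ψ_X₁_Y₁⟩

theorem isIntegralPair_X₁_Y₂ : IsIntegralPair (U := U) (E 0 + P₂) (E 1 + P₁) :=
  ⟨eta_X₁, eta_Y₂, pseudosphericalForms.d₁_θ_X₁_Y₂, pseudosphericalForms.ψ_X₁_Y₂⟩

theorem isIntegralPair_X₂_Y₁ : IsIntegralPair (U := U) (E 1 - P₁) (E 0 - P₂) :=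
  ⟨eta_X₂, eta_Y₁, pseudosphericalForms.d₁_θ_X₂_Y₁, pseudosphericalForms.ψ_X₂_Y₁⟩

theorem isIntegralPair_X₂_Y₂ : IsIntegralPair (U := U) (E 1 - P₁) (E 1 + P₁) :=
  ⟨eta_X₂, eta_Y₂, pseudosphericalForms.d₁_θ_X₂_Y₂, pseudosphericalForms.ψ_X₂_Y₂⟩

theorem lieDeriv_eta_eq_zero {v : VField (smoothFunctions U)}
    (hv : v ∈ infinitesimalSymmetries (pseudosphericalGenerators U))
    (X : VField (smoothFunctions U)) (hX : eta U 2 ![X] = 0) : lieDeriv v (eta U 2) ![X] = 0 :=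
  apply_eq_zero_of_memIdeal_one hX (hv 1 _ memIdeal_eta)

theorem exists_eq_add_generatedField {v : VField (smoothFunctions U)}
    (hv : v ∈ infinitesimalSymmetries (pseudosphericalGenerators U)) :
    ∃ f g : smoothFunctions U, EuclideanEquations (E 0) (E 1) (E 2) P₁ P₂ R g ∧
      v = f • R + generatedField (E 0) (E 1) (E 2) P₁ P₂ R g := by
  have hθ := lieDeriv_eta_eq_zero hv
  have hψ := hv 2 _ memIdeal_psi
  have h11 := isIntegralPair_X₁_Y₁.apply_eq_zero hψ
  have h12 := isIntegralPair_X₁_Y₂.apply_eq_zero hψ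
  have h21 := isIntegralPair_X₂_Y₁.apply_eq_zero hψ
  have h22 := isIntegralPair_X₂_Y₂.apply_eq_zero hψ
  clear hψ hv
  obtain ⟨a₁, a₂, g, p₁, p₂, r, rfl⟩ := exists_eq_frameComb v
  have hg := pseudosphericalForms.determiningEquations hθ h11 h12 h21 h22
  obtain ⟨rfl, rfl, rfl, rfl, -⟩ := pseudosphericalForms.contact_equations hθ
  -- The multiple of R split off is r - E₂P₁ g, the excess over the spin of the generated field.
  exact ⟨_, g, DeterminingEquations.euclidean (euclideanBrackets U) hg,
    frameComb_eq_add_smul _ _ _ _ _ _ _⟩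

theorem generatedField_mem_euclideanMotions {g : smoothFunctions U}
    (hg : EuclideanEquations (E 0) (E 1) (E 2) P₁ P₂ R g)
    (hU : IsConnected (U : Set FrameBundle)) :
    generatedField (E 0) (E 1) (E 2) P₁ P₂ R g ∈ euclideanMotions U := by
  have H := euclideanBrackets U
  refine mem_euclideanMotions_of_lie_eq_zero (fun i => ?_) (hg.lie_P₁ H) (hg.lie_P₂ H)
    (hg.lie_R H) hU
  fin_cases i
  exacts [hg.lie_E₁ H, hg.lie_E₂ H, hg.lie_E₃ H]

theorem infinitesimalSymmetries_le (hU : IsConnected (U : Set FrameBundle)) :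
    infinitesimalSymmetries (pseudosphericalGenerators U) ≤
      frameRotations U ⊔ euclideanMotions U := by
  intro v hv
  obtain ⟨f, g, hg, rfl⟩ := exists_eq_add_generatedField hv
  exact Submodule.add_mem_sup (smul_spinField_mem_frameRotations f)
    (generatedField_mem_euclideanMotions hg hU)

end FrameBundle

end

noncomputable section

/-! ### Cauchy characteristics and Euclidean motions -/

open DForm

namespace PseudosphericalForms

variable {A : Type} [CommRing A] [Algebra ℝ A] {E₁ E₂ E₃ P₁ P₂ R : VField A} {θ : DForm A 1}
  {ψ : DForm A 2} (H : PseudosphericalForms E₁ E₂ E₃ P₁ P₂ R θ ψ) (a₁ a₂ g p₁ p₂ r : A)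
include H

theorem d₁_θ_R : d₁ θ ![R, frameComb E₁ E₂ E₃ P₁ P₂ R a₁ a₂ g p₁ p₂ r] = 0 := by
  rw [d₁_apply, ← lie_skew, H.brackets.lie_frameComb_R,
    H.θ_apply, apply_one_neg, H.θ_apply, H.θ_R, map_zero]
  ring

theorem ψ_R : ψ ![R, frameComb E₁ E₂ E₃ P₁ P₂ R a₁ a₂ g p₁ p₂ r] = 0 := by
  have h : frameComb E₁ E₂ E₃ P₁ P₂ R 0 0 0 0 0 1 = R := by
    simp only [frameComb]
    module
  have := H.ψ_apply 0 0 0 0 0 1 a₁ a₂ g p₁ p₂ r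
  rw [h] at this
  rw [this]
  ring

/-- The derivative of f enters only the R-component, which θ and ψ ignore. Preservation of θ and ψ
by f R thus reduces to invariance under R. -/
theorem lie_smul_R (f : A) : ⁅f • R, frameComb E₁ E₂ E₃ P₁ P₂ R a₁ a₂ g p₁ p₂ r⁆ =
    frameComb E₁ E₂ E₃ P₁ P₂ R (f * (R a₁ - a₂)) (f * (R a₂ + a₁)) (f * R g) (f * (R p₁ - p₂))
      (f * (R p₂ + p₁)) (f * R r - frameComb E₁ E₂ E₃ P₁ P₂ R a₁ a₂ g p₁ p₂ r f) := by
  rw [lie_smul_left, ← lie_skew, H.brackets.lie_frameComb_R]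
  generalize frameComb E₁ E₂ E₃ P₁ P₂ R a₁ a₂ g p₁ p₂ r f = s
  simp only [frameComb]
  module

theorem lieDeriv_smul_R_θ (f : A) :
    lieDeriv (f • R) θ ![frameComb E₁ E₂ E₃ P₁ P₂ R a₁ a₂ g p₁ p₂ r] = 0 := by
  rw [lieDeriv_one_apply, H.lie_smul_R, H.θ_apply, H.θ_apply, Derivation.smul_apply, smul_eq_mul,
    sub_self]

theorem lieDeriv_smul_R_ψ (f b₁ b₂ h q₁ q₂ s : A) :
    lieDeriv (f • R) ψ ![frameComb E₁ E₂ E₃ P₁ P₂ R a₁ a₂ g p₁ p₂ r,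
      frameComb E₁ E₂ E₃ P₁ P₂ R b₁ b₂ h q₁ q₂ s] = 0 := by
  rw [lieDeriv_two_apply, H.lie_smul_R, H.lie_smul_R, H.ψ_apply, H.ψ_apply, H.ψ_apply,
    Derivation.smul_apply]
  simp only [map_add, map_sub, Derivation.leibniz, smul_eq_mul]
  ring

end PseudosphericalForms

theorem DForm.interior_smul_eq_zero {A : Type} [CommRing A] [Algebra ℝ A] {k : ℕ} (f : A)
    {v : VField A} {φ : DForm A (k + 1)} (h : interior v φ = 0) : interior (f • v) φ = 0 := by
  rw [interior] at h
  rw [interior, map_smul, h, smul_zero]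

theorem DForm.interior_apply_one {A : Type} [CommRing A] [Algebra ℝ A] (v X : VField A)
    (φ : DForm A 2) : interior v φ ![X] = φ ![v, X] := rfl

theorem DForm.d₁_zero {A : Type} [CommRing A] [Algebra ℝ A] : d₁ (0 : DForm A 1) = 0 :=
  two_ext fun X Y => by simp [d₁_apply]

theorem DForm.lieDeriv_wedge_eq_zero {A : Type} [CommRing A] [Algebra ℝ A] {v : VField A}
    {α β : DForm A 1} (hα : lieDeriv v α = 0) (hβ : lieDeriv v β = 0) :
    lieDeriv v (wedge α β : DForm A 2) = 0 := by
  have h : lieDeriv v (wedge α β : DForm A 2) =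
    wedge (lieDeriv v α) β + wedge α (lieDeriv v β) := lieDeriv_wedge v α β
  rw [h, hα, hβ]
  exact two_ext fun X Y => by
    rw [wedge_add_wedge_apply]
    simp

/-- An infinitesimal rotation preserves the inner product. -/
theorem sum_mul_add_sum_mul_eq_zero {A : Type} [CommRing A] [Algebra ℝ A]
    {M : Matrix (Fin 3) (Fin 3) ℝ} (hM : M.transpose = -M) (a c : Fin 3 → A) :
    ∑ k, (∑ l, M k l • a l) * c k + ∑ k, a k * ∑ l, M k l • c l = 0 := by
  simp only [Finset.sum_mul, Finset.mul_sum]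
  rw [Finset.sum_comm, ← Finset.sum_add_distrib]
  refine Finset.sum_eq_zero fun k _ => ?_
  rw [← Finset.sum_add_distrib]
  refine Finset.sum_eq_zero fun l _ => ?_
  have h : M k l = -M l k := congrFun (congrFun hM l) k
  rw [h, smul_mul_assoc, mul_smul_comm, neg_smul, add_neg_cancel]

namespace FrameBundle

variable {U : TopologicalSpace.Opens FrameBundle}

local notation "E" => translationField U
local notation "P₁" => tiltField₁ U
local notation "P₂" => tiltField₂ U
local notation "R" => spinField U

theorem interior_smul_spinField_eq_zero (f : smoothFunctions U) (k : ℕ)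
    (φ : DForm (smoothFunctions U) (k + 1)) (hφ : φ ∈ pseudosphericalGenerators U (k + 1)) :
    interior (f • R) φ = 0 := by
  have h : interior R φ = 0 := by
    match k, φ, hφ with
    | 0, φ, hφ =>
      obtain rfl : φ = eta U 2 := hφ
      ext w
      have : interior R (eta U 2) w = eta U 2 ![R] := by
        rw [Subsingleton.elim w ![]]
        rfl
      rw [this, eta_R]
      rfl
    | 1, φ, hφ =>
      refine one_ext fun X => ?_
      rw [interior_apply_one]
      obtain ⟨a₁, a₂, g, p₁, p₂, r, rfl⟩ := exists_eq_frameComb X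
      rcases hφ with rfl | rfl
      · exact pseudosphericalForms.d₁_θ_R a₁ a₂ g p₁ p₂ r
      · exact pseudosphericalForms.ψ_R a₁ a₂ g p₁ p₂ r
    | k + 2, _, hφ => exact hφ.elim
  exact interior_smul_eq_zero f h

theorem frameRotations_le_cauchyCharacteristics :
    frameRotations U ≤ cauchyCharacteristics (pseudosphericalGenerators U) := by
  intro v hv
  obtain ⟨f, rfl⟩ := mem_frameRotations_iff.mp hv
  intro k φ hφ
  refine MemIdeal.interior (fun k φ hφ => ?_) hφ
  rw [interior_smul_spinField_eq_zero f k φ hφ]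
  exact .zero

/-- The generators η³ and dη³ suffice: the first kills g, and pairing dη³ with P₁, P₂, E₁, E₂ in ker
η³ kills a₁, a₂, p₁, p₂. -/
theorem cauchyCharacteristics_le_frameRotations :
    cauchyCharacteristics (pseudosphericalGenerators U) ≤ frameRotations U := by
  intro v hv
  have h0 : eta U 2 ![v] = 0 := eq_zero_of_memIdeal_zero (hv 0 _ memIdeal_eta) ![]
  have h1 : ∀ X, eta U 2 ![X] = 0 → d₁ (eta U 2) ![v, X] = 0 := fun X hX =>
    apply_eq_zero_of_memIdeal_one hX (hv 1 _ memIdeal_d₁_eta)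
  clear hv
  obtain ⟨a₁, a₂, g, p₁, p₂, r, rfl⟩ := exists_eq_frameComb v
  have H := pseudosphericalForms (U := U)
  have hg : g = 0 := (H.θ_apply a₁ a₂ g p₁ p₂ r).symm.trans h0
  have ha₁ : a₁ = 0 := (H.d₁_θ_P₁ a₁ a₂ g p₁ p₂ r).symm.trans (h1 _ H.θ_P₁)
  have ha₂ : a₂ = 0 := (H.d₁_θ_P₂ a₁ a₂ g p₁ p₂ r).symm.trans (h1 _ H.θ_P₂)
  have hp₁ : p₁ = 0 := neg_eq_zero.mp ((H.d₁_θ_E₁ a₁ a₂ g p₁ p₂ r).symm.trans (h1 _ H.θ_E₁))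
  have hp₂ : p₂ = 0 := neg_eq_zero.mp ((H.d₁_θ_E₂ a₁ a₂ g p₁ p₂ r).symm.trans (h1 _ H.θ_E₂))
  subst hg ha₁ ha₂ hp₁ hp₂
  refine mem_frameRotations_iff.mpr ⟨r, ?_⟩
  rw [frameComb_eq_add_smul _ _ _ _ _ _ 0, frameComb_eq_zero rfl rfl rfl rfl rfl rfl, sub_zero,
    add_zero]

theorem cauchyCharacteristics_eq :
    cauchyCharacteristics (pseudosphericalGenerators U) = frameRotations U :=
  le_antisymm cauchyCharacteristics_le_frameRotations frameRotations_le_cauchyCharacteristics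

/-- The generator dη³ needs no hypothesis of its own, as the Lie derivative commutes with d. -/
theorem mem_infinitesimalSymmetries {v : VField (smoothFunctions U)}
    (hθ : lieDeriv v (eta U 2) = 0) (hψ : lieDeriv v (psi U) = 0) :
    v ∈ infinitesimalSymmetries (pseudosphericalGenerators U) := by
  intro k φ hφ
  refine MemIdeal.lieDeriv (fun k φ hφ => ?_) hφ
  have h : lieDeriv v φ = 0 := by
    match k, φ, hφ with
    | 0, _, hφ => exact hφ.elim
    | 1, φ, hφ =>
      obtain rfl : φ = eta U 2 := hφ
      exact hθ
    | 2, φ, hφ =>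
      rcases hφ with rfl | rfl
      · rw [lieDeriv_d₁, hθ, d₁_zero]
      · exact hψ
    | k + 3, _, hφ => exact hφ.elim
  rw [h]
  exact .zero

theorem frameRotations_le_infinitesimalSymmetries :
    frameRotations U ≤ infinitesimalSymmetries (pseudosphericalGenerators U) := by
  intro v hv
  obtain ⟨f, rfl⟩ := mem_frameRotations_iff.mp hv
  refine mem_infinitesimalSymmetries (one_ext fun X => ?_) (two_ext fun X Y => ?_)
  · obtain ⟨a₁, a₂, g, p₁, p₂, r, rfl⟩ := exists_eq_frameComb X
    exact pseudosphericalForms.lieDeriv_smul_R_θ a₁ a₂ g p₁ p₂ r f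
  · obtain ⟨a₁, a₂, g, p₁, p₂, r, rfl⟩ := exists_eq_frameComb X
    obtain ⟨b₁, b₂, h, q₁, q₂, s, rfl⟩ := exists_eq_frameComb Y
    exact pseudosphericalForms.lieDeriv_smul_R_ψ a₁ a₂ g p₁ p₂ r f b₁ b₂ h q₁ q₂ s

/-- A form `∑ fₖ dgₖ` is preserved by `v` if `f` and `g` rotate with the same velocity. -/
theorem _root_.DForm.lieDeriv_sum_smul_d₀_eq_zero {A : Type} [CommRing A] [Algebra ℝ A]
    {v : VField A} {M : Matrix (Fin 3) (Fin 3) ℝ} (hM : M.transpose = -M) {f g : Fin 3 → A}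
    {b : Fin 3 → ℝ} (hf : ∀ k, v (f k) = ∑ l, M k l • f l)
    (hg : ∀ k, v (g k) = ∑ l, M k l • g l + algebraMap ℝ A (b k)) :
    lieDeriv v (∑ k, f k • d₀ (g k)) = 0 := by
  refine one_ext fun X => ?_
  rw [lieDeriv_sum, finset_sum_apply, AlternatingMap.zero_apply,
    ← sum_mul_add_sum_mul_eq_zero hM f fun k => X (g k), ← Finset.sum_add_distrib]
  refine Finset.sum_congr rfl fun k _ => ?_
  rw [lieDeriv_smul_d₀, AlternatingMap.add_apply, AlternatingMap.smul_apply,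
    AlternatingMap.smul_apply, d₀_apply, d₀_apply, hf, hg, map_add, Derivation.map_algebraMap,
    map_sum, add_zero, smul_eq_mul, smul_eq_mul]
  simp only [Derivation.map_smul]

theorem euclideanMotions_le_infinitesimalSymmetries :
    euclideanMotions U ≤ infinitesimalSymmetries (pseudosphericalGenerators U) := by
  rintro v ⟨M, b, hM, hx, he⟩
  have hη : ∀ i, lieDeriv v (eta U i) = 0 := fun i =>
    lieDeriv_sum_smul_d₀_eq_zero hM (he i) hx
  have hω : ∀ i j, lieDeriv v (etaConn U i j) = 0 := fun i j =>
    lieDeriv_sum_smul_d₀_eq_zero (b := 0) hM (he i) fun k => by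
      rw [he, Pi.zero_apply, map_zero, add_zero]
  refine mem_infinitesimalSymmetries (hη 2) ?_
  rw [psi, lieDeriv_add, lieDeriv_wedge_eq_zero (hω _ _) (hω _ _),
    lieDeriv_wedge_eq_zero (hη _) (hη _), add_zero]

end FrameBundle

end

noncomputable section

/-! ### The dimension of the space of symmetries -/

/-- The hypotheses say that F followed by the quotient map is injective and surjective, hence an
isomorphism. -/
theorem finrank_symmetriesModCauchy_eq {A W : Type} [CommRing A] [Algebra ℝ A] [AddCommGroup W]
    [Module ℝ W] (G : ∀ k : ℕ, Set (DForm A k)) (F : W →ₗ[ℝ] VField A)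
    (hF : ∀ p, F p ∈ infinitesimalSymmetries G)
    (hinj : ∀ p, F p ∈ cauchyCharacteristics G → p = 0)
    (hsurj : ∀ v ∈ infinitesimalSymmetries G, ∃ p, v - F p ∈ cauchyCharacteristics G) :
    Module.finrank ℝ (SymmetriesModCauchy G) = Module.finrank ℝ W := by
  let Q : W →ₗ[ℝ] SymmetriesModCauchy G :=
    (Submodule.mkQ _).comp (F.codRestrict (infinitesimalSymmetries G) hF)
  refine (LinearEquiv.ofBijective Q ⟨?_, fun s => ?_⟩).finrank_eq.symm
  · exact (injective_iff_map_eq_zero _).mpr fun p hp =>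
      hinj p ((Submodule.Quotient.mk_eq_zero
        ((cauchyCharacteristics G).submoduleOf (infinitesimalSymmetries G))).mp hp)
  · obtain ⟨⟨v, hv⟩, rfl⟩ := Submodule.Quotient.mk_surjective _ s
    obtain ⟨p, hp⟩ := hsurj v hv
    exact ⟨p, ((Submodule.Quotient.eq
      ((cauchyCharacteristics G).submoduleOf (infinitesimalSymmetries G))
      (x := ⟨v, hv⟩) (y := ⟨F p, hF p⟩)).mpr hp).symm⟩

namespace FrameBundle

open DForm

variable {U : TopologicalSpace.Opens FrameBundle}

local notation "E" => translationField U
local notation "P₁" => tiltField₁ U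
local notation "P₂" => tiltField₂ U
local notation "R" => spinField U

/-- Skewness of ω is the tangency condition for orthonormal frames; the field is then written down
in the moving frame. -/
theorem exists_vfield (a : Fin 3 → smoothFunctions U) {ω : Fin 3 → Fin 3 → smoothFunctions U}
    (hω : ∀ i j, ω i j + ω j i = 0) :
    ∃ v : VField (smoothFunctions U), (∀ k, v (xCoord U k) = ∑ i, a i * eCoord U i k) ∧
      ∀ j k, v (eCoord U j k) = ∑ i, ω i j * eCoord U i k := by
  have hs : ∀ i, ω i i = 0 := fun i => eq_zero_of_two_mul (by rw [two_mul, hω])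
  have h01 := hω 0 1
  have h02 := hω 0 2
  have h12 := hω 1 2
  refine ⟨a 0 • E 0 + a 1 • E 1 + a 2 • E 2 + ω 2 0 • P₁ + ω 2 1 • P₂ + ω 1 0 • R,
    fun k => ?_, fun j k => ?_⟩
  · simp only [Fin.sum_univ_three, Derivation.add_apply,
      Derivation.smul_apply, smul_eq_mul, translationField_xCoord,
      tiltField₁_xCoord, tiltField₂_xCoord, spinField_xCoord]
    ring
  · fin_cases j <;> simp only [Fin.sum_univ_three, Derivation.add_apply, Derivation.smul_apply,
      smul_eq_mul, translationField_eCoord, Fin.zero_eta, Fin.mk_one, Fin.reduceFinMk, hs]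
    · simp only [tiltField₁_eCoord_zero, tiltField₂_eCoord_zero, spinField_eCoord_zero]
      ring
    · simp only [tiltField₁_eCoord_one, tiltField₂_eCoord_one, spinField_eCoord_one]
      linear_combination -eCoord U 0 k * h01
    · simp only [tiltField₁_eCoord_two, tiltField₂_eCoord_two, spinField_eCoord_two]
      linear_combination -eCoord U 0 k * h02 - eCoord U 1 k * h12

theorem sum_sum_eCoord_mul (y : Fin 3 → smoothFunctions U) (l : Fin 3) :
    ∑ i, (∑ k, eCoord U i k * y k) * eCoord U i l = y l := by
  simp only [Finset.sum_mul]
  rw [Finset.sum_comm]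
  have h : ∀ k, ∑ i, eCoord U i k * y k * eCoord U i l = y k * if k = l then 1 else 0 := fun k => by
    rw [← sum_eCoord_mul_eCoord', Finset.mul_sum]
    exact Finset.sum_congr rfl fun i _ => by ring
  simp only [h, mul_ite, mul_one, mul_zero, Finset.sum_ite_eq', Finset.mem_univ, if_true]

/-- The vector field that is induced by the Euclidean motion with velocity field `y ↦ M y + b`. -/
theorem exists_euclideanMotion {M : Matrix (Fin 3) (Fin 3) ℝ} (hM : M.transpose = -M)
    (b : Fin 3 → ℝ) : ∃ v : VField (smoothFunctions U),
      (∀ k, v (xCoord U k) = ∑ l, M k l • xCoord U l + algebraMap ℝ _ (b k)) ∧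
      ∀ i k, v (eCoord U i k) = ∑ l, M k l • eCoord U i l := by
  obtain ⟨v, hx, he⟩ := exists_vfield (U := U)
    (fun i => ∑ k, eCoord U i k * (∑ l, M k l • xCoord U l + algebraMap ℝ _ (b k)))
    (ω := fun i j => ∑ k, eCoord U i k * ∑ l, M k l • eCoord U j l) fun i j => by
      rw [← sum_mul_add_sum_mul_eq_zero hM (eCoord U i) (eCoord U j), add_comm]
      exact congrArg₂ _ (Finset.sum_congr rfl fun k _ => mul_comm _ _) rfl
  exact ⟨v, fun k => (hx k).trans (sum_sum_eCoord_mul _ k),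
    fun j k => (he j k).trans (sum_sum_eCoord_mul (fun k => ∑ l, M k l • eCoord U j l) k)⟩

/-! ### Parametrization of the Euclidean motions by ℝ³ × ℝ³ -/

/-- The matrix of the cross product with `m`. -/
def crossMatrix (m : Fin 3 → ℝ) : Matrix (Fin 3) (Fin 3) ℝ :=
  !![0, -m 2, m 1; m 2, 0, -m 0; -m 1, m 0, 0]

theorem crossMatrix_transpose (m : Fin 3 → ℝ) : (crossMatrix m).transpose = -crossMatrix m := by
  ext i j
  fin_cases i <;> fin_cases j <;> simp [crossMatrix]

theorem crossMatrix_add (m m' : Fin 3 → ℝ) :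
    crossMatrix (m + m') = crossMatrix m + crossMatrix m' := by
  ext i j
  fin_cases i <;> fin_cases j <;> simp [crossMatrix, add_comm]

theorem crossMatrix_smul (c : ℝ) (m : Fin 3 → ℝ) : crossMatrix (c • m) = c • crossMatrix m := by
  ext i j
  fin_cases i <;> fin_cases j <;> simp [crossMatrix]

theorem exists_eq_crossMatrix {M : Matrix (Fin 3) (Fin 3) ℝ} (hM : M.transpose = -M) :
    ∃ m, M = crossMatrix m := by
  have h : ∀ i j, M j i = -M i j := fun i j => congrFun (congrFun hM i) j
  have h0 := h 0 0
  have h1 := h 1 1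
  have h2 := h 2 2
  refine ⟨![M 2 1, M 0 2, M 1 0], ?_⟩
  ext i j
  fin_cases i <;> fin_cases j <;> simp [crossMatrix] <;> first | linarith | exact h _ _

variable (U) in
/-- The vector field that is induced by the velocity field `y ↦ m × y + b`. -/
def euclideanField (p : (Fin 3 → ℝ) × (Fin 3 → ℝ)) : VField (smoothFunctions U) :=
  (exists_euclideanMotion (crossMatrix_transpose p.1) p.2).choose

theorem euclideanField_xCoord (p : (Fin 3 → ℝ) × (Fin 3 → ℝ)) (k : Fin 3) :
    euclideanField U p (xCoord U k) =
      ∑ l, crossMatrix p.1 k l • xCoord U l + algebraMap ℝ _ (p.2 k) :=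
  (exists_euclideanMotion (crossMatrix_transpose p.1) p.2).choose_spec.1 k

theorem euclideanField_eCoord (p : (Fin 3 → ℝ) × (Fin 3 → ℝ)) (i k : Fin 3) :
    euclideanField U p (eCoord U i k) = ∑ l, crossMatrix p.1 k l • eCoord U i l :=
  (exists_euclideanMotion (crossMatrix_transpose p.1) p.2).choose_spec.2 i k

theorem euclideanField_mem (p : (Fin 3 → ℝ) × (Fin 3 → ℝ)) :
    euclideanField U p ∈ euclideanMotions U :=
  ⟨_, _, crossMatrix_transpose p.1, euclideanField_xCoord p, euclideanField_eCoord p⟩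

theorem exists_eq_euclideanField {v : VField (smoothFunctions U)} (hv : v ∈ euclideanMotions U) :
    ∃ p, v = euclideanField U p := by
  obtain ⟨M, b, hM, hx, he⟩ := hv
  obtain ⟨m, rfl⟩ := exists_eq_crossMatrix hM
  exact ⟨(m, b), vfield_ext (fun k => (hx k).trans (euclideanField_xCoord (m, b) k).symm)
    fun i k => (he i k).trans (euclideanField_eCoord (m, b) i k).symm⟩

theorem euclideanField_add (p q : (Fin 3 → ℝ) × (Fin 3 → ℝ)) :
    euclideanField U (p + q) = euclideanField U p + euclideanField U q := by
  refine vfield_ext (fun k => ?_) fun i k => ?_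
  · rw [Derivation.add_apply, euclideanField_xCoord, euclideanField_xCoord, euclideanField_xCoord,
      Prod.fst_add, Prod.snd_add, crossMatrix_add, Pi.add_apply, map_add, add_add_add_comm,
      ← Finset.sum_add_distrib]
    simp only [Matrix.add_apply, add_smul]
  · rw [Derivation.add_apply, euclideanField_eCoord, euclideanField_eCoord, euclideanField_eCoord,
      Prod.fst_add, crossMatrix_add, ← Finset.sum_add_distrib]
    simp only [Matrix.add_apply, add_smul]

theorem euclideanField_smul (c : ℝ) (p : (Fin 3 → ℝ) × (Fin 3 → ℝ)) :
    euclideanField U (c • p) = c • euclideanField U p := by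
  refine vfield_ext (fun k => ?_) fun i k => ?_
  · rw [Derivation.smul_apply, euclideanField_xCoord, euclideanField_xCoord, Prod.smul_fst,
      Prod.smul_snd, crossMatrix_smul, Pi.smul_apply, smul_add, Finset.smul_sum, smul_eq_mul,
      map_mul, Algebra.smul_def c (algebraMap _ _ _)]
    simp only [Matrix.smul_apply, smul_eq_mul, mul_smul]
  · rw [Derivation.smul_apply, euclideanField_eCoord, euclideanField_eCoord, Prod.smul_fst,
      crossMatrix_smul, Finset.smul_sum]
    simp only [Matrix.smul_apply, smul_eq_mul, mul_smul]

/-- A Euclidean motion that fixes the base point is trivial. -/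
theorem eq_zero_of_euclideanField_xCoord_eq_zero (hU : (U : Set FrameBundle).Nonempty)
    {p : (Fin 3 → ℝ) × (Fin 3 → ℝ)} (hp : ∀ k, euclideanField U p (xCoord U k) = 0) : p = 0 := by
  have hM : ∀ k j, crossMatrix p.1 k j = 0 := fun k j => by
    apply algebraMap_injective hU
    -- Differentiating M x + b = 0 along `E i` gives M eᵢ = 0, and the eᵢ span, so M = 0. An open U
    -- leaves room for this.
    have h : ∀ i, ∑ l, algebraMap ℝ (smoothFunctions U) (crossMatrix p.1 k l) * eCoord U i l = 0 :=
      fun i => by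
        have := congrArg (E i) ((euclideanField_xCoord p k).symm.trans (hp k))
        rw [map_zero, map_add, Derivation.map_algebraMap, add_zero, map_sum] at this
        rw [← this]
        refine Finset.sum_congr rfl fun l _ => ?_
        rw [Derivation.map_smul, translationField_xCoord, Algebra.smul_def]
    rw [map_zero,
      ← sum_sum_eCoord_mul (fun l => algebraMap ℝ (smoothFunctions U) (crossMatrix p.1 k l)) j]
    refine Finset.sum_eq_zero fun i _ => ?_
    have h' := h i
    simp only [mul_comm (algebraMap ℝ (smoothFunctions U) _)] at h'
    rw [h', zero_mul]
  have hb : ∀ k, p.2 k = 0 := fun k => by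
    apply algebraMap_injective hU
    have := (euclideanField_xCoord p k).symm.trans (hp k)
    simp only [hM, zero_smul, Finset.sum_const_zero, zero_add] at this
    rw [this, map_zero]
  refine Prod.ext (funext fun i => ?_) (funext hb)
  fin_cases i
  exacts [hM 2 1, hM 0 2, hM 1 0]

variable (U) in
/-- The infinitesimal Euclidean motions, parametrized by angular velocity and velocity. -/
def euclideanFieldₗ : ((Fin 3 → ℝ) × (Fin 3 → ℝ)) →ₗ[ℝ] VField (smoothFunctions U) where
  toFun := euclideanField U
  map_add' := euclideanField_add
  map_smul' := euclideanField_smul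

theorem eq_zero_of_euclideanField_mem (hU : (U : Set FrameBundle).Nonempty)
    (p : (Fin 3 → ℝ) × (Fin 3 → ℝ))
    (h : euclideanField U p ∈ cauchyCharacteristics (pseudosphericalGenerators U)) : p = 0 := by
  obtain ⟨f, hf⟩ := cauchyCharacteristics_le_frameRotations h
  exact eq_zero_of_euclideanField_xCoord_eq_zero hU fun k => (hf k).1

theorem exists_sub_mem_cauchyCharacteristics (hU : IsConnected (U : Set FrameBundle))
    (v : VField (smoothFunctions U))
    (hv : v ∈ infinitesimalSymmetries (pseudosphericalGenerators U)) :
    ∃ p, v - euclideanField U p ∈ cauchyCharacteristics (pseudosphericalGenerators U) := by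
  obtain ⟨c, hc, e, he, rfl⟩ := Submodule.mem_sup.mp (infinitesimalSymmetries_le hU hv)
  obtain ⟨p, rfl⟩ := exists_eq_euclideanField he
  refine ⟨p, frameRotations_le_cauchyCharacteristics ?_⟩
  convert hc using 1
  exact add_sub_cancel_right c _

/-- As `Module.finrank` is 0 in infinite dimension, the value 6 includes finite-dimensionality of
the quotient. -/
theorem finrank_symmetriesModCauchy (hU : IsConnected (U : Set FrameBundle)) :
    Module.finrank ℝ (SymmetriesModCauchy (pseudosphericalGenerators U)) = 6 := by
  rw [finrank_symmetriesModCauchy_eq (pseudosphericalGenerators U) (euclideanFieldₗ U)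
    (fun p => euclideanMotions_le_infinitesimalSymmetries (euclideanField_mem p))
    (eq_zero_of_euclideanField_mem hU.nonempty) (exists_sub_mem_cauchyCharacteristics hU)]
  simp

end FrameBundle

end

theorem mainTheorem5 (U : TopologicalSpace.Opens FrameBundle)
    (hU : U = ⊤ ∨ IsConnected (U : Set FrameBundle)) :
    infinitesimalSymmetries (FrameBundle.pseudosphericalGenerators U) =
        cauchyCharacteristics (FrameBundle.pseudosphericalGenerators U) ⊔
          FrameBundle.euclideanMotions U ∧
      cauchyCharacteristics (FrameBundle.pseudosphericalGenerators U) =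
        FrameBundle.frameRotations U ∧
      Module.finrank ℝ
        (SymmetriesModCauchy (FrameBundle.pseudosphericalGenerators U)) = 6 := by
  -- For U = ⊤ this is connectedness of ℝ³ × SO(3). It matters for the first and third claims; the
  -- description of the Cauchy characteristics holds on any open U.
  have hc : IsConnected (U : Set FrameBundle) := by
    rcases hU with rfl | h
    · exact FrameBundle.isConnected_univ_frameBundle
    · exact h
  refine ⟨?_, FrameBundle.cauchyCharacteristics_eq, FrameBundle.finrank_symmetriesModCauchy hc⟩
  rw [FrameBundle.cauchyCharacteristics_eq]
  exact le_antisymm (FrameBundle.infinitesimalSymmetries_le hc)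
    (sup_le FrameBundle.frameRotations_le_infinitesimalSymmetries
      FrameBundle.euclideanMotions_le_infinitesimalSymmetries)
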